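/- \textbf{Conventions.} A \emph{CAT(0) cube complex} is a simply connected cube complex in which the link of every vertex is a flag simplicial complex; a subcomplex is \emph{convex} if it is full and contains every vertex on a combinatorial geodesic between two of its vertices. Distances are measured in the path metric of the 1-skeleton. A \emph{cubulated group} $G\curvearrowright X$ is a group $G$ with a proper cocompact action by automorphisms on a CAT(0) cube complex $X$. A hyperplane $H$ of $X$ has a carrier $H\times[-1,1]\subset X$, and the convex subcomplexes $H\times\{\pm1\}$ are called \emph{combinatorial hyperplanes}. Two convex subcomplexes are \emph{parallel} if they are crossed by the same hyperplanes; a subcomplex is \emph{nontrivial} if it has at least two vertices. For a convex subcomplex $K$, $\mathfrak g_K:X\to K$ is the closest point projection. A \emph{factor system} on $X$ is a collection $\mathfrak F$ of subcomplexes of $X$ such that (1) $X\in\mathfrak F$; (2) every $F\in\mathfrak F$ is a nonempty convex subcomplex; (3) there is $\Delta\ge 0$ such that every vertex of $X$ lies in at most $\Delta$ elements of $\mathfrak F$; (4) every nontrivial convex subcomplex parallel to a combinatorial hyperplane of $X$ is in $\mathfrak F$; (5) there is $\xi\ge0$ such that for all $F,F'\in\mathfrak F$ either $\mathfrak g_F(F')\in\mathfrak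 F$ or $\operatorname{diam}\mathfrak g_F(F')<\xi$. \textbf{Theorem.} (a) There is a cubulated group $G\curvearrowright X$ such that $X$ has no factor system. (b) Let $T_1,T_2$ be locally finite trees and let $\Gamma$ be a group acting freely and cocompactly by automorphisms on the square complex $T_1\times T_2$. Let $g_1,g_2\in\Gamma$ form an \emph{anti-torus}: there are bi-infinite geodesics $\ell_1\subset T_1$, $\ell_2\subset T_2$ and vertices $p_1\in\ell_1$, $p_2\in\ell_2$ such that $g_1$ translates nontrivially along $\ell_1\times\{p_2\}$, $g_2$ translates nontrivially along $\{p_1\}\times\ell_2$, and $g_1^m,g_2^n$ do not commute for any nonzero integers $m,n$. Suppose that neither $g_1$ nor $g_2$ is a proper power in $\Gamma$. Let $\tau_1$ be the translation length of $g_1$ along $\ell_1\times\{p_2\}$, let $Z$ be the square complex obtained from $(T_1\times T_2)/\Gamma$ by attaching an annulus subdivided into $\tau_1$ squares, where one boundary component is glued along the edge loop of length $\tau_1$ to which $\ell_1\times\{p_2\}$ descends, and let $X$ be the universal cover of $Z$ (it exists). Then $\Gamma$ acts freely on $X$ as the group of deck transformations, $\Gamma\curvearrowright X$ is a cubulated group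 (in particular $X$ is a CAT(0) cube complex), and $X$ has no factor system. -/

import Mathlib

universe u v

/-! ## Cube complexes -/

/-- The corners of the standard `n`-cube `[0,1]ⁿ`. -/
abbrev Corner (n : ℕ) : Type := Fin n → Bool

/-- An isometric identification of the standard `m`-cube with a face of the standard `n`-cube,
recorded on corners. (A map between corner sets which preserves the Hamming distance is the same
thing as an isometry of the `m`-cube onto an `m`-dimensional face of the `n`-cube.) -/
@[ext]
structure CubeMap (m n : ℕ) where
  toFun : Corner m → Corner n
  isometry : ∀ x y, hammingDist (toFun x) (toFun y) = hammingDist x y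

namespace CubeMap

def id (n : ℕ) : CubeMap n n := ⟨fun x => x, fun _ _ => rfl⟩

def comp {l m n : ℕ} (ψ : CubeMap m n) (φ : CubeMap l m) : CubeMap l n :=
  ⟨fun x => ψ.toFun (φ.toFun x), fun x y => by rw [ψ.isometry, φ.isometry]⟩

theorem injective {m n : ℕ} (φ : CubeMap m n) : Function.Injective φ.toFun := by
  intro x y h
  have h1 := φ.isometry x y
  rw [h, hammingDist_self] at h1
  exact hammingDist_eq_zero.1 h1.symm

/-- The corner `x` of the `n`-cube. -/
def corner {n : ℕ} (x : Corner n) : CubeMap 0 n :=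
  ⟨fun _ => x, fun a b => by rw [Subsingleton.elim a b, hammingDist_self, hammingDist_self]⟩

/-- The edge of the `n`-cube in direction `i` whose other coordinates are those of `x`, oriented
from coordinate `0` to coordinate `1`. -/
def side {n : ℕ} (i : Fin n) (x : Corner n) : CubeMap 1 n :=
  ⟨fun t => Function.update x i (t 0), fun s t => by
    by_cases h : s 0 = t 0
    · have : s = t := by
        funext j
        rw [Subsingleton.elim j 0, h]
      rw [this, hammingDist_self, hammingDist_self]
    · have h1 : hammingDist s t = 1 := by
        have h0 : (Finset.univ.filter fun j => s j ≠ t j) = {0} := by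
          ext j
          rw [Subsingleton.elim j 0]
          simp [h]
        rw [hammingDist, h0, Finset.card_singleton]
      have h2 : (Finset.univ.filter fun j =>
          Function.update x i (s 0) j ≠ Function.update x i (t 0) j) = {i} := by
        ext j
        by_cases hj : j = i
        · subst hj
          simp [h]
        · simp [hj]
      rw [h1, hammingDist, h2, Finset.card_singleton]⟩

/-- The reflection of the interval. -/
def flip : CubeMap 1 1 :=
  ⟨fun t j => !(t j), fun s t => by simp [hammingDist]⟩

end CubeMap

/-- A cube complex: a complex glued from cubes along isometries of faces. `cube n` is the type of
parametrized `n`-cubes, that is `n`-cubes of the complex together with an identification with the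
standard `n`-cube; so each geometric `n`-cube occurs `2ⁿ n!` times, and `cube 1` consists of the
oriented edges. `face φ c` is the restriction of the parametrized cube `c` along `φ`. The condition
`free` says that no cube is folded onto itself by the gluing. -/
structure CubeComplex where
  cube : ℕ → Type u
  face : ∀ {m n : ℕ}, CubeMap m n → cube n → cube m
  face_id : ∀ {n : ℕ} (c : cube n), face (CubeMap.id n) c = c
  face_comp : ∀ {l m n : ℕ} (ψ : CubeMap m n) (φ : CubeMap l m) (c : cube n),
    face (ψ.comp φ) c = face φ (face ψ c)
  free : ∀ {n : ℕ} (φ : CubeMap n n) (c : cube n), face φ c = c → φ = CubeMap.id n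

namespace CubeComplex

/-- The vertices. -/
abbrev Vertex (X : CubeComplex.{u}) : Type u := X.cube 0

/-- The oriented edges. -/
abbrev Edge (X : CubeComplex.{u}) : Type u := X.cube 1

variable (X : CubeComplex.{u})

/-- The vertex of the parametrized cube `c` at the corner `x`. -/
def vert {n : ℕ} (c : X.cube n) (x : Corner n) : X.Vertex := X.face (CubeMap.corner x) c

/-- The vertex of `c` at the corner `(0, …, 0)`. -/
def origin {n : ℕ} (c : X.cube n) : X.Vertex := X.vert c fun _ => false

/-- The oriented edge of `c` in direction `i` issuing from the origin of `c`. -/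
def axisEdge {n : ℕ} (c : X.cube n) (i : Fin n) : X.Edge :=
  X.face (CubeMap.side i fun _ => false) c

def src (e : X.Edge) : X.Vertex := X.vert e fun _ => false

def tgt (e : X.Edge) : X.Vertex := X.vert e fun _ => true

/-- The same edge with the opposite orientation. -/
def rev (e : X.Edge) : X.Edge := X.face CubeMap.flip e

/-! ### Simple connectedness, through edge paths -/

/-- `l` is an edge path from `v` to `w`. -/
def IsPath : List X.Edge → X.Vertex → X.Vertex → Prop
  | [], v, w => v = w
  | e :: l, v, w => X.src e = v ∧ IsPath l (X.tgt e) w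

/-- The edge paths from `v` to `w`. -/
def EdgePath (v w : X.Vertex) : Type u := {l : List X.Edge // X.IsPath l v w}

/-- The constant path. -/
def EdgePath.nil (v : X.Vertex) : X.EdgePath v v := ⟨[], rfl⟩

/-- Elementary homotopies: insertion of a backtrack, and pushing two consecutive sides of a square
across the square. -/
inductive HomotopyStep : List X.Edge → List X.Edge → Prop
  | backtrack (l l' : List X.Edge) (e : X.Edge) :
      HomotopyStep (l ++ l') (l ++ [e, X.rev e] ++ l')
  | square (l l' : List X.Edge) (s : X.cube 2) :
      HomotopyStep
        (l ++ [X.face (CubeMap.side 0 ![false, false]) s,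
          X.face (CubeMap.side 1 ![true, false]) s] ++ l')
        (l ++ [X.face (CubeMap.side 1 ![false, false]) s,
          X.face (CubeMap.side 0 ![false, true]) s] ++ l')

/-- Homotopy of edge paths relative to their endpoints. -/
def Homotopic {v w : X.Vertex} (p q : X.EdgePath v w) : Prop :=
  Relation.EqvGen (fun p q : X.EdgePath v w => X.HomotopyStep p.1 q.1) p q

structure IsSimplyConnected : Prop where
  nonempty : Nonempty X.Vertex
  connected : ∀ v w : X.Vertex, Nonempty (X.EdgePath v w)
  trivial_loops : ∀ (v : X.Vertex) (p : X.EdgePath v v), X.Homotopic p (EdgePath.nil X v)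

/-! ### CAT(0) cube complexes -/

/-- Nonpositive curvature: the link of every vertex is a flag simplicial complex. The vertices of
the link of `v` are the oriented edges issuing from `v`, and a cube with origin `v` is a simplex
spanned by its edges at `v`.

`simplicial` says that a simplex of the link is determined by its vertices; the vertices of a
simplex are then automatically distinct, since otherwise a permutation of the coordinates of a
square would fix that square, against `CubeComplex.free`. `flag` says that pairwise adjacent
vertices of the link span a simplex. -/
structure IsNonpositivelyCurved : Prop where
  simplicial : ∀ {n : ℕ} (c c' : X.cube n), X.origin c = X.origin c' →
    (∀ i, X.axisEdge c i = X.axisEdge c' i) → c = c'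
  flag : ∀ {n : ℕ} (v : X.Vertex) (e : Fin n → X.Edge), (∀ i, X.src (e i) = v) →
    (∀ i j, i ≠ j → ∃ s : X.cube 2, X.axisEdge s 0 = e i ∧ X.axisEdge s 1 = e j) →
    ∃ c : X.cube n, X.origin c = v ∧ ∀ i, X.axisEdge c i = e i

/-- A CAT(0) cube complex: simply connected, with all vertex links flag simplicial complexes. -/
structure IsCAT0 : Prop where
  simplyConnected : X.IsSimplyConnected
  nonpositivelyCurved : X.IsNonpositivelyCurved

/-- The 1-skeleton as a graph. Its path metric is the combinatorial metric of `X`. -/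
def skeleton : SimpleGraph X.Vertex where
  Adj v w := v ≠ w ∧ ∃ e : X.Edge, (X.src e = v ∧ X.tgt e = w) ∨ (X.src e = w ∧ X.tgt e = v)
  symm := ⟨fun _ _ h => ⟨h.1.symm, h.2.imp fun _ he => he.symm⟩⟩
  loopless := ⟨fun _ h => h.1 rfl⟩

/-! ### Subcomplexes, convexity, hyperplanes -/

@[ext]
structure Subcomplex where
  carrier : ∀ n : ℕ, Set (X.cube n)
  face_mem : ∀ {m n : ℕ} (φ : CubeMap m n) (c : X.cube n),
    c ∈ carrier n → X.face φ c ∈ carrier m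

variable {X}

namespace Subcomplex

/-- The vertex set of a subcomplex. -/
def verts (K : X.Subcomplex) : Set X.Vertex := K.carrier 0

/-- The whole complex as a subcomplex. -/
def whole (X : CubeComplex.{u}) : X.Subcomplex := ⟨fun _ => Set.univ, fun _ _ _ => trivial⟩

/-- The full subcomplex spanned by a set of vertices: all cubes whose vertices lie in the set. -/
def span (S : Set X.Vertex) : X.Subcomplex where
  carrier n := {c | ∀ x : Corner n, X.vert c x ∈ S}
  face_mem := by
    intro m n φ c hc x
    have : X.vert (X.face φ c) x = X.vert c (φ.toFun x) := by
      unfold vert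
      rw [← X.face_comp]
      rfl
    rw [this]
    exact hc _

/-- A subcomplex as a cube complex in its own right. -/
def toComplex (K : X.Subcomplex) : CubeComplex.{u} where
  cube n := {c : X.cube n // c ∈ K.carrier n}
  face φ c := ⟨X.face φ c.1, K.face_mem φ c.1 c.2⟩
  face_id c := Subtype.ext (X.face_id c.1)
  face_comp ψ φ c := Subtype.ext (X.face_comp ψ φ c.1)
  free φ c h := X.free φ c.1 (congrArg Subtype.val h)

/-- Convexity of a subcomplex of a CAT(0) cube complex: it is full, and it contains every vertex
that lies on a combinatorial geodesic between two of its vertices. -/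
structure IsConvex (K : X.Subcomplex) : Prop where
  full : ∀ {n : ℕ} (c : X.cube n), (∀ x : Corner n, X.vert c x ∈ K.verts) → c ∈ K.carrier n
  geodesic : ∀ v ∈ K.verts, ∀ w ∈ K.verts, ∀ z : X.Vertex,
    X.skeleton.dist v z + X.skeleton.dist z w = X.skeleton.dist v w → z ∈ K.verts

/-- Not a single vertex (and not empty). -/
def IsNontrivial (K : X.Subcomplex) : Prop := K.verts.Nontrivial

/-- The image of `L` under the closest point projection to the convex subcomplex `K`.
In a CAT(0) cube complex every vertex has a unique closest vertex in `K` (the same one for the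
combinatorial and for the CAT(0) metric), the projection maps cubes to cubes, and the image of a
convex subcomplex is convex, hence spanned by its vertices. -/
def proj (K L : X.Subcomplex) : X.Subcomplex :=
  span {v | v ∈ K.verts ∧ ∃ w ∈ L.verts, ∀ u ∈ K.verts, X.skeleton.dist w v ≤ X.skeleton.dist w u}

end Subcomplex

/-- Two oriented edges are dual to the same hyperplane, and cross it in the same direction: the
equivalence relation generated by being opposite sides of a square. -/
def SameHyperplane : X.Edge → X.Edge → Prop :=
  Relation.EqvGen fun e e' => ∃ s : X.cube 2,
    X.face (CubeMap.side 0 ![false, false]) s = e ∧ X.face (CubeMap.side 0 ![false, true]) s = e'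

/-- The combinatorial hyperplane `H × {-1}`, where `H` is the hyperplane dual to `e` and `e` is
oriented from `H × {-1}` to `H × {1}`. (The combinatorial hyperplane `H × {1}` is the one of the
reversed edge.) -/
def combHyperplane (e : X.Edge) : X.Subcomplex :=
  Subcomplex.span {v | ∃ e' : X.Edge, SameHyperplane e e' ∧ X.src e' = v}

/-- The hyperplane dual to `e` crosses `K`. -/
def Subcomplex.Crosses (K : X.Subcomplex) (e : X.Edge) : Prop :=
  ∃ e' ∈ K.carrier 1, SameHyperplane e e'

/-- Convex subcomplexes are parallel if they are crossed by the same hyperplanes. -/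
def Subcomplex.Parallel (K L : X.Subcomplex) : Prop :=
  ∀ e : X.Edge, K.Crosses e ↔ L.Crosses e

/-- Factor systems on a CAT(0) cube complex. -/
structure IsFactorSystem (𝔉 : Set X.Subcomplex) : Prop where
  whole_mem : Subcomplex.whole X ∈ 𝔉
  nonempty_convex : ∀ F ∈ 𝔉, F.verts.Nonempty ∧ F.IsConvex
  multiplicity : ∃ Δ : ℕ, ∀ x : X.Vertex, {F | F ∈ 𝔉 ∧ x ∈ F.verts}.encard ≤ Δ
  hyperplanes : ∀ (K : X.Subcomplex) (e : X.Edge), K.IsConvex → K.IsNontrivial →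
    K.Parallel (combHyperplane e) → K ∈ 𝔉
  projections : ∃ ξ : ℕ, ∀ F ∈ 𝔉, ∀ F' ∈ 𝔉, Subcomplex.proj F F' ∈ 𝔉 ∨
    ∀ v ∈ (Subcomplex.proj F F').verts, ∀ w ∈ (Subcomplex.proj F F').verts,
      X.skeleton.dist v w < ξ

variable (X) in
/-- The cube complex has a factor system. -/
def HasFactorSystem : Prop := ∃ 𝔉 : Set X.Subcomplex, IsFactorSystem 𝔉

/-! ### Maps, coverings, group actions -/

/-- Cubical maps that send each `n`-cube isometrically to an `n`-cube. -/
structure Hom (X : CubeComplex.{u}) (Y : CubeComplex.{v}) where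
  toFun : ∀ {n : ℕ}, X.cube n → Y.cube n
  map_face : ∀ {m n : ℕ} (φ : CubeMap m n) (c : X.cube n),
    toFun (X.face φ c) = Y.face φ (toFun c)

/-- Covering maps: at each vertex `x` of the source, the cubes issuing from the image of `x` lift
uniquely to cubes issuing from `x`. -/
def Hom.IsCovering {X : CubeComplex.{u}} {Y : CubeComplex.{v}} (p : Hom X Y) : Prop :=
  ∀ {n : ℕ} (x : X.Vertex) (c : Y.cube n), Y.origin c = p.toFun x →
    ∃! c' : X.cube n, X.origin c' = x ∧ p.toFun c' = c

/-- `p` exhibits `X` as the universal cover of `Y`. -/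
structure Hom.IsUniversalCover {X : CubeComplex.{u}} {Y : CubeComplex.{v}} (p : Hom X Y) :
    Prop where
  covering : p.IsCovering
  simplyConnected : X.IsSimplyConnected

/-- An action of the group `G` on `X` by automorphisms of the cube complex. -/
structure Action (X : CubeComplex.{u}) (G : Type v) [Group G] where
  act : G → Hom X X
  act_one : ∀ {n : ℕ} (c : X.cube n), (act 1).toFun c = c
  act_mul : ∀ (g h : G) {n : ℕ} (c : X.cube n),
    (act (g * h)).toFun c = (act g).toFun ((act h).toFun c)

namespace Action

variable {G : Type v} [Group G] (A : X.Action G)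

/-- No nontrivial element maps a cube onto itself (equivalently, fixes a point of the geometric
realization). -/
def IsFree : Prop :=
  ∀ (g : G) {n : ℕ} (c : X.cube n) (φ : CubeMap n n), (A.act g).toFun c = X.face φ c → g = 1

/-- Properness: only finitely many elements move a given vertex by a bounded distance. -/
def IsProper : Prop :=
  ∀ (x : X.Vertex) (r : ℕ), {g : G | X.skeleton.dist x ((A.act g).toFun x) ≤ r}.Finite

/-- Cocompactness: there are finitely many orbits of cubes. -/
def IsCocompact : Prop :=
  ∃ S : Set (Σ n : ℕ, X.cube n), S.Finite ∧
    ∀ {n : ℕ} (c : X.cube n), ∃ g : G, (⟨n, (A.act g).toFun c⟩ : Σ n : ℕ, X.cube n) ∈ S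

/-- The action makes `G ↷ X` a cubulated group. -/
structure IsCubulation : Prop where
  cat0 : X.IsCAT0
  proper : A.IsProper
  cocompact : A.IsCocompact

/-- Parametrized `n`-cubes in the same orbit. -/
def orbitSetoid (n : ℕ) : Setoid (X.cube n) where
  r c c' := ∃ g : G, (A.act g).toFun c = c'
  iseqv :=
    { refl := fun c => ⟨1, A.act_one c⟩
      symm := by
        rintro c _ ⟨g, rfl⟩
        exact ⟨g⁻¹, by rw [← A.act_mul, inv_mul_cancel, A.act_one]⟩
      trans := by
        rintro c _ _ ⟨g, rfl⟩ ⟨h, rfl⟩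
        exact ⟨h * g, A.act_mul h g c⟩ }

/-- The quotient of a cube complex by a free action. -/
def quotient (hA : A.IsFree) : CubeComplex.{u} where
  cube n := Quotient (A.orbitSetoid n)
  face {m n} φ := Quotient.map (sa := A.orbitSetoid n) (sb := A.orbitSetoid m) (X.face φ) (by
    rintro c _ ⟨g, rfl⟩
    exact ⟨g, (A.act g).map_face φ c⟩)
  face_id := by
    rintro n ⟨c⟩
    exact congrArg (Quotient.mk (A.orbitSetoid n)) (X.face_id c)
  face_comp := by
    rintro l m n ψ φ ⟨c⟩
    exact congrArg (Quotient.mk (A.orbitSetoid l)) (X.face_comp ψ φ c)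
  free := by
    rintro n φ ⟨c⟩ h
    obtain ⟨g, hg⟩ := Quotient.exact (s := A.orbitSetoid n) h
    have hg' : (A.act g⁻¹).toFun c = X.face φ c := by
      conv_lhs => rw [← hg]
      rw [← A.act_mul, inv_mul_cancel, A.act_one]
    have h1 : g = 1 := inv_eq_one.1 (hA _ c φ hg')
    rw [h1, A.act_one] at hg
    exact X.free φ c hg

end Action

/-! ### Gluing -/

open Classical in
/-- The cube complex `Y ∪_f B` obtained from `Y` by attaching `B` along the map `f : A → Y` defined
on the subcomplex `A` of `B`. -/
noncomputable def attach (Y : CubeComplex.{u}) (B : CubeComplex.{v}) (A : B.Subcomplex)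
    (f : Hom A.toComplex Y) : CubeComplex.{max u v} where
  cube n := Y.cube n ⊕ {b : B.cube n // b ∉ A.carrier n}
  face {m n} φ := fun c => match c with
    | Sum.inl y => Sum.inl (Y.face φ y)
    | Sum.inr b =>
      if h : B.face φ b.1 ∈ A.carrier m then Sum.inl (f.toFun ⟨B.face φ b.1, h⟩)
      else Sum.inr ⟨B.face φ b.1, h⟩
  face_id := by
    rintro n (y | ⟨b, hb⟩)
    · exact congrArg Sum.inl (Y.face_id y)
    · simp [B.face_id, hb]
  face_comp := by
    rintro l m n ψ φ (y | ⟨b, hb⟩)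
    · exact congrArg Sum.inl (Y.face_comp ψ φ y)
    · by_cases h : B.face ψ b ∈ A.carrier m
      · have h' : B.face (ψ.comp φ) b ∈ A.carrier l := by
          rw [B.face_comp]
          exact A.face_mem φ _ h
        have h2 := f.map_face φ ⟨B.face ψ b, h⟩
        simp only [h, h', dite_true]
        rw [← h2]
        congr 2
        exact Subtype.ext (B.face_comp ψ φ b)
      · simp [h, B.face_comp]
  free := by
    rintro n φ (y | ⟨b, hb⟩) h
    · exact Y.free φ y (Sum.inl.inj h)
    · by_cases h' : B.face φ b ∈ A.carrier n
      · simp [h'] at h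
      · simp only [h', dite_false] at h
        exact B.free φ b (congrArg Subtype.val (Sum.inr.inj h))

/-! ### Cube complexes of graphs, products of trees -/

/-- The cube complex with 1-skeleton `T` in which every hypercube subgraph is filled by a cube.
For trees `T₁, T₂` the hypercube subgraphs of the box product of `T₁` and `T₂` are exactly its vertices,
its edges and the products of an edge of `T₁` with an edge of `T₂`, so that `ofGraph (T₁.boxProd T₂)` is
the square complex `T₁ × T₂`. -/
def ofGraph {V : Type u} (T : SimpleGraph V) : CubeComplex.{u} where
  cube n := {c : Corner n → V //
    Function.Injective c ∧ ∀ x y, hammingDist x y = 1 → T.Adj (c x) (c y)}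
  face φ c := ⟨fun x => c.1 (φ.toFun x), fun _ _ h => φ.injective (c.2.1 h),
    fun x y h => c.2.2 _ _ (by rw [φ.isometry, h])⟩
  face_id _ := rfl
  face_comp _ _ _ := rfl
  free φ c h := by
    ext x : 2
    exact c.2.1 (congrFun (congrArg Subtype.val h) x)

/-- A group acting on the graph `T` acts on the cube complex `ofGraph T`. -/
def graphAction {V : Type u} {T : SimpleGraph V} {G : Type v} [Group G] (ρ : G →* (T ≃g T)) :
    (ofGraph T).Action G where
  act g :=
    { toFun := fun c => ⟨fun x => ρ g (c.1 x), fun _ _ h => c.2.1 ((ρ g).injective h),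
        fun x y h => (ρ g).map_rel_iff.2 (c.2.2 x y h)⟩
      map_face := fun _ _ => rfl }
  act_one c := by
    apply Subtype.ext
    funext x
    simp
  act_mul g h _ c := by
    apply Subtype.ext
    funext x
    simp

end CubeComplex

/-! ### Annuli -/

section Annulus

open CubeComplex

/-- The graph `ℤ × [0,1]` (the 1-skeleton of an infinite strip). -/
noncomputable abbrev stripGraph : SimpleGraph (ℤ × Bool) := (SimpleGraph.hasse ℤ).boxProd (⊤ : SimpleGraph Bool)

/-- The translation `(t, s) ↦ (t + a, s)` of the strip. -/
noncomputable def stripShift (a : ℤ) : stripGraph ≃g stripGraph where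
  toEquiv := (Equiv.addRight a).prodCongr (Equiv.refl Bool)
  map_rel_iff' := by
    rintro ⟨t, s⟩ ⟨t', s'⟩
    simp [SimpleGraph.boxProd_adj, SimpleGraph.hasse_adj, Order.covBy_iff_add_one_eq]
    grind

/-- The action of `ℤ` on the strip by translations by the multiples of `τ`. -/
noncomputable def stripHom (τ : ℕ) : Multiplicative ℤ →* (stripGraph ≃g stripGraph) where
  toFun k := stripShift (k.toAdd * τ)
  map_one' := by
    ext x <;> simp [stripShift]
  map_mul' a b := by
    ext x <;> simp [stripShift]
    ring

theorem stripHom_free {τ : ℕ} (hτ : 0 < τ) : (graphAction (stripHom τ)).IsFree := by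
  intro k n c φ h
  have h1 : ∀ x, (c.1 x).1 + k.toAdd * τ = (c.1 (φ.toFun x)).1 := fun x =>
    congrArg Prod.fst (congrFun (congrArg Subtype.val h) x)
  have hbij : Function.Bijective φ.toFun := Finite.injective_iff_bijective.1 φ.injective
  have h2 : ∑ x, ((c.1 x).1 + k.toAdd * τ) = ∑ x, (c.1 x).1 := by
    rw [Finset.sum_congr rfl fun x _ => h1 x]
    exact Function.Bijective.sum_comp hbij fun x => (c.1 x).1
  rw [Finset.sum_add_distrib, add_eq_left, Finset.sum_const] at h2
  have h3 : k.toAdd = 0 := by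
    simpa [hτ.ne'] using h2
  exact Multiplicative.toAdd.injective h3

/-- The annulus `S¹ × [0,1]` subdivided into `τ` squares: the quotient of the strip `ℤ × [0,1]` by
translation by `τ`. -/
noncomputable def annulus (τ : ℕ) (hτ : 0 < τ) : CubeComplex.{0} :=
  (graphAction (stripHom τ)).quotient (stripHom_free hτ)

/-- The boundary component `S¹ × {0}` of the annulus. -/
noncomputable def annulusBoundary (τ : ℕ) (hτ : 0 < τ) : (annulus τ hτ).Subcomplex where
  carrier n := {b | ∃ c : (ofGraph stripGraph).cube n,
    (∀ x, (c.1 x).2 = false) ∧ Quotient.mk ((graphAction (stripHom τ)).orbitSetoid n) c = b}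
  face_mem := by
    rintro m n φ _ ⟨c, hc, rfl⟩
    exact ⟨(ofGraph stripGraph).face φ c, fun x => hc _, rfl⟩

end Annulus

/-! ### Anti-tori in products of trees -/

section AntiTorus

open CubeComplex

variable {V₁ V₂ Γ : Type u} [Group Γ] {T₁ : SimpleGraph V₁} {T₂ : SimpleGraph V₂}

/-- The elements `g₁, g₂` form an anti-torus for the action `ρ` on `T₁ × T₂`. They translate
nontrivially along the axes `ℓ₁ × {p₂}` and `{p₁} × ℓ₂`, which intersect in the vertex `(p₁, p₂)`,
and no nonzero powers of them commute. The lines `ℓ₁, ℓ₂` are parametrized by arc length, in the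
direction of translation, with `p₁ = ℓ₁ 0` and `p₂ = ℓ₂ 0`; the translation lengths are `τ₁, τ₂`. -/
structure AntiTorus (ρ : Γ →* (T₁.boxProd T₂ ≃g T₁.boxProd T₂)) (g₁ g₂ : Γ) where
  ℓ₁ : ℤ → V₁
  ℓ₂ : ℤ → V₂
  ℓ₁_injective : Function.Injective ℓ₁
  ℓ₂_injective : Function.Injective ℓ₂
  ℓ₁_adj : ∀ t, T₁.Adj (ℓ₁ t) (ℓ₁ (t + 1))
  ℓ₂_adj : ∀ t, T₂.Adj (ℓ₂ t) (ℓ₂ (t + 1))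
  τ₁ : ℕ
  τ₂ : ℕ
  τ₁_pos : 0 < τ₁
  τ₂_pos : 0 < τ₂
  translate₁ : ∀ t : ℤ, ρ g₁ (ℓ₁ t, ℓ₂ 0) = (ℓ₁ (t + τ₁), ℓ₂ 0)
  translate₂ : ∀ t : ℤ, ρ g₂ (ℓ₁ 0, ℓ₂ t) = (ℓ₁ 0, ℓ₂ (t + τ₂))
  not_commute : ∀ m n : ℤ, m ≠ 0 → n ≠ 0 → ¬ Commute (g₁ ^ m) (g₂ ^ n)

namespace AntiTorus

variable {ρ : Γ →* (T₁.boxProd T₂ ≃g T₁.boxProd T₂)} {g₁ g₂ : Γ} (h : AntiTorus ρ g₁ g₂)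

/-- The cube of `ℓ₁ × {p₂}` that corresponds to a cube of the line `ℤ × {0}`. -/
def axisCube {n : ℕ} (c : (ofGraph stripGraph).cube n) (hc : ∀ x, (c.1 x).2 = false) :
    (ofGraph (T₁.boxProd T₂)).cube n :=
  ⟨fun x => (h.ℓ₁ (c.1 x).1, h.ℓ₂ 0), by
    intro x y hxy
    refine c.2.1 (Prod.ext (h.ℓ₁_injective (congrArg Prod.fst hxy)) ?_)
    rw [hc x, hc y], by
    intro x y hxy
    have h1 := c.2.2 x y hxy
    rw [SimpleGraph.boxProd_adj, hc x, hc y] at h1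
    simp only [SimpleGraph.hasse_adj, Order.covBy_iff_add_one_eq, SimpleGraph.irrefl, false_and,
      or_false, and_true] at h1
    rw [SimpleGraph.boxProd_adj]
    refine Or.inl ⟨?_, rfl⟩
    change T₁.Adj (h.ℓ₁ (c.1 x).1) (h.ℓ₁ (c.1 y).1)
    rcases h1 with h1 | h1
    · exact h1 ▸ h.ℓ₁_adj (c.1 x).1
    · exact h1 ▸ (h.ℓ₁_adj (c.1 y).1).symm⟩

theorem axis_zpow (k : ℤ) : ∀ t : ℤ, ρ (g₁ ^ k) (h.ℓ₁ t, h.ℓ₂ 0) = (h.ℓ₁ (t + k * h.τ₁), h.ℓ₂ 0) := by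
  induction k with
  | zero => simp
  | succ k ih =>
    intro t
    rw [zpow_add_one, map_mul, RelIso.mul_apply, h.translate₁, ih]
    congr 2
    ring
  | pred k ih =>
    intro t
    have h1 := h.translate₁ (t - h.τ₁)
    rw [sub_add_cancel] at h1
    rw [zpow_sub_one, map_mul, RelIso.mul_apply, ← h1, map_inv, RelIso.inv_apply_self, ih]
    congr 2
    ring

/-- The edge loop of the quotient `(T₁ × T₂)/Γ` to which the axis `ℓ₁ × {p₂}` descends, as a
map from the boundary circle of the annulus with `τ₁` squares. -/
noncomputable def loop (hfree : (graphAction ρ).IsFree) :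
    Hom (annulusBoundary h.τ₁ h.τ₁_pos).toComplex ((graphAction ρ).quotient hfree) where
  toFun {n} b := Quotient.mk ((graphAction ρ).orbitSetoid n)
    (h.axisCube b.2.choose b.2.choose_spec.1)
  map_face {m n} φ b := by
    have key : ∀ (c c' : (ofGraph stripGraph).cube m) (hc : ∀ x, (c.1 x).2 = false)
        (hc' : ∀ x, (c'.1 x).2 = false),
        Quotient.mk ((graphAction (stripHom h.τ₁)).orbitSetoid m) c =
          Quotient.mk ((graphAction (stripHom h.τ₁)).orbitSetoid m) c' →
        Quotient.mk ((graphAction ρ).orbitSetoid m) (h.axisCube c hc) =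
          Quotient.mk ((graphAction ρ).orbitSetoid m) (h.axisCube c' hc') := by
      intro c c' hc hc' hcc
      obtain ⟨k, hk⟩ := Quotient.exact (s := (graphAction (stripHom h.τ₁)).orbitSetoid m) hcc
      refine Quotient.sound (s := (graphAction ρ).orbitSetoid m) ⟨g₁ ^ k.toAdd, ?_⟩
      apply Subtype.ext
      funext x
      have hx : (c.1 x).1 + k.toAdd * h.τ₁ = (c'.1 x).1 :=
        congrArg Prod.fst (congrFun (congrArg Subtype.val hk) x)
      refine (h.axis_zpow k.toAdd (c.1 x).1).trans ?_
      rw [hx]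
      rfl
    refine key _ ((ofGraph stripGraph).face φ b.2.choose) _ (fun x => b.2.choose_spec.1 _) ?_
    refine (Exists.choose_spec
      ((annulusBoundary h.τ₁ h.τ₁_pos).toComplex.face φ b).2).2.trans ?_
    exact (congrArg ((annulus h.τ₁ h.τ₁_pos).face φ) b.2.choose_spec.2).symm

/-- The quotient `(T₁ × T₂)/Γ` with an annulus of `τ₁` squares attached by gluing one of its
boundary components along the loop to which the axis `ℓ₁ × {p₂}` descends. -/
noncomputable def gluedComplex (hfree : (graphAction ρ).IsFree) : CubeComplex.{u} :=
  attach.{u, 0} ((graphAction ρ).quotient hfree) (annulus h.τ₁ h.τ₁_pos)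
    (annulusBoundary h.τ₁ h.τ₁_pos) (h.loop hfree)

end AntiTorus

end AntiTorus

/-! The universal cover is built by hand. Its 1-skeleton `modelGraph` is that of T₁ × T₂ with a fin,
i.e. a strip ℝ × [0,1], attached along γ(ℓ₁ × {p₂}) for each coset γ⟨g₁⟩. Indexing by cosets and not
by lines gives exactly one strip for each lift of the annulus. The complex spanned by this graph is
simply connected because loops can be pushed down a rank function (`ofGraph_isSimplyConnected`), and
nonpositively curved because no vertex has three edges that pairwise span squares
(`ofGraph_isNonpositivelyCurved`). Γ acts on it freely, properly and cocompactly, and its orbits are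
the fibres of a map to the glued complex. So the model is a universal cover, and every other one is
isomorphic to it by lifting (`exists_iso_of_universalCover`).

The obstruction to factor systems: the rungs of a strip are dual to a hyperplane that has the
attaching line as a combinatorial hyperplane (`combHyperplane_rung`). On T₁ × ℓ₂, which it
preserves, g₂ᵏ is the product of an automorphism `drift k` of T₁ fixing p₁ and a translation of ℓ₂
(`zpow_apply`). So the strip of g₂ᵏ⟨g₁⟩ is attached along a line parallel to drift k (ℓ₁) × {p₂},
and every factor system contains all these lines of the single layer T₁ × {p₂} (`layer_mem`). They
all pass through (p₁, p₂), and projecting one of them to ℓ₁ × {p₂} gives their intersection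
(`proj_layer`).

By local finiteness and pigeonhole, for each R some k ≠ 0 makes this intersection contain the
segment of radius R about p₁ (`exists_drift_eq`). It is never all of ℓ₁: otherwise the conjugates
g₁⁻ᵐ g₂ᵏ gᵐ₁ would all move (p₁, p₂) by the same distance, two of them would coincide by properness,
and a power of g₁ would commute with g₂ᵏ (`exists_notMem_drift`). So infinitely many distinct
members of the factor system contain one vertex, against bounded multiplicity
(`model_not_hasFactorSystem`).

For (a) one anti-torus suffices. A `SquareDatum` yields a group acting simply transitively on the
vertices of a product of two Cayley trees; the datum used here comes from integer quaternions of
norms 3 and 5. Powers of the rotations given by 1 + j + k and 1 + 2i never commute, by congruences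
modulo 3 and 5 (`not_commute_rot`). -/

namespace CubeComplex

/-! ### Vertices of faces -/

section Basic

variable {X Y : CubeComplex.{u}}

theorem vert_face {m n : ℕ} (φ : CubeMap m n) (c : X.cube n) (x : Corner m) :
    X.vert (X.face φ c) x = X.vert c (φ.toFun x) := by
  unfold vert
  rw [← X.face_comp]
  rfl

theorem vert_zero (v : X.Vertex) (x : Corner 0) : X.vert v x = v := by
  have : CubeMap.corner x = CubeMap.id 0 := CubeMap.ext (funext fun _ => Subsingleton.elim _ _)
  rw [vert, this, X.face_id]

theorem src_side {n : ℕ} (c : X.cube n) (i : Fin n) (x : Corner n) :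
    X.src (X.face (CubeMap.side i x) c) = X.vert c (Function.update x i false) :=
  vert_face _ _ _

theorem tgt_side {n : ℕ} (c : X.cube n) (i : Fin n) (x : Corner n) :
    X.tgt (X.face (CubeMap.side i x) c) = X.vert c (Function.update x i true) :=
  vert_face _ _ _

theorem src_rev (e : X.Edge) : X.src (X.rev e) = X.tgt e := vert_face _ _ _

theorem tgt_rev (e : X.Edge) : X.tgt (X.rev e) = X.src e := vert_face _ _ _

theorem Hom.map_vert (f : Hom X Y) {n : ℕ} (c : X.cube n) (x : Corner n) :
    f.toFun (X.vert c x) = Y.vert (f.toFun c) x :=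
  f.map_face _ _

theorem Hom.map_src (f : Hom X Y) (e : X.Edge) : f.toFun (X.src e) = Y.src (f.toFun e) :=
  f.map_face _ _

theorem Hom.map_tgt (f : Hom X Y) (e : X.Edge) : f.toFun (X.tgt e) = Y.tgt (f.toFun e) :=
  f.map_face _ _

theorem Hom.map_origin (f : Hom X Y) {n : ℕ} (c : X.cube n) :
    f.toFun (X.origin c) = Y.origin (f.toFun c) :=
  f.map_face _ _

theorem isPath_append {l l' : List X.Edge} {v w : X.Vertex} :
    X.IsPath (l ++ l') v w ↔ ∃ z, X.IsPath l v z ∧ X.IsPath l' z w := by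
  induction l generalizing v with
  | nil => simp [IsPath]
  | cons e l ih => simp [IsPath, ih, and_assoc]

theorem update_sq (a b : Bool) (i : Fin 2) (t : Bool) :
    Function.update ![a, b] i t = if i = 0 then ![t, b] else ![a, t] := by
  fin_cases i <;> ext j <;> fin_cases j <;> rfl

end Basic

/-! ### Lifting -/

section Lifting

variable {X Y Z : CubeComplex.{u}} (q : Hom Y Z) (p : Hom X Z)

/-- The lift to `X` at `x` of the image in `Z` of the edge path `l` of `Y` ends in `x'`. -/
def LiftsTo : List Y.Edge → X.Vertex → X.Vertex → Prop
  | [], x, x' => x = x'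
  | e :: l, x, x' => ∃ e' : X.Edge, X.src e' = x ∧ p.toFun e' = q.toFun e ∧
      LiftsTo l (X.tgt e') x'

variable {q p}

theorem liftsTo_append {l l' : List Y.Edge} {x x' : X.Vertex} :
    LiftsTo q p (l ++ l') x x' ↔ ∃ z, LiftsTo q p l x z ∧ LiftsTo q p l' z x' := by
  induction l generalizing x with
  | nil => simp [LiftsTo]
  | cons e l ih =>
    simp only [List.cons_append, LiftsTo, ih]
    constructor
    · rintro ⟨e', h1, h2, z, h3, h4⟩
      exact ⟨z, ⟨e', h1, h2, h3⟩, h4⟩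
    · rintro ⟨z, ⟨e', h1, h2, h3⟩, h4⟩
      exact ⟨e', h1, h2, z, h3, h4⟩

theorem Hom.IsCovering.eq_of_origin (hp : p.IsCovering) {n : ℕ} {c c' : X.cube n}
    (h : X.origin c = X.origin c') (h' : p.toFun c = p.toFun c') : c = c' :=
  (hp (X.origin c) (p.toFun c) (p.map_origin c).symm).unique ⟨rfl, rfl⟩ ⟨h.symm, h'.symm⟩

theorem LiftsTo.unique (hp : p.IsCovering) {l : List Y.Edge} {x a b : X.Vertex}
    (ha : LiftsTo q p l x a) (hb : LiftsTo q p l x b) : a = b := by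
  induction l generalizing x with
  | nil => exact ha.symm.trans hb
  | cons e l ih =>
    obtain ⟨e₁, h1, h2, h3⟩ := ha
    obtain ⟨e₂, h4, h5, h6⟩ := hb
    have : e₁ = e₂ := hp.eq_of_origin (h1.trans h4.symm) (h2.trans h5.symm)
    subst this
    exact ih h3 h6

theorem LiftsTo.map_eq {l : List Y.Edge} {y y' : Y.Vertex} {x x' : X.Vertex}
    (hl : Y.IsPath l y y') (hx : p.toFun x = q.toFun y) (h : LiftsTo q p l x x') :
    p.toFun x' = q.toFun y' := by
  induction l generalizing x y with
  | nil => rw [← h, hx, hl]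
  | cons e l ih =>
    obtain ⟨e', h1, h2, h3⟩ := h
    exact ih hl.2 (by rw [p.map_tgt, h2, q.map_tgt]) h3

theorem exists_liftsTo (hp : p.IsCovering) {l : List Y.Edge} {y y' : Y.Vertex} {x : X.Vertex}
    (hl : Y.IsPath l y y') (hx : p.toFun x = q.toFun y) : ∃ x', LiftsTo q p l x x' := by
  induction l generalizing x y with
  | nil => exact ⟨x, rfl⟩
  | cons e l ih =>
    obtain ⟨e', ⟨h1, h2⟩, -⟩ := hp x (q.toFun e) (by
      rw [hx, ← hl.1]
      exact (q.map_src e).symm)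
    obtain ⟨x', h3⟩ := ih (x := X.tgt e') hl.2 (by rw [p.map_tgt, h2, q.map_tgt])
    exact ⟨x', e', h1, h2, h3⟩

/-- The inserted edge, or the whole square, lifts at the point reached so far; uniqueness of lifts
then identifies the two lifted edges of `l` with sides of the lifted square. -/
theorem LiftsTo.step (hp : p.IsCovering) {l l' : List Y.Edge} (hs : Y.HomotopyStep l l')
    {y y' : Y.Vertex} {x x' : X.Vertex} (hl : Y.IsPath l' y y')
    (hx : p.toFun x = q.toFun y) (h : LiftsTo q p l x x') : LiftsTo q p l' x x' := by
  cases hs with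
  | backtrack l₁ l₂ e =>
    obtain ⟨z, h1, h2⟩ := liftsTo_append.1 h
    rw [List.append_assoc] at hl ⊢
    obtain ⟨w, h3, h4⟩ := isPath_append.1 hl
    have hz := h1.map_eq h3 hx
    obtain ⟨e', ⟨h5, h6⟩, -⟩ := hp z (q.toFun e) (by
      rw [hz, ← h4.1]
      exact (q.map_src e).symm)
    refine liftsTo_append.2 ⟨z, h1, e', h5, h6, X.rev e', src_rev e', ?_, ?_⟩
    · rw [rev, rev, p.map_face, h6, q.map_face]
    · rw [tgt_rev]
      exact (show X.src e' = z from h5) ▸ h2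
  | square l₁ l₂ s =>
    rw [List.append_assoc] at hl h ⊢
    obtain ⟨z, h1, h2⟩ := liftsTo_append.1 h
    obtain ⟨w, h3, h4⟩ := isPath_append.1 hl
    have hz := h1.map_eq h3 hx
    have hw : w = Y.origin s := by
      rw [← h4.1, src_side, origin]
      congr 1
      ext i
      fin_cases i <;> rfl
    obtain ⟨s', ⟨h5, h6⟩, -⟩ := hp z (q.toFun s) (by rw [hz, hw, q.map_origin])
    have hside : ∀ (i : Fin 2) (v : Corner 2), p.toFun (X.face (CubeMap.side i v) s') =
        q.toFun (Y.face (CubeMap.side i v) s) := fun i v => by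
      rw [p.map_face, h6, q.map_face]
    have ho : ∀ i : Fin 2, X.src (X.face (CubeMap.side i ![false, false]) s') = z := by
      intro i
      rw [src_side, ← h5, origin]
      congr 1
      ext j
      fin_cases i <;> fin_cases j <;> rfl
    obtain ⟨e₁, a1, a2, e₂, a3, a4, a5⟩ := h2
    have b1 : e₁ = X.face (CubeMap.side 0 ![false, false]) s' :=
      hp.eq_of_origin (a1.trans (ho 0).symm) (a2.trans (hside _ _).symm)
    have b2 : e₂ = X.face (CubeMap.side 1 ![true, false]) s' := by
      refine hp.eq_of_origin (a3.trans ?_) (a4.trans (hside _ _).symm)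
      change X.tgt e₁ = X.src _
      rw [b1, tgt_side, src_side, update_sq, update_sq]
      rfl
    refine liftsTo_append.2 ⟨z, h1, _, ho 1, hside _ _, _, ?_, hside _ _, ?_⟩
    · rw [tgt_side, src_side, update_sq, update_sq]
      rfl
    · rw [b2, tgt_side, update_sq] at a5
      rw [tgt_side, update_sq]
      exact a5

theorem LiftsTo.of_homotopic (hp : p.IsCovering) {y y' : Y.Vertex} {l l' : Y.EdgePath y y'}
    (hl : Y.Homotopic l l') {x x' : X.Vertex} (hx : p.toFun x = q.toFun y) :
    LiftsTo q p l.1 x x' ↔ LiftsTo q p l'.1 x x' := by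
  induction hl with
  | rel l l' hs =>
    refine ⟨fun h => h.step hp hs l'.2 hx, fun h => ?_⟩
    -- Only the forward direction is available from `step`. Conversely, some lift of `l` exists, and
    -- pushing it forward shows by uniqueness that it has the right endpoint.
    obtain ⟨z, hz⟩ := exists_liftsTo (q := q) hp l.2 hx
    rwa [h.unique hp (hz.step hp hs l'.2 hx)]
  | refl => exact Iff.rfl
  | symm _ _ _ ih => exact ih.symm
  | trans _ _ _ _ _ ih1 ih2 => exact ih1.trans ih2

/-- Concatenation with the reversed path. -/
theorem exists_reverse_path {v w : Y.Vertex} (l : List Y.Edge) (hl : Y.IsPath l v w) :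
    Y.IsPath (l.reverse.map Y.rev) w v := by
  induction l generalizing v with
  | nil => exact hl.symm
  | cons e l ih =>
    rw [List.reverse_cons, List.map_append]
    exact isPath_append.2 ⟨_, ih hl.2, src_rev e, (tgt_rev e).trans hl.1⟩

theorem LiftsTo.reverse {l : List Y.Edge} {x x' : X.Vertex} (h : LiftsTo q p l x x') :
    LiftsTo q p (l.reverse.map Y.rev) x' x := by
  induction l generalizing x with
  | nil => exact h.symm
  | cons e l ih =>
    obtain ⟨e', h1, h2, h3⟩ := h
    rw [List.reverse_cons, List.map_append]
    refine liftsTo_append.2 ⟨_, ih h3, X.rev e', src_rev e', ?_, (tgt_rev e').trans h1⟩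
    rw [rev, rev, p.map_face, h2, q.map_face]

/-- In a simply connected complex the endpoint of the lift depends on the endpoints only. -/
theorem LiftsTo.endpoint_unique (hp : p.IsCovering) (hY : Y.IsSimplyConnected) {y y' : Y.Vertex}
    {l l' : List Y.Edge} (hl : Y.IsPath l y y') (hl' : Y.IsPath l' y y') {x a b : X.Vertex}
    (hx : p.toFun x = q.toFun y) (ha : LiftsTo q p l x a) (hb : LiftsTo q p l' x b) : a = b := by
  have h1 : LiftsTo q p (l ++ l'.reverse.map Y.rev) x x := by
    refine (LiftsTo.of_homotopic hp (hY.trivial_loops y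
      ⟨_, isPath_append.2 ⟨_, hl, exists_reverse_path l' hl'⟩⟩) hx).2 rfl
  obtain ⟨z, h2, h3⟩ := liftsTo_append.1 h1
  rw [ha.unique hp h2]
  have h4 := h3.reverse
  have h5 : (List.map Y.rev (List.map Y.rev l'.reverse).reverse) = l' := by
    rw [← List.map_reverse, List.reverse_reverse, List.map_map]
    have : (Y.rev ∘ Y.rev) = id := by
      funext e
      change Y.face _ (Y.face _ e) = e
      rw [← Y.face_comp]
      have : CubeMap.flip.comp CubeMap.flip = CubeMap.id 1 := by
        ext x i
        simp [CubeMap.comp, CubeMap.flip, CubeMap.id]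
      rw [this, Y.face_id]
    rw [this, List.map_id]
  rw [h5] at h4
  exact h4.unique hp hb

/-- Lifting criterion for maps from simply connected complexes. -/
theorem exists_lift (hp : p.IsCovering) (hY : Y.IsSimplyConnected) (y₀ : Y.Vertex) (x₀ : X.Vertex)
    (h₀ : p.toFun x₀ = q.toFun y₀) :
    ∃ f : Hom Y X, (∀ {n : ℕ} (c : Y.cube n), p.toFun (f.toFun c) = q.toFun c) ∧
      f.toFun y₀ = x₀ := by
  have h1 : ∀ y : Y.Vertex, ∃ x : X.Vertex, ∀ l, Y.IsPath l y₀ y → LiftsTo q p l x₀ x := by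
    intro y
    obtain ⟨l, hl⟩ := hY.connected y₀ y
    obtain ⟨x, hx⟩ := exists_liftsTo (q := q) hp hl h₀
    refine ⟨x, fun l' hl' => ?_⟩
    obtain ⟨x', hx'⟩ := exists_liftsTo (q := q) hp hl' h₀
    rwa [LiftsTo.endpoint_unique hp hY hl hl' h₀ hx hx']
  choose f₀ hf₀ using h1
  have hpf₀ : ∀ y, p.toFun (f₀ y) = q.toFun y := fun y => by
    obtain ⟨l, hl⟩ := hY.connected y₀ y
    exact (hf₀ y l hl).map_eq hl h₀
  have h2 : ∀ {n : ℕ} (c : Y.cube n), ∃ c' : X.cube n, X.origin c' = f₀ (Y.origin c) ∧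
      p.toFun c' = q.toFun c := fun {n} c => by
    obtain ⟨c', h, -⟩ := hp (f₀ (Y.origin c)) (q.toFun c) (by rw [hpf₀, q.map_origin])
    exact ⟨c', h⟩
  choose f hfo hpf using @h2
  have hedge : ∀ (e : Y.Edge) (e' : X.Edge), X.src e' = f₀ (Y.src e) → p.toFun e' = q.toFun e →
      f₀ (Y.tgt e) = X.tgt e' := by
    intro e e' h3 h4
    obtain ⟨l, hl⟩ := hY.connected y₀ (Y.src e)
    have h5 := hf₀ (Y.tgt e) (l ++ [e]) (isPath_append.2 ⟨_, hl, rfl, rfl⟩)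
    exact h5.unique hp (liftsTo_append.2 ⟨_, hf₀ _ l hl, e', h3, h4, rfl⟩)
  -- The vertex map comes from paths, the cube map from lifting at the origin. They are compared at
  -- all corners by induction on the number of coordinates equal to `true`, moving along one edge of
  -- the cube at a time.
  have hvert : ∀ {n : ℕ} (c : Y.cube n) (k : ℕ) (x : Corner n),
      (Finset.univ.filter fun i => x i = true).card = k →
      f₀ (Y.vert c x) = X.vert (f c) x := by
    intro n c k
    induction k with
    | zero =>
      intro x hx
      have : x = fun _ => false := by
        funext i
        have := Finset.filter_eq_empty_iff.1 (Finset.card_eq_zero.1 hx) (Finset.mem_univ i)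
        simpa using this
      rw [this]
      exact (hfo c).symm
    | succ k ih =>
      intro x hx
      obtain ⟨i, hi⟩ : ∃ i, x i = true := by
        obtain ⟨i, hi⟩ := Finset.card_pos.1 (by omega : 0 < (Finset.univ.filter
          fun i => x i = true).card)
        exact ⟨i, (Finset.mem_filter.1 hi).2⟩
      have h3 : (Finset.univ.filter fun j => Function.update x i false j = true) =
          (Finset.univ.filter fun j => x j = true).erase i := by
        ext j
        by_cases hj : j = i
        · subst hj; simp
        · simp [hj]
      have h4 := ih (Function.update x i false) (by
        rw [h3, Finset.card_erase_of_mem (by simp [hi]), hx]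
        rfl)
      have h5 := hedge (Y.face (CubeMap.side i x) c) (X.face (CubeMap.side i x) (f c))
        (by rw [src_side, src_side, h4]) (by rw [p.map_face, hpf, q.map_face])
      rw [tgt_side, tgt_side] at h5
      have h6 : Function.update x i true = x := by rw [← hi, Function.update_eq_self]
      rwa [h6] at h5
  have hf_vertex : ∀ y : Y.Vertex, f y = f₀ y := fun y => by
    have := hvert y _ (fun _ => false) rfl
    rw [vert_zero, vert_zero] at this
    exact this.symm
  refine ⟨⟨fun c => f c, fun φ c => ?_⟩, fun c => hpf c, ?_⟩
  · refine hp.eq_of_origin ?_ (by rw [hpf, p.map_face, hpf, q.map_face])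
    rw [hfo]
    change f₀ (Y.vert _ _) = X.vert _ _
    rw [vert_face, vert_face]
    exact hvert c _ _ rfl
  · change f y₀ = x₀
    rw [hf_vertex]
    exact (hf₀ y₀ [] rfl).symm

/-- Uniqueness of lifts. -/
theorem lift_unique (hp : p.IsCovering) (hY : Y.IsSimplyConnected) {f f' : Hom Y X}
    (h : ∀ {n : ℕ} (c : Y.cube n), p.toFun (f.toFun c) = p.toFun (f'.toFun c)) (y₀ : Y.Vertex)
    (h₀ : f.toFun y₀ = f'.toFun y₀) {n : ℕ} (c : Y.cube n) : f.toFun c = f'.toFun c := by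
  have h1 : ∀ (l : List Y.Edge) (y y' : Y.Vertex), Y.IsPath l y y' → f.toFun y = f'.toFun y →
      f.toFun y' = f'.toFun y' := by
    intro l
    induction l with
    | nil =>
      rintro y y' rfl h
      exact h
    | cons e l ih =>
      rintro y y' hl h2
      refine ih _ _ hl.2 ?_
      have : f.toFun e = f'.toFun e := by
        refine hp.eq_of_origin ?_ (h e)
        rw [← f.map_origin, ← f'.map_origin]
        exact (show Y.origin e = y from hl.1) ▸ h2
      rw [f.map_tgt, f'.map_tgt, this]
  obtain ⟨l, hl⟩ := hY.connected y₀ (Y.origin c)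
  refine hp.eq_of_origin ?_ (h c)
  rw [← f.map_origin, ← f'.map_origin]
  exact h1 l _ _ hl h₀

/-- Uniqueness of universal covers. -/
theorem exists_iso_of_universalCover (hp : p.IsUniversalCover) (hq : q.IsUniversalCover)
    (hsurj : Function.Surjective (q.toFun (n := 0))) :
    ∃ (f : Hom Y X) (g : Hom X Y), (∀ {n : ℕ} (c : Y.cube n), g.toFun (f.toFun c) = c) ∧
      (∀ {n : ℕ} (c : X.cube n), f.toFun (g.toFun c) = c) ∧
      ∀ {n : ℕ} (c : Y.cube n), p.toFun (f.toFun c) = q.toFun c := by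
  obtain ⟨x₀⟩ := hp.simplyConnected.nonempty
  -- Surjectivity on vertices supplies a base point over `p.toFun x₀`, in place of connectedness of
  -- the base.
  obtain ⟨y₀, h₀⟩ := hsurj (p.toFun x₀)
  obtain ⟨f, hf, hf₀⟩ := exists_lift (q := q) hp.covering hq.simplyConnected y₀ x₀ h₀.symm
  obtain ⟨g, hg, hg₀⟩ := exists_lift (q := p) hq.covering hp.simplyConnected x₀ y₀ h₀
  refine ⟨f, g, fun c => ?_, fun c => ?_, hf⟩
  · exact lift_unique (f := ⟨fun c => g.toFun (f.toFun c), fun φ c => by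
      rw [f.map_face, g.map_face]⟩) (f' := ⟨fun c => c, fun _ _ => rfl⟩) hq.covering
      hq.simplyConnected (fun c => by rw [hg, hf]) y₀ (by
        change g.toFun (f.toFun y₀) = y₀
        rw [hf₀, hg₀]) c
  · exact lift_unique (f := ⟨fun c => f.toFun (g.toFun c), fun φ c => by
      rw [g.map_face, f.map_face]⟩) (f' := ⟨fun c => c, fun _ _ => rfl⟩) hp.covering
      hp.simplyConnected (fun c => by rw [hf, hg]) x₀ (by
        change f.toFun (g.toFun x₀) = x₀
        rw [hg₀, hf₀]) c

end Lifting

end CubeComplex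

/-! ### Distances and isomorphisms of graphs -/

namespace SimpleGraph

theorem dist_map_le {V W : Type*} {G : SimpleGraph V} {H : SimpleGraph W} (f : G →g H) {v w : V}
    (h : G.Reachable v w) : H.dist (f v) (f w) ≤ G.dist v w := by
  obtain ⟨p, hp⟩ := h.exists_walk_length_eq_dist
  rw [← hp, ← Walk.length_map f p]
  exact dist_le _

theorem dist_iso {V W : Type*} {G : SimpleGraph V} {H : SimpleGraph W} (f : G ≃g H) (v w : V) :
    H.dist (f v) (f w) = G.dist v w := by
  by_cases h : G.Reachable v w
  · refine le_antisymm (dist_map_le f.toHom h) ?_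
    have h1 := dist_map_le f.symm.toHom (h.map f.toHom)
    simpa using h1
  -- Unreachable pairs have distance 0 by convention, so unreachability has to be transported as
  -- well.
  · rw [dist_eq_zero_of_not_reachable h, dist_eq_zero_of_not_reachable]
    intro h1
    exact h (by simpa using h1.map f.symm.toHom)

end SimpleGraph

namespace CubeComplex

/-! ### Isomorphisms of cube complexes -/

structure Iso (X Y : CubeComplex.{u}) where
  hom : Hom X Y
  inv : Hom Y X
  inv_hom : ∀ {n : ℕ} (c : X.cube n), inv.toFun (hom.toFun c) = c
  hom_inv : ∀ {n : ℕ} (c : Y.cube n), hom.toFun (inv.toFun c) = c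

namespace Iso

variable {X Y : CubeComplex.{u}} (e : Iso X Y)

def symm : Iso Y X := ⟨e.inv, e.hom, e.hom_inv, e.inv_hom⟩

theorem symm_hom : e.symm.hom = e.inv := rfl

theorem hom_injective {n : ℕ} : Function.Injective (e.hom.toFun (n := n)) :=
  Function.LeftInverse.injective e.inv_hom

theorem skeleton_adj {v w : X.Vertex} (h : X.skeleton.Adj v w) :
    Y.skeleton.Adj (e.hom.toFun v) (e.hom.toFun w) := by
  refine ⟨fun h' => h.1 (e.hom_injective h'), ?_⟩
  obtain ⟨a, ha⟩ := h.2
  refine ⟨e.hom.toFun a, ?_⟩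
  rw [← e.hom.map_src, ← e.hom.map_tgt]
  rcases ha with ⟨rfl, rfl⟩ | ⟨rfl, rfl⟩
  · exact Or.inl ⟨rfl, rfl⟩
  · exact Or.inr ⟨rfl, rfl⟩

def skeletonIso : X.skeleton ≃g Y.skeleton where
  toFun := e.hom.toFun
  invFun := e.inv.toFun
  left_inv := e.inv_hom
  right_inv := e.hom_inv
  map_rel_iff' := by
    intro v w
    refine ⟨fun h => ?_, e.skeleton_adj⟩
    have := e.symm.skeleton_adj h
    change X.skeleton.Adj (e.inv.toFun (e.hom.toFun v)) (e.inv.toFun (e.hom.toFun w)) at this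
    rwa [e.inv_hom, e.inv_hom] at this

theorem dist_hom (v w : X.Vertex) :
    Y.skeleton.dist (e.hom.toFun v) (e.hom.toFun w) = X.skeleton.dist v w :=
  SimpleGraph.dist_iso e.skeletonIso v w

theorem isNonpositivelyCurved (e : Iso X Y) (h : X.IsNonpositivelyCurved) : Y.IsNonpositivelyCurved where
  simplicial {n} c c' ho ha := by
    refine e.symm.hom_injective (h.simplicial _ _ ?_ fun i => ?_)
    · rw [← e.symm.hom.map_origin, ← e.symm.hom.map_origin, ho]
    · have := congrArg (e.symm.hom.toFun) (ha i)
      unfold axisEdge at this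
      rwa [e.symm.hom.map_face, e.symm.hom.map_face] at this
  flag {n} v a ha hs := by
    obtain ⟨c, hc, hc'⟩ := h.flag (e.inv.toFun v) (fun i => e.inv.toFun (a i))
      (fun i => by rw [← e.inv.map_src, ha]) (fun i j hij => by
        obtain ⟨s, h1, h2⟩ := hs i j hij
        refine ⟨e.inv.toFun s, ?_, ?_⟩
        · rw [← h1]; exact (e.inv.map_face _ _).symm
        · rw [← h2]; exact (e.inv.map_face _ _).symm)
    refine ⟨e.hom.toFun c, ?_, fun i => ?_⟩
    · rw [← e.hom.map_origin, hc, e.hom_inv]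
    · rw [← e.hom_inv (a i), ← hc' i]
      exact (e.hom.map_face _ _).symm

end Iso

/-! ### Transport of actions -/

namespace Action

variable {X Y : CubeComplex.{u}} {G : Type v} [Group G] (A : X.Action G) (e : Iso X Y)

def transport : Y.Action G where
  act g := ⟨fun c => e.hom.toFun ((A.act g).toFun (e.inv.toFun c)), fun φ c => by
    rw [e.inv.map_face, (A.act g).map_face, e.hom.map_face]⟩
  act_one c := by
    change e.hom.toFun _ = c
    rw [A.act_one, e.hom_inv]
  act_mul g h n c := by
    change e.hom.toFun _ = e.hom.toFun ((A.act g).toFun (e.inv.toFun (e.hom.toFun _)))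
    rw [e.inv_hom, A.act_mul]

theorem transport_act (g : G) {n : ℕ} (c : Y.cube n) :
    ((A.transport e).act g).toFun c = e.hom.toFun ((A.act g).toFun (e.inv.toFun c)) := rfl

variable {A}

theorem IsFree.transport (hA : A.IsFree) : (A.transport e).IsFree := by
  intro g n c φ h
  refine hA g (e.inv.toFun c) φ (e.hom_injective ?_)
  rw [e.hom.map_face, e.hom_inv]
  exact h

theorem IsProper.transport (hA : A.IsProper) : (A.transport e).IsProper := by
  intro x r
  refine (hA (e.inv.toFun x) r).subset fun g hg => ?_
  change Y.skeleton.dist x (e.hom.toFun _) ≤ r at hg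
  rw [← e.hom_inv x, e.dist_hom, e.inv_hom] at hg
  exact hg

theorem IsCocompact.transport (hA : A.IsCocompact) : (A.transport e).IsCocompact := by
  obtain ⟨S, hS, h⟩ := hA
  refine ⟨(fun c : Σ n, X.cube n => (⟨c.1, e.hom.toFun c.2⟩ : Σ n, Y.cube n)) '' S,
    hS.image _, fun c => ?_⟩
  obtain ⟨g, hg⟩ := h (e.inv.toFun c)
  exact ⟨g, _, hg, rfl⟩

end Action

/-- The quotient map of an action that is free on vertices is a covering map. -/
theorem Hom.isCovering_of_orbits {X Z : CubeComplex.{u}} {G : Type v} [Group G] (A : X.Action G)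
    (p : Hom X Z) (hfree : ∀ (g : G) (v : X.Vertex), (A.act g).toFun v = v → g = 1)
    (hsurj : ∀ n, Function.Surjective (p.toFun (n := n)))
    (hfib : ∀ {n : ℕ} (c c' : X.cube n), p.toFun c = p.toFun c' ↔ ∃ g, (A.act g).toFun c = c') :
    p.IsCovering := by
  intro n x c hc
  obtain ⟨d, rfl⟩ := hsurj n c
  rw [← p.map_origin] at hc
  obtain ⟨g, hg⟩ := (hfib _ _).1 hc
  refine ⟨(A.act g).toFun d, ⟨?_, ((hfib _ _).2 ⟨g, rfl⟩).symm⟩, ?_⟩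
  · rw [← hg, Hom.map_origin]
  · rintro d' ⟨hd', hd⟩
    obtain ⟨k, rfl⟩ := (hfib _ _).1 hd.symm
    rw [← Hom.map_origin] at hd'
    have : (A.act (k * g⁻¹)).toFun x = x := by
      rw [A.act_mul, ← hg, ← A.act_mul g⁻¹ g, inv_mul_cancel, A.act_one, hd', hg]
    rw [eq_of_mul_inv_eq_one (hfree _ _ this)]

/-! ### Transport of factor systems -/

namespace Subcomplex

variable {X Y : CubeComplex.{u}}

def comap (f : Hom X Y) (K : Y.Subcomplex) : X.Subcomplex where
  carrier n := {c | f.toFun c ∈ K.carrier n}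
  face_mem φ c hc := by
    change f.toFun _ ∈ K.carrier _
    rw [f.map_face]
    exact K.face_mem φ _ hc

theorem mem_comap_verts {f : Hom X Y} {K : Y.Subcomplex} {v : X.Vertex} :
    v ∈ (comap f K).verts ↔ f.toFun v ∈ K.verts := Iff.rfl

variable (e : Iso X Y)

theorem comap_inv_comap_hom (K : Y.Subcomplex) : comap e.inv (comap e.hom K) = K := by
  ext n c
  change e.hom.toFun (e.inv.toFun c) ∈ K.carrier n ↔ _
  rw [e.hom_inv]

theorem comap_hom_comap_inv (K : X.Subcomplex) : comap e.hom (comap e.inv K) = K :=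
  comap_inv_comap_hom e.symm K

theorem IsConvex.comap {K : Y.Subcomplex} (hK : K.IsConvex) :
    (Subcomplex.comap e.hom K).IsConvex where
  full c hc := hK.full _ fun x => by
    have := hc x
    rwa [mem_comap_verts, e.hom.map_vert] at this
  geodesic v hv w hw z hz := by
    rw [mem_comap_verts] at hv hw ⊢
    refine hK.geodesic _ hv _ hw _ ?_
    rw [e.dist_hom, e.dist_hom, e.dist_hom, hz]

theorem comap_span (S : Set Y.Vertex) :
    comap e.hom (span S) = span (e.hom.toFun ⁻¹' S) := by
  ext n c
  change (∀ x, _ ∈ S) ↔ ∀ x, _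
  refine forall_congr' fun x => ?_
  rw [Set.mem_preimage, e.hom.map_vert]

theorem comap_proj (K L : Y.Subcomplex) :
    comap e.hom (proj K L) = proj (comap e.hom K) (comap e.hom L) := by
  unfold proj
  rw [comap_span]
  congr 1
  ext v
  simp only [Set.mem_preimage, Set.mem_ofPred_eq, mem_comap_verts]
  refine and_congr_right fun _ => ⟨?_, ?_⟩
  · rintro ⟨w, hw, h⟩
    refine ⟨e.inv.toFun w, by rwa [e.hom_inv], fun u hu => ?_⟩
    have := h _ hu
    rwa [← e.hom_inv w, e.dist_hom, e.dist_hom] at this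
  · rintro ⟨w, hw, h⟩
    refine ⟨_, hw, fun u hu => ?_⟩
    have := h (e.inv.toFun u) (by rwa [e.hom_inv])
    rw [← e.hom_inv u, e.dist_hom, e.dist_hom]
    exact this

end Subcomplex

theorem SameHyperplane.map {X Y : CubeComplex.{u}} (f : Hom X Y) {a b : X.Edge}
    (h : SameHyperplane a b) : SameHyperplane (f.toFun a) (f.toFun b) := by
  induction h with
  | rel a b h =>
    obtain ⟨s, rfl, rfl⟩ := h
    exact .rel _ _ ⟨f.toFun s, (f.map_face _ _).symm, (f.map_face _ _).symm⟩
  | refl a => exact .refl _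
  | symm _ _ _ ih => exact .symm _ _ ih
  | trans _ _ _ _ _ h1 h2 => exact .trans _ _ _ h1 h2

namespace Iso

variable {X Y : CubeComplex.{u}} (e : Iso X Y)

theorem sameHyperplane_iff {a b : X.Edge} :
    SameHyperplane (e.hom.toFun a) (e.hom.toFun b) ↔ SameHyperplane a b := by
  refine ⟨fun h => ?_, fun h => h.map e.hom⟩
  have := h.map e.inv
  rwa [e.inv_hom, e.inv_hom] at this

theorem comap_combHyperplane (a : X.Edge) :
    Subcomplex.comap e.hom (combHyperplane (e.hom.toFun a)) = combHyperplane a := by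
  unfold combHyperplane
  rw [Subcomplex.comap_span]
  congr 1
  ext v
  constructor
  · rintro ⟨b, hb, hv⟩
    refine ⟨e.inv.toFun b, ?_, ?_⟩
    · rwa [← e.sameHyperplane_iff, e.hom_inv]
    · rw [← e.inv.map_src, hv, e.inv_hom]
  · rintro ⟨b, hb, rfl⟩
    exact ⟨_, hb.map e.hom, (e.hom.map_src b).symm⟩

theorem comap_crosses {K : Y.Subcomplex} {a : X.Edge} :
    (Subcomplex.comap e.hom K).Crosses a ↔ K.Crosses (e.hom.toFun a) := by
  constructor
  · rintro ⟨b, hb, h⟩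
    exact ⟨_, hb, h.map e.hom⟩
  · rintro ⟨b, hb, h⟩
    refine ⟨e.inv.toFun b, ?_, ?_⟩
    · change e.hom.toFun _ ∈ K.carrier _
      rwa [e.hom_inv]
    · rwa [← e.sameHyperplane_iff, e.hom_inv]

/-- All clauses are expressed through faces and skeleton distances, hence invariant under
isomorphism. This carries the contradiction found in the model to an arbitrary universal cover. -/
theorem hasFactorSystem (e : Iso X Y) (h : Y.HasFactorSystem) : X.HasFactorSystem := by
  obtain ⟨𝔉, h𝔉⟩ := h
  refine ⟨{K | Subcomplex.comap e.inv K ∈ 𝔉}, h𝔉.whole_mem, fun F hF => ?_, ?_,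
    fun K a hK hK' hp => ?_, ?_⟩
  · obtain ⟨⟨v, hv⟩, hc⟩ := h𝔉.nonempty_convex _ hF
    exact ⟨⟨_, hv⟩, Subcomplex.comap_hom_comap_inv e F ▸ hc.comap e⟩
  · obtain ⟨Δ, hΔ⟩ := h𝔉.multiplicity
    refine ⟨Δ, fun x => le_trans ?_ (hΔ (e.hom.toFun x))⟩
    refine Set.encard_le_encard_of_injOn (f := Subcomplex.comap e.inv) ?_ ?_
    · rintro F ⟨hF, hx⟩
      refine ⟨hF, ?_⟩
      rwa [Subcomplex.mem_comap_verts, e.inv_hom]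
    · intro F _ F' _ h
      rw [← Subcomplex.comap_hom_comap_inv e F, h, Subcomplex.comap_hom_comap_inv]
  · refine h𝔉.hyperplanes _ (e.hom.toFun a) (hK.comap e.symm) ?_ ?_
    · obtain ⟨v, hv, w, hw, hvw⟩ := hK'
      refine ⟨e.hom.toFun v, ?_, e.hom.toFun w, ?_, fun h => hvw (e.hom_injective h)⟩
      · rwa [Subcomplex.mem_comap_verts, e.inv_hom]
      · rwa [Subcomplex.mem_comap_verts, e.inv_hom]
    · intro b
      rw [← e.symm_hom, e.symm.comap_crosses]
      change K.Crosses (e.inv.toFun b) ↔ _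
      rw [hp, ← e.comap_combHyperplane, e.comap_crosses, e.hom_inv]
  · obtain ⟨ξ, hξ⟩ := h𝔉.projections
    refine ⟨ξ, fun F hF F' hF' => ?_⟩
    refine (hξ _ hF _ hF').imp (fun h => ?_) fun h v hv w hw => ?_
    · rwa [← e.symm_hom, ← Subcomplex.comap_proj e.symm] at h
    · rw [← e.symm_hom, ← Subcomplex.comap_proj e.symm] at h
      rw [← e.dist_hom]
      refine h _ ?_ _ ?_
      · rwa [Subcomplex.mem_comap_verts, e.symm_hom, e.inv_hom]
      · rwa [Subcomplex.mem_comap_verts, e.symm_hom, e.inv_hom]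

end Iso

end CubeComplex

/-! ### Squares and two-dimensionality in graphs. -/

namespace SimpleGraph

variable {V : Type u} (G : SimpleGraph V)

/-- The edges `ua` and `ub` are sides of a common square. -/
def SpanSquare (u a b : V) : Prop :=
  a ≠ b ∧ G.Adj u a ∧ G.Adj u b ∧ ∃ w, w ≠ u ∧ G.Adj w a ∧ G.Adj w b

/-- There is no vertex with three edges that pairwise span squares. -/
def TwoDimensional : Prop :=
  ∀ u a b c, G.SpanSquare u a b → G.SpanSquare u b c → G.SpanSquare u a c → False

variable {G}

theorem SpanSquare.map {W : Type v} {H : SimpleGraph W} (f : G ≃g H) {u a b : V}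
    (h : G.SpanSquare u a b) : H.SpanSquare (f u) (f a) (f b) := by
  obtain ⟨h1, h2, h3, w, h4, h5, h6⟩ := h
  exact ⟨f.injective.ne h1, f.map_rel_iff.2 h2, f.map_rel_iff.2 h3, f w, f.injective.ne h4,
    f.map_rel_iff.2 h5, f.map_rel_iff.2 h6⟩

end SimpleGraph

namespace CubeComplex

/-- The neighbour of the corner `x` in direction `i`. -/
def flipAt {n : ℕ} (x : Corner n) (i : Fin n) : Corner n := Function.update x i (!x i)

theorem hammingDist_update {n : ℕ} (x : Corner n) (i : Fin n) {s t : Bool} (h : s ≠ t) :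
    hammingDist (Function.update x i s) (Function.update x i t) = 1 := by
  have h2 : (Finset.univ.filter fun j =>
      Function.update x i s j ≠ Function.update x i t j) = {i} := by
    ext j
    by_cases hj : j = i
    · subst hj
      simp [h]
    · simp [hj]
  rw [hammingDist, h2, Finset.card_singleton]

theorem hammingDist_flipAt {n : ℕ} (x : Corner n) (i : Fin n) :
    hammingDist x (flipAt x i) = 1 := by
  have := hammingDist_update x i (s := x i) (t := !x i) (by simp)
  rwa [Function.update_eq_self] at this

theorem flipAt_comm {n : ℕ} (x : Corner n) {i j : Fin n} (h : i ≠ j) :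
    flipAt (flipAt x i) j = flipAt (flipAt x j) i := by
  unfold flipAt
  rw [Function.update_of_ne h.symm, Function.update_of_ne h, Function.update_comm h]

theorem flipAt_injective {n : ℕ} (x : Corner n) {i j : Fin n} (h : i ≠ j) :
    flipAt x i ≠ flipAt x j := by
  intro h'
  have := congrFun h' i
  simp [flipAt, h] at this

theorem flipAt_flipAt_ne {n : ℕ} (x : Corner n) {i j : Fin n} (h : i ≠ j) :
    flipAt (flipAt x i) j ≠ x := by
  intro h'
  have := congrFun h' i
  simp [flipAt, h] at this

/-! ### Cubes, edges and squares of the complex of a graph. -/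

section OfGraph

variable {V : Type u} {G : SimpleGraph V}

theorem cube_adj_flipAt {n : ℕ} (c : (ofGraph G).cube n) (x : Corner n) (i : Fin n) :
    G.Adj (c.1 x) (c.1 (flipAt x i)) :=
  c.2.2 _ _ (hammingDist_flipAt x i)

theorem cube_spanSquare {n : ℕ} (c : (ofGraph G).cube n) (x : Corner n) {i j : Fin n}
    (h : i ≠ j) : G.SpanSquare (c.1 x) (c.1 (flipAt x i)) (c.1 (flipAt x j)) :=
  ⟨c.2.1.ne (flipAt_injective x h), cube_adj_flipAt c x i, cube_adj_flipAt c x j,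
    c.1 (flipAt (flipAt x i) j), c.2.1.ne (flipAt_flipAt_ne x h), (cube_adj_flipAt c _ j).symm, by
      rw [flipAt_comm x h]
      exact (cube_adj_flipAt c _ i).symm⟩

/-- Three edges at a corner of a cube of dimension at least 3 would pairwise span squares. -/
theorem cube_dim_le {n : ℕ} (hG : G.TwoDimensional) (c : (ofGraph G).cube n) : n ≤ 2 := by
  by_contra! h
  exact hG _ _ _ _ (cube_spanSquare c (fun _ => false) (i := ⟨0, by omega⟩) (j := ⟨1, by omega⟩)
      (by simp)) (cube_spanSquare c _ (i := ⟨1, by omega⟩) (j := ⟨2, by omega⟩) (by simp))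
    (cube_spanSquare c _ (i := ⟨0, by omega⟩) (j := ⟨2, by omega⟩) (by simp))

/-- A vertex of the graph as a vertex of the cube complex. -/
def vtx (G : SimpleGraph V) (v : V) : (ofGraph G).Vertex :=
  ⟨fun _ => v, fun _ _ _ => Subsingleton.elim _ _, fun x y h => by
    rw [Subsingleton.elim x y, hammingDist_self] at h
    exact absurd h zero_ne_one⟩

/-- The vertex of the graph underlying a vertex of the cube complex. -/
def pt (v : (ofGraph G).Vertex) : V := v.1 fun _ => false

@[simp] theorem pt_vtx (v : V) : pt (vtx G v) = v := rfl

@[simp] theorem vtx_pt (v : (ofGraph G).Vertex) : vtx G (pt v) = v :=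
  Subtype.ext (funext fun _ => congrArg v.1 (Subsingleton.elim _ _))

theorem pt_injective : Function.Injective (pt (G := G)) :=
  Function.LeftInverse.injective vtx_pt

theorem corner_one (t : Corner 1) : t = (fun _ => false) ∨ t = fun _ => true := by
  rcases h : t 0 with _ | _
  · left; funext i; rw [Subsingleton.elim i 0, h]
  · right; funext i; rw [Subsingleton.elim i 0, h]

theorem edge_adj (e : (ofGraph G).Edge) :
    G.Adj (pt ((ofGraph G).src e)) (pt ((ofGraph G).tgt e)) :=
  e.2.2 _ _ rfl

/-- An edge of the cube complex of a graph. -/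
def mkEdge {v w : V} (h : G.Adj v w) : (ofGraph G).Edge :=
  ⟨fun t => cond (t 0) w v, by
    intro s t hst
    rcases corner_one s with rfl | rfl <;> rcases corner_one t with rfl | rfl
    · rfl
    · exact absurd hst h.ne
    · exact absurd hst.symm h.ne
    · rfl, by
    intro s t hst
    rcases corner_one s with rfl | rfl <;> rcases corner_one t with rfl | rfl
    · simp at hst
    · exact h
    · exact h.symm
    · simp at hst⟩

theorem edge_ext {e e' : (ofGraph G).Edge} (h : (ofGraph G).src e = (ofGraph G).src e')
    (h' : (ofGraph G).tgt e = (ofGraph G).tgt e') : e = e' := by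
  apply Subtype.ext
  funext t
  rcases corner_one t with rfl | rfl
  · exact congrArg pt h
  · exact congrArg pt h'

theorem corner_two (t : Corner 2) : t = ![false, false] ∨ t = ![true, false] ∨
    t = ![false, true] ∨ t = ![true, true] := by
  rcases h0 : t 0 with _ | _ <;> rcases h1 : t 1 with _ | _
  · left; ext i; fin_cases i <;> simp [h0, h1]
  · right; right; left; ext i; fin_cases i <;> simp [h0, h1]
  · right; left; ext i; fin_cases i <;> simp [h0, h1]
  · right; right; right; ext i; fin_cases i <;> simp [h0, h1]

/-- The square with corners `u, a, b, w`, where `u` and `w` are opposite. -/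
def mkSquare {u a b w : V} (hab : a ≠ b) (huw : u ≠ w) (h1 : G.Adj u a) (h2 : G.Adj u b)
    (h3 : G.Adj w a) (h4 : G.Adj w b) : (ofGraph G).cube 2 :=
  ⟨fun t => cond (t 0) (cond (t 1) w a) (cond (t 1) b u), by
    intro s t hst
    have := h1.ne; have := h2.ne; have := h3.ne; have := h4.ne
    rcases corner_two s with rfl | rfl | rfl | rfl <;>
      rcases corner_two t with rfl | rfl | rfl | rfl <;> simp at hst ⊢ <;> simp_all, by
    intro s t hst
    have := h1.symm; have := h2.symm; have := h3.symm; have := h4.symm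
    rcases corner_two s with rfl | rfl | rfl | rfl <;>
      rcases corner_two t with rfl | rfl | rfl | rfl <;>
      first
        | assumption
        | exact absurd hst (by decide)⟩

/-- The 1-skeleton of the cube complex of a graph is the graph. -/
def ofGraphSkeleton (G : SimpleGraph V) : (ofGraph G).skeleton ≃g G where
  toFun := pt
  invFun := vtx G
  left_inv := vtx_pt
  right_inv := pt_vtx
  map_rel_iff' := by
    intro v w
    constructor
    · intro h
      refine ⟨fun hvw => h.ne (congrArg pt hvw), mkEdge h, Or.inl ⟨?_, ?_⟩⟩
      · exact vtx_pt v
      · exact vtx_pt w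
    · rintro ⟨-, e, ⟨rfl, rfl⟩ | ⟨rfl, rfl⟩⟩
      · exact edge_adj e
      · exact (edge_adj e).symm

theorem dist_ofGraph (v w : (ofGraph G).Vertex) :
    (ofGraph G).skeleton.dist v w = G.dist (pt v) (pt w) :=
  (SimpleGraph.dist_iso (ofGraphSkeleton G) v w).symm

/-! ### Curvature -/

theorem src_axisEdge {X : CubeComplex.{u}} {n : ℕ} (c : X.cube n) (i : Fin n) :
    X.src (X.axisEdge c i) = X.origin c := by
  rw [axisEdge, src_side, origin, Function.update_eq_self_iff.2 rfl]

/-- Only cubes of dimension at most 2 matter. The one real case of `simplicial` is that of two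
squares with three common corners and different fourth corners: together they form a K₂,₃, and at
the corner `![true, false]` its three edges pairwise span squares, closed up by `![false, true]`.
For `flag`, three pairwise adjacent edges do not occur, and for two edges the hypothesis already
provides the square. -/
theorem ofGraph_isNonpositivelyCurved (hG : G.TwoDimensional) :
    (ofGraph G).IsNonpositivelyCurved where
  simplicial {n} c c' ho ha := by
    have h0 : c.1 (fun _ => false) = c'.1 (fun _ => false) := congrArg pt ho
    have h1 : ∀ i, c.1 (flipAt (fun _ => false) i) = c'.1 (flipAt (fun _ => false) i) := fun i =>
      congrArg (fun e => pt ((ofGraph G).tgt e)) (ha i)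
    have hn := cube_dim_le hG c
    apply Subtype.ext
    funext x
    interval_cases n
    · rw [Subsingleton.elim x fun _ => false, h0]
    · rcases corner_one x with rfl | rfl
      · exact h0
      · have h2 : (fun _ => true : Corner 1) = flipAt (fun _ => false) 0 := by decide
        rw [h2, h1]
    · have e0 : (fun _ => false : Corner 2) = ![false, false] := by decide
      have e1 : flipAt (fun _ => false : Corner 2) 0 = ![true, false] := by decide
      have e2 : flipAt (fun _ => false : Corner 2) 1 = ![false, true] := by decide
      have h10 := h1 0
      have h11 := h1 1
      rw [e0] at h0
      rw [e1] at h10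
      rw [e2] at h11
      rcases corner_two x with rfl | rfl | rfl | rfl
      · exact h0
      · exact h10
      · exact h11
      · by_contra hne
        have a1 : ∀ d : (ofGraph G).cube 2, G.Adj (d.1 ![true, false]) (d.1 ![true, true]) :=
          fun d => d.2.2 _ _ (by decide)
        have a2 : ∀ d : (ofGraph G).cube 2, G.Adj (d.1 ![false, true]) (d.1 ![true, true]) :=
          fun d => d.2.2 _ _ (by decide)
        have a3 : G.Adj (c.1 ![true, false]) (c.1 ![false, false]) := c.2.2 _ _ (by decide)
        have a4 : G.Adj (c.1 ![false, true]) (c.1 ![false, false]) := c.2.2 _ _ (by decide)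
        have n1 : c.1 ![false, true] ≠ c.1 ![true, false] := c.2.1.ne (by decide)
        have b1 := a1 c'
        have b2 := a2 c'
        rw [← h10] at b1
        rw [← h11] at b2
        refine hG (c.1 ![true, false]) (c.1 ![false, false]) (c.1 ![true, true])
          (c'.1 ![true, true]) ⟨?_, a3, a1 c, _, n1, a4, a2 c⟩
          ⟨hne, a1 c, b1, _, n1, a2 c, b2⟩ ⟨?_, a3, b1, _, n1, a4, b2⟩
        · exact c.2.1.ne (by decide)
        · rw [h0]
          exact c'.2.1.ne (by decide)
  flag {n} v e he hs := by
    have hsq : ∀ i j, i ≠ j → G.SpanSquare (pt v) (pt ((ofGraph G).tgt (e i)))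
        (pt ((ofGraph G).tgt (e j))) := by
      intro i j hij
      obtain ⟨s, h1, h2⟩ := hs i j hij
      rw [← he i, ← h1, ← h2, src_axisEdge]
      exact cube_spanSquare s (fun _ => false) (i := 0) (j := 1) (by decide)
    have hn : n ≤ 2 := by
      by_contra! h
      exact hG _ _ _ _ (hsq ⟨0, by omega⟩ ⟨1, by omega⟩ (by simp))
        (hsq ⟨1, by omega⟩ ⟨2, by omega⟩ (by simp)) (hsq ⟨0, by omega⟩ ⟨2, by omega⟩ (by simp))
    interval_cases n
    · exact ⟨v, vert_zero _ _, fun i => i.elim0⟩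
    · refine ⟨e 0, he 0, fun i => ?_⟩
      rw [Subsingleton.elim i 0]
      apply Subtype.ext
      funext t
      rcases corner_one t with rfl | rfl <;> exact congrArg (e 0).1 (by decide)
    · obtain ⟨s, h1, h2⟩ := hs 0 1 (by decide)
      refine ⟨s, ?_, fun i => ?_⟩
      · rw [← he 0, ← h1, src_axisEdge]
      · fin_cases i
        · exact h1
        · exact h2

end OfGraph

/-! ### A criterion for simple connectedness -/

section SimplyConnected

/-- Homotopy of lists of edges that are edge paths from `v` to `w`. -/
def ListHomotopic (X : CubeComplex.{u}) (v w : X.Vertex) (l l' : List X.Edge) : Prop :=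
  ∃ (h : X.IsPath l v w) (h' : X.IsPath l' v w), X.Homotopic ⟨l, h⟩ ⟨l', h'⟩

namespace ListHomotopic

variable {X : CubeComplex.{u}} {v w : X.Vertex}

theorem refl {l : List X.Edge} (h : X.IsPath l v w) : ListHomotopic X v w l l := ⟨h, h, .refl _⟩

theorem symm {l l' : List X.Edge} (h : ListHomotopic X v w l l') : ListHomotopic X v w l' l :=
  ⟨h.2.1, h.1, .symm _ _ h.2.2⟩

theorem trans {l l' l'' : List X.Edge} (h : ListHomotopic X v w l l')
    (h' : ListHomotopic X v w l' l'') : ListHomotopic X v w l l'' :=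
  ⟨h.1, h'.2.1, .trans _ _ _ h.2.2 h'.2.2⟩

theorem step {l l' : List X.Edge} (hs : X.HomotopyStep l l') (h : X.IsPath l v w)
    (h' : X.IsPath l' v w) : ListHomotopic X v w l l' :=
  ⟨h, h', .rel _ _ hs⟩

theorem append {m m' l l' : List X.Edge} {a b : X.Vertex} (h : ListHomotopic X v w m m')
    (hl : X.IsPath l a v) (hl' : X.IsPath l' w b) :
    ListHomotopic X a b (l ++ m ++ l') (l ++ m' ++ l') := by
  obtain ⟨h1, h2, h⟩ := h
  have hp : ∀ p : X.EdgePath v w, X.IsPath (l ++ p.1 ++ l') a b := fun p =>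
    isPath_append.2 ⟨_, isPath_append.2 ⟨_, hl, p.2⟩, hl'⟩
  have key : ∀ p q : X.EdgePath v w, X.Homotopic p q →
      ListHomotopic X a b (l ++ p.1 ++ l') (l ++ q.1 ++ l') := by
    intro p q h
    induction h with
    | rel p q h =>
      refine step ?_ (hp p) (hp q)
      generalize p.1 = p at h
      generalize q.1 = q at h
      cases h with
      | backtrack l₁ l₂ e => simpa using HomotopyStep.backtrack (l ++ l₁) (l₂ ++ l') e
      | square l₁ l₂ s => simpa using HomotopyStep.square (l ++ l₁) (l₂ ++ l') s
    | refl p => exact refl (hp p)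
    | symm _ _ _ ih => exact ih.symm
    | trans _ _ _ _ _ h1 h2 => exact h1.trans h2
  exact key _ _ h

theorem reverse (l : List X.Edge) (hl : X.IsPath l v w) :
    ListHomotopic X v v (l ++ l.reverse.map X.rev) [] := by
  induction l generalizing v with
  | nil => exact refl rfl
  | cons e l ih =>
    have h1 : X.IsPath [e] v (X.tgt e) := ⟨hl.1, rfl⟩
    have h2 : X.IsPath [X.rev e] (X.tgt e) v := ⟨src_rev e, (tgt_rev e).trans hl.1⟩
    have h3 := (ih hl.2).append h1 h2
    have h4 : ListHomotopic X v v [] [e, X.rev e] :=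
      step (.backtrack [] [] e) rfl (isPath_append.2 ⟨_, h1, h2⟩)
    simpa using h3.trans h4.symm

end ListHomotopic

/-- If the loops at one vertex of a connected complex are trivial, then all loops are. -/
theorem isSimplyConnected_of_base {X : CubeComplex.{u}} (b : X.Vertex)
    (hconn : ∀ v w : X.Vertex, Nonempty (X.EdgePath v w))
    (h : ∀ l, X.IsPath l b b → ListHomotopic X b b l []) : X.IsSimplyConnected := by
  refine ⟨⟨b⟩, hconn, fun v p => ?_⟩
  obtain ⟨l, hl⟩ := hconn v b
  have hr := exists_reverse_path l hl
  have h1 := (h _ (isPath_append.2 ⟨_, isPath_append.2 ⟨_, hr, p.2⟩, hl⟩)).append hl hr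
  have h2 := ListHomotopic.reverse l hl
  have h3 := h2.append (l := []) rfl (isPath_append.2 ⟨_, p.2, isPath_append.2 ⟨_, hl, hr⟩⟩)
  have h4 := h2.append (l' := []) p.2 rfl
  simp only [List.append_nil, List.nil_append, List.append_assoc] at h1 h2 h3 h4
  exact (h4.symm.trans (h3.symm.trans (h1.trans h2))).2.2

variable {V : Type u} {G : SimpleGraph V}

/-- The rank rises along the first edge and ends at its minimum 0, and it changes along each edge.
So it must turn at some vertex, which is where a homotopy can lower the path. -/
theorem exists_peak (f : V → ℕ) (hne : ∀ v w, G.Adj v w → f v ≠ f w) (l : List (ofGraph G).Edge) :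
    ∀ (e : (ofGraph G).Edge) {v w : (ofGraph G).Vertex}, (ofGraph G).IsPath (e :: l) v w →
      f (pt w) = 0 → f (pt ((ofGraph G).src e)) < f (pt ((ofGraph G).tgt e)) →
      ∃ (l₁ l₂ : List (ofGraph G).Edge) (e₁ e₂ : (ofGraph G).Edge), e :: l = l₁ ++ [e₁, e₂] ++ l₂ ∧
        (ofGraph G).src e₂ = (ofGraph G).tgt e₁ ∧
        f (pt ((ofGraph G).src e₁)) < f (pt ((ofGraph G).tgt e₁)) ∧
        f (pt ((ofGraph G).tgt e₂)) < f (pt ((ofGraph G).tgt e₁)) := by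
  induction l with
  | nil =>
    rintro e v w ⟨-, rfl⟩ hw h
    omega
  | cons e' l ih =>
    rintro e v w ⟨-, h1⟩ hw h
    rcases lt_or_ge (f (pt ((ofGraph G).tgt e'))) (f (pt ((ofGraph G).tgt e))) with h2 | h2
    · exact ⟨[], l, e, e', rfl, h1.1, h, h2⟩
    · have h3 := hne _ _ (edge_adj e')
      rw [h1.1] at h3
      obtain ⟨l₁, l₂, e₁, e₂, h4, h5⟩ := ih e' h1 hw (by rw [h1.1]; omega)
      exact ⟨e :: l₁, l₂, e₁, e₂, by rw [h4]; rfl, h5⟩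

/-- A graph with a rank function, such that two vertices of lower rank adjacent to `v` are
opposite to `v` in a square whose fourth vertex also has lower rank, spans a simply connected
cube complex. -/
theorem ofGraph_isSimplyConnected (hconn : G.Connected) (f : V → ℕ) (b : V) (hb : f b = 0)
    (hne : ∀ v w, G.Adj v w → f v ≠ f w)
    (hquad : ∀ v u u', G.Adj v u → G.Adj v u' → f u < f v → f u' < f v → u ≠ u' →
      ∃ w, w ≠ v ∧ G.Adj w u ∧ G.Adj w u' ∧ f w < f v) :
    (ofGraph G).IsSimplyConnected := by
  refine isSimplyConnected_of_base (vtx G b) (fun v w => ?_) fun l hl => ?_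
  · obtain ⟨q⟩ := hconn (pt v) (pt w)
    have : ∀ {x y : V}, G.Walk x y → Nonempty ((ofGraph G).EdgePath (vtx G x) (vtx G y)) := by
      intro x y q
      induction q with
      | nil => exact ⟨[], rfl⟩
      | cons h q ih =>
        obtain ⟨l, hl⟩ := ih
        exact ⟨mkEdge h :: l, rfl, hl⟩
    have h := this q
    rwa [vtx_pt, vtx_pt] at h
  -- Induction on the sum of the ranks of the endpoints of the edges. At a peak, either the two
  -- edges form a backtrack, which is deleted, or `hquad` gives a square across which the peak is
  -- replaced by a lower vertex. The sum drops in both cases.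
  · have key : ∀ (N : ℕ) (l : List (ofGraph G).Edge), (ofGraph G).IsPath l (vtx G b) (vtx G b) →
        (l.map fun e => f (pt ((ofGraph G).tgt e))).sum = N →
        ListHomotopic (ofGraph G) (vtx G b) (vtx G b) l [] := by
      intro N
      induction N using Nat.strong_induction_on with
      | _ N ih =>
        intro l hl hN
        rcases l with _ | ⟨e, l⟩
        · exact .refl rfl
        · have h0 : f (pt ((ofGraph G).src e)) = 0 := by rw [hl.1, pt_vtx, hb]
          have h1 := hne _ _ (edge_adj e)
          obtain ⟨l₁, l₂, e₁, e₂, h2, h3, h4, h5⟩ := exists_peak f hne l e hl hb (by omega)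
          rw [h2] at hN hl ⊢
          obtain ⟨y, h6, h7⟩ := isPath_append.1 hl
          obtain ⟨x, h8, h9, -, h10⟩ := isPath_append.1 h6
          have h10 : (ofGraph G).tgt e₂ = y := h10
          by_cases hu : (ofGraph G).src e₁ = (ofGraph G).tgt e₂
          · have h11 : e₂ = (ofGraph G).rev e₁ :=
              edge_ext (by rw [h3, src_rev]) (by rw [tgt_rev, hu])
            have h12 : (ofGraph G).IsPath (l₁ ++ l₂) (vtx G b) (vtx G b) :=
              isPath_append.2 ⟨x, h8, by rwa [← h9, hu, h10]⟩
            refine (ListHomotopic.step ?_ h12 hl).symm.trans (ih _ ?_ _ h12 rfl)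
            · subst h11
              exact .backtrack l₁ l₂ e₁
            · simp only [List.map_append, List.sum_append, List.map_cons, List.map_nil,
                List.sum_cons, List.sum_nil] at hN ⊢
              omega
          · have a1 := edge_adj e₁
            have a2 := edge_adj e₂
            rw [h3] at a2
            obtain ⟨w, hw1, hw2, hw3, hw4⟩ := hquad _ _ _ a1.symm a2 h4 h5
              (fun h => hu (pt_injective h))
            let s := mkSquare hw1.symm (fun h => hu (pt_injective h)) a1 hw2.symm a2.symm hw3.symm
            have s1 : (ofGraph G).face (CubeMap.side 0 ![false, false]) s = e₁ :=
              edge_ext (vtx_pt ((ofGraph G).src e₁)) (vtx_pt ((ofGraph G).tgt e₁))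
            have s2 : (ofGraph G).face (CubeMap.side 1 ![true, false]) s = e₂ :=
              edge_ext ((vtx_pt ((ofGraph G).tgt e₁)).trans h3.symm) (vtx_pt ((ofGraph G).tgt e₂))
            have h12 : (ofGraph G).IsPath (l₁ ++ [(ofGraph G).face (CubeMap.side 1
                ![false, false]) s, (ofGraph G).face (CubeMap.side 0 ![false, true]) s] ++ l₂)
                (vtx G b) (vtx G b) := by
              refine isPath_append.2 ⟨y, isPath_append.2 ⟨x, h8, ?_, rfl, ?_⟩, h7⟩
              · exact (vtx_pt _).trans h9
              · exact (vtx_pt _).trans h10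
            refine (ListHomotopic.step ?_ hl h12).trans (ih _ ?_ _ h12 rfl)
            · have := HomotopyStep.square l₁ l₂ s
              rwa [s1, s2] at this
            · have t1 : pt ((ofGraph G).tgt ((ofGraph G).face (CubeMap.side 1
                ![false, false]) s)) = w := rfl
              have t2 : pt ((ofGraph G).tgt ((ofGraph G).face (CubeMap.side 0
                ![false, true]) s)) = pt ((ofGraph G).tgt e₂) := rfl
              simp only [List.map_append, List.sum_append, List.map_cons, List.map_nil,
                List.sum_cons, List.sum_nil, t1, t2] at hN ⊢
              omega
    exact key _ l hl rfl

end SimplyConnected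

end CubeComplex

/-! ### Trees, lines in trees, and products of two trees. -/

namespace SimpleGraph

section Tree

variable {V : Type u} {T : SimpleGraph V}

/-- Each neighbour of `v` closer to `r` is the penultimate vertex of a path from `r` to `v`, and
there is only one such path. -/
theorem IsTree.eq_of_dist_lt (hT : T.IsTree) (r : V) {v a b : V} (ha : T.Adj v a)
    (hb : T.Adj v b) (ha' : T.dist r a < T.dist r v) (hb' : T.dist r b < T.dist r v) : a = b := by
  have key : ∀ c, T.Adj v c → T.dist r c < T.dist r v →
      ∃ p : T.Walk r v, p.IsPath ∧ p.penultimate = c := by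
    intro c hc hc'
    obtain ⟨p, hp⟩ := hT.connected.exists_walk_length_eq_dist r c
    refine ⟨p.concat hc.symm, Walk.isPath_of_length_eq_dist _ ?_, Walk.penultimate_concat _ _⟩
    rw [Walk.length_concat, hp]
    rcases hT.dist_eq_dist_add_one_of_adj r hc with h | h <;> omega
  obtain ⟨p, hp, rfl⟩ := key a ha ha'
  obtain ⟨q, hq, rfl⟩ := key b hb hb'
  rw [(hT.existsUnique_path r v).unique hp hq]

/-- Trees have no 4-cycles: seen from `u`, the vertex `w` has distance 2, and `a`, `b` are both
neighbours of `w` at distance 1. -/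
theorem IsTree.eq_of_common_adj (hT : T.IsTree) {u w a b : V} (huw : u ≠ w) (h1 : T.Adj u a)
    (h2 : T.Adj u b) (h3 : T.Adj w a) (h4 : T.Adj w b) : a = b := by
  have ha := dist_eq_one_iff_adj.2 h1
  have hb := dist_eq_one_iff_adj.2 h2
  have h0 := hT.connected.pos_dist_of_ne huw
  have h5 := hT.dist_eq_dist_add_one_of_adj u h3
  refine hT.eq_of_dist_lt u h3 h4 ?_ ?_ <;> omega

/-- A bi-infinite path without repetitions. -/
structure IsLine (T : SimpleGraph V) (m : ℤ → V) : Prop where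
  injective : Function.Injective m
  adj : ∀ t, T.Adj (m t) (m (t + 1))

theorem IsLine.reverse {m : ℤ → V} (hm : T.IsLine m) : T.IsLine fun t => m (-t) where
  injective s t h := neg_injective (hm.injective h)
  adj t := by
    have := hm.adj (-(t + 1))
    rw [show -(t + 1) + 1 = -t by ring] at this
    exact this.symm

/-- Once the distance from `w` grows along the line it cannot drop again: at the turning point both
neighbours on the line would be closer to `w`, hence equal, against injectivity. The induction
carries two consecutive values because this argument compares both neighbours. -/
theorem IsLine.dist_add_nat {m : ℤ → V} (hm : T.IsLine m) (hT : T.IsTree) {w : V} {s : ℤ}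
    (hs : ∀ t, T.dist w (m s) ≤ T.dist w (m t)) (j : ℕ) :
    T.dist w (m (s + j)) = T.dist w (m s) + j ∧
      T.dist w (m (s + j + 1)) = T.dist w (m s) + j + 1 := by
  induction j with
  | zero =>
    simp only [Nat.cast_zero, add_zero, true_and]
    have := hT.dist_eq_dist_add_one_of_adj w (hm.adj s)
    have := hs (s + 1)
    omega
  | succ j ih =>
    push_cast
    refine ⟨by rw [← add_assoc, ih.2, add_assoc], ?_⟩
    have h1 := hm.adj (s + j)
    have h2 := hm.adj (s + j + 1)
    rw [← add_assoc]
    rcases hT.dist_eq_dist_add_one_of_adj w h2 with h | h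
    · have h3 := hT.eq_of_dist_lt w h1.symm h2 (by omega) (by omega)
      have := hm.injective h3
      omega
    · omega

/-- If `m s` is a point of the line `m` closest to `w`, then distances from `w` to the line are
realized by paths through `m s`. -/
theorem IsLine.dist_eq_of_closest {m : ℤ → V} (hm : T.IsLine m) (hT : T.IsTree) {w : V} {s : ℤ}
    (hs : ∀ t, T.dist w (m s) ≤ T.dist w (m t)) (t : ℤ) :
    T.dist w (m t) = T.dist w (m s) + (t - s).natAbs := by
  rcases le_total s t with h | h
  · have := (hm.dist_add_nat hT hs (t - s).natAbs).1
    rwa [show s + ((t - s).natAbs : ℤ) = t by omega] at this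
  · have := (hm.reverse.dist_add_nat hT (w := w) (s := -s) (fun t => by
      rw [neg_neg]
      exact hs _) (t - s).natAbs).1
    rwa [neg_neg, show -(-s + ((t - s).natAbs : ℤ)) = t by omega] at this

theorem IsLine.dist_eq {m : ℤ → V} (hm : T.IsLine m) (hT : T.IsTree) (s t : ℤ) :
    T.dist (m s) (m t) = (t - s).natAbs := by
  have := hm.dist_eq_of_closest hT (w := m s) (s := s) (fun t => by simp) t
  simpa using this

theorem IsLine.exists_closest {m : ℤ → V} (w : V) :
    ∃ s, ∀ t, T.dist w (m s) ≤ T.dist w (m t) := by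
  exact ⟨Function.argmin fun t => T.dist w (m t),
    fun t => Function.argmin_le (fun t => T.dist w (m t)) t⟩

/-- Lines in trees are convex. -/
theorem IsLine.mem_range_of_dist_add {m : ℤ → V} (hm : T.IsLine m) (hT : T.IsTree) {s t : ℤ}
    {z : V} (h : T.dist (m s) z + T.dist z (m t) ≤ T.dist (m s) (m t)) : z ∈ Set.range m := by
  obtain ⟨r, hr⟩ := IsLine.exists_closest (T := T) (m := m) z
  have h1 := hm.dist_eq_of_closest hT hr s
  have h2 := hm.dist_eq_of_closest hT hr t
  rw [dist_comm, h1, h2, hm.dist_eq hT] at h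
  exact ⟨r, ((hT.connected.dist_eq_zero_iff).1 (by omega)).symm⟩

end Tree

section BoxProd

variable {V₁ : Type u} {V₂ : Type v} {T₁ : SimpleGraph V₁} {T₂ : SimpleGraph V₂}

/-- Two edges at `u` in the same factor would close up to a 4-cycle in one tree or to a degenerate
square. So they lie in different factors, and this determines the fourth corner. -/
theorem IsTree.boxProd_square (hT₁ : T₁.IsTree) (hT₂ : T₂.IsTree) {u a b w : V₁ × V₂}
    (hab : a ≠ b) (huw : u ≠ w) (h1 : (T₁.boxProd T₂).Adj u a) (h2 : (T₁.boxProd T₂).Adj u b)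
    (h3 : (T₁.boxProd T₂).Adj w a) (h4 : (T₁.boxProd T₂).Adj w b) :
    (a.2 = u.2 ∧ b.1 = u.1 ∧ w = (a.1, b.2)) ∨ (a.1 = u.1 ∧ b.2 = u.2 ∧ w = (b.1, a.2)) := by
  obtain ⟨u1, u2⟩ := u
  obtain ⟨a1, a2⟩ := a
  obtain ⟨b1, b2⟩ := b
  obtain ⟨w1, w2⟩ := w
  have c1 : ∀ {u w a b}, u ≠ w → T₁.Adj u a → T₁.Adj u b → T₁.Adj w a → T₁.Adj w b → a = b :=
    fun h => hT₁.eq_of_common_adj h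
  have c2 : ∀ {u w a b}, u ≠ w → T₂.Adj u a → T₂.Adj u b → T₂.Adj w a → T₂.Adj w b → a = b :=
    fun h => hT₂.eq_of_common_adj h
  simp only [boxProd_adj, ne_eq, Prod.mk.injEq] at *
  have i1 := T₁.loopless
  have i2 := T₂.loopless
  rcases h1 with ⟨h1, e1⟩ | ⟨h1, e1⟩ <;> rcases h2 with ⟨h2, e2⟩ | ⟨h2, e2⟩ <;>
    rcases h3 with ⟨h3, e3⟩ | ⟨h3, e3⟩ <;> rcases h4 with ⟨h4, e4⟩ | ⟨h4, e4⟩ <;> subst_vars <;>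
    grind [SimpleGraph.irrefl]

theorem IsTree.boxProd_spanSquare (hT₁ : T₁.IsTree) (hT₂ : T₂.IsTree) {u a b : V₁ × V₂}
    (h : (T₁.boxProd T₂).SpanSquare u a b) :
    (a.2 = u.2 ∧ a.1 ≠ u.1 ∧ b.1 = u.1 ∧ b.2 ≠ u.2) ∨
      (a.1 = u.1 ∧ a.2 ≠ u.2 ∧ b.2 = u.2 ∧ b.1 ≠ u.1) := by
  obtain ⟨h1, h2, h3, w, h4, h5, h6⟩ := h
  have n1 := h2.ne
  have n2 := h3.ne
  rcases hT₁.boxProd_square hT₂ h1 h4.symm h2 h3 h5 h6 with ⟨e1, e2, -⟩ | ⟨e1, e2, -⟩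
  · exact Or.inl ⟨e1, fun h => n1 (Prod.ext h.symm e1.symm), e2,
      fun h => n2 (Prod.ext e2.symm h.symm)⟩
  · exact Or.inr ⟨e1, fun h => n1 (Prod.ext e1.symm h.symm), e2,
      fun h => n2 (Prod.ext h.symm e2.symm)⟩

/-- Edges spanning a square lie in different factors, and there are only two factors for three
edges. -/
theorem IsTree.boxProd_twoDimensional (hT₁ : T₁.IsTree) (hT₂ : T₂.IsTree) :
    (T₁.boxProd T₂).TwoDimensional := by
  intro u a b c h1 h2 h3
  have e1 := hT₁.boxProd_spanSquare hT₂ h1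
  have e2 := hT₁.boxProd_spanSquare hT₂ h2
  have e3 := hT₁.boxProd_spanSquare hT₂ h3
  grind

/-- The rank function on a product of trees. -/
theorem IsTree.boxProd_rank_ne (hT₁ : T₁.IsTree) (hT₂ : T₂.IsTree) (r : V₁ × V₂)
    {v w : V₁ × V₂} (h : (T₁.boxProd T₂).Adj v w) :
    T₁.dist r.1 v.1 + T₂.dist r.2 v.2 ≠ T₁.dist r.1 w.1 + T₂.dist r.2 w.2 := by
  rcases boxProd_adj.1 h with ⟨h, e⟩ | ⟨h, e⟩
  · have := hT₁.dist_ne_of_adj r.1 h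
    rw [e]
    omega
  · have := hT₂.dist_ne_of_adj r.2 h
    rw [e]
    omega

/-- A move that lowers the rank lowers the distance in its own factor. In one tree there is only one
such move; moves in different trees commute, and performing both gives `w`. -/
theorem IsTree.boxProd_quadrangle (hT₁ : T₁.IsTree) (hT₂ : T₂.IsTree) (r v a b : V₁ × V₂)
    (h1 : (T₁.boxProd T₂).Adj v a) (h2 : (T₁.boxProd T₂).Adj v b)
    (ha : T₁.dist r.1 a.1 + T₂.dist r.2 a.2 < T₁.dist r.1 v.1 + T₂.dist r.2 v.2)
    (hb : T₁.dist r.1 b.1 + T₂.dist r.2 b.2 < T₁.dist r.1 v.1 + T₂.dist r.2 v.2) (hab : a ≠ b) :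
    ∃ w, w ≠ v ∧ (T₁.boxProd T₂).Adj w a ∧ (T₁.boxProd T₂).Adj w b ∧
      T₁.dist r.1 w.1 + T₂.dist r.2 w.2 < T₁.dist r.1 v.1 + T₂.dist r.2 v.2 := by
  obtain ⟨v1, v2⟩ := v
  obtain ⟨a1, a2⟩ := a
  obtain ⟨b1, b2⟩ := b
  rcases boxProd_adj.1 h1 with ⟨k1, e1⟩ | ⟨k1, e1⟩ <;>
    rcases boxProd_adj.1 h2 with ⟨k2, e2⟩ | ⟨k2, e2⟩ <;> dsimp only at k1 k2 e1 e2 ha hb <;> subst e1 <;> subst e2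
  · have : a1 = b1 := hT₁.eq_of_dist_lt r.1 k1 k2 (by omega) (by omega)
    exact (hab (by rw [this])).elim
  · refine ⟨(a1, b2), fun h => k1.ne (congrArg Prod.fst h).symm, boxProd_adj.2 (Or.inr ⟨k2.symm, rfl⟩),
      boxProd_adj.2 (Or.inl ⟨k1.symm, rfl⟩), ?_⟩
    dsimp only
    omega
  · refine ⟨(b1, a2), fun h => k2.ne (congrArg Prod.fst h).symm, boxProd_adj.2 (Or.inl ⟨k2.symm, rfl⟩),
      boxProd_adj.2 (Or.inr ⟨k1.symm, rfl⟩), ?_⟩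
    dsimp only
    omega
  · have : a2 = b2 := hT₂.eq_of_dist_lt r.2 k1 k2 (by omega) (by omega)
    exact (hab (by rw [this])).elim

theorem dist_boxProd (h₁ : T₁.Connected) (h₂ : T₂.Connected) (x y : V₁ × V₂) :
    (T₁.boxProd T₂).dist x y = T₁.dist x.1 y.1 + T₂.dist x.2 y.2 := by
  have h := edist_boxProd (G := T₁) (H := T₂) x y
  rw [← (h₁ x.1 y.1).coe_dist_eq_edist, ← (h₂ x.2 y.2).coe_dist_eq_edist,
    ← ((h₁.boxProd h₂) x y).coe_dist_eq_edist] at h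
  exact_mod_cast h

end BoxProd

section Ball

variable {V : Type u} {G : SimpleGraph V}

/-- Balls of locally finite graphs are finite. -/
theorem finite_ball (hconn : G.Connected) (hfin : ∀ v, (G.neighborSet v).Finite) (v : V) (r : ℕ) :
    {w | G.dist v w ≤ r}.Finite := by
  induction r with
  | zero =>
    refine (Set.finite_singleton v).subset fun w hw => ?_
    exact ((hconn.dist_eq_zero_iff).1 (Nat.le_zero.1 hw)).symm
  | succ r ih =>
    refine (ih.union (ih.biUnion fun w _ => hfin w)).subset fun w hw => ?_
    by_cases h : G.dist v w ≤ r
    · exact Or.inl h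
    · right
      have hw : G.dist v w ≤ r + 1 := hw
      obtain ⟨p, hp⟩ := hconn.exists_walk_length_eq_dist w v
      rw [dist_comm] at hw h
      cases p with
      | nil => simp at h
      | @cons _ x _ hx q =>
        rw [Walk.length_cons] at hp
        refine Set.mem_biUnion (x := x) ?_ hx.symm
        have := dist_le q
        change G.dist v x ≤ r
        rw [dist_comm]
        omega

theorem finite_neighborSet_boxProd {V₁ : Type u} {V₂ : Type v} {T₁ : SimpleGraph V₁}
    {T₂ : SimpleGraph V₂} (h₁ : ∀ v, (T₁.neighborSet v).Finite)
    (h₂ : ∀ v, (T₂.neighborSet v).Finite) (v : V₁ × V₂) :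
    ((T₁.boxProd T₂).neighborSet v).Finite := by
  rw [neighborSet_boxProd]
  exact ((h₁ _).prod (Set.finite_singleton _)).union ((Set.finite_singleton _).prod (h₂ _))

end Ball

end SimpleGraph

/-! ### Graphs with fins -/

namespace SimpleGraph

variable {V Q : Type u}

/-- Vertices of the graph obtained from a graph on `V` by attaching to each subset `L s` a fin,
that is, a copy `L s × {s}` of `L s`. -/
abbrev FinVertex (L : Q → Set V) : Type u :=
  {p : V × Option Q // ∀ s, p.2 = some s → p.1 ∈ L s}

/-- The graph obtained from `G` by attaching along each subset `L s` a fin `L s × [0,1]`. -/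
def finned (G : SimpleGraph V) (L : Q → Set V) : SimpleGraph (FinVertex L) where
  Adj p q := (p.1.2 = q.1.2 ∧ G.Adj p.1.1 q.1.1) ∨
    (p.1.1 = q.1.1 ∧ ((p.1.2 = none ∧ q.1.2 ≠ none) ∨ (p.1.2 ≠ none ∧ q.1.2 = none)))
  symm := ⟨fun p q h => by
    rcases h with ⟨h1, h2⟩ | ⟨h1, ⟨h2, h3⟩ | ⟨h2, h3⟩⟩
    · exact Or.inl ⟨h1.symm, h2.symm⟩
    · exact Or.inr ⟨h1.symm, Or.inr ⟨h3, h2⟩⟩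
    · exact Or.inr ⟨h1.symm, Or.inl ⟨h3, h2⟩⟩⟩
  loopless := ⟨fun p h => by
    rcases h with ⟨-, h⟩ | ⟨-, ⟨h2, h3⟩ | ⟨h2, h3⟩⟩
    · exact h.ne rfl
    · exact h3 h2
    · exact h2 h3⟩

section Finned

variable {G : SimpleGraph V} {L : Q → Set V}

theorem finned_adj {p q : FinVertex L} : (finned G L).Adj p q ↔
    (p.1.2 = q.1.2 ∧ G.Adj p.1.1 q.1.1) ∨
    (p.1.1 = q.1.1 ∧ ((p.1.2 = none ∧ q.1.2 ≠ none) ∨ (p.1.2 ≠ none ∧ q.1.2 = none))) := Iff.rfl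

/-- A vertex of the original graph. -/
def finBase (L : Q → Set V) (v : V) : FinVertex L := ⟨(v, none), fun _ h => nomatch h⟩

/-- A vertex at the free side of a fin. -/
def finTip {s : Q} {v : V} (h : v ∈ L s) : FinVertex L :=
  ⟨(v, some s), fun _ h' => Option.some.inj h' ▸ h⟩

@[simp] theorem finBase_fst (v : V) : (finBase L v).1.1 = v := rfl
@[simp] theorem finBase_snd (v : V) : (finBase L v).1.2 = none := rfl
@[simp] theorem finTip_fst {s : Q} {v : V} (h : v ∈ L s) : (finTip h).1.1 = v := rfl
@[simp] theorem finTip_snd {s : Q} {v : V} (h : v ∈ L s) : (finTip h).1.2 = some s := rfl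

theorem finBase_injective : Function.Injective (finBase L) := fun _ _ h =>
  congrArg (fun p : FinVertex L => p.1.1) h

theorem finVertex_cases (p : FinVertex L) :
    (∃ v, p = finBase L v) ∨ ∃ s v, ∃ h : v ∈ L s, p = finTip h := by
  obtain ⟨⟨v, _ | s⟩, h⟩ := p
  · exact Or.inl ⟨v, rfl⟩
  · exact Or.inr ⟨s, v, h s rfl, rfl⟩

theorem eq_finBase_iff {p : FinVertex L} {v : V} :
    p = finBase L v ↔ p.1.1 = v ∧ p.1.2 = none :=
  ⟨fun h => h ▸ ⟨rfl, rfl⟩, fun h => Subtype.ext (Prod.ext h.1 h.2)⟩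

theorem eq_finTip_iff {p : FinVertex L} {s : Q} {v : V} (h : v ∈ L s) :
    p = finTip h ↔ p.1.1 = v ∧ p.1.2 = some s :=
  ⟨fun h => h ▸ ⟨rfl, rfl⟩, fun h => Subtype.ext (Prod.ext h.1 h.2)⟩

@[simp] theorem finned_adj_base {v w : V} :
    (finned G L).Adj (finBase L v) (finBase L w) ↔ G.Adj v w := by simp [finned_adj]

theorem finned_adj_rung {s : Q} {v : V} (h : v ∈ L s) :
    (finned G L).Adj (finBase L v) (finTip h) := by simp [finned_adj]

theorem finned_adj_tip {s : Q} {v w : V} (hv : v ∈ L s) (hw : w ∈ L s) (h : G.Adj v w) :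
    (finned G L).Adj (finTip hv) (finTip hw) := by simp [finned_adj, h]

/-- A square either stays on one level, and then projects to a square of `G`, or it crosses a single
fin `s`; in the latter case exactly one of the two edges at `p` is a rung and the corners project
into `L s`. -/
theorem finned_spanSquare {p a b : FinVertex L} (h : (finned G L).SpanSquare p a b) :
    (a.1.2 = p.1.2 ∧ b.1.2 = p.1.2 ∧ G.SpanSquare p.1.1 a.1.1 b.1.1) ∨
    (∃ s, p.1.1 ∈ L s ∧ a.1.1 ∈ L s ∧ b.1.1 ∈ L s ∧
      ((b.1.2 = p.1.2 ∧ ((p.1.2 = none ∧ a.1.2 = some s) ∨ (p.1.2 = some s ∧ a.1.2 = none))) ∨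
      (a.1.2 = p.1.2 ∧ ((p.1.2 = none ∧ b.1.2 = some s) ∨ (p.1.2 = some s ∧ b.1.2 = none))))) := by
  obtain ⟨h1, h2, h3, w, h4, h5, h6⟩ := h
  obtain ⟨⟨p1, p2⟩, hp⟩ := p
  obtain ⟨⟨a1, a2⟩, ha⟩ := a
  obtain ⟨⟨b1, b2⟩, hb⟩ := b
  obtain ⟨⟨w1, w2⟩, hw⟩ := w
  have i := G.loopless
  simp only [finned_adj, ne_eq, Subtype.mk.injEq, Prod.mk.injEq, SpanSquare] at *
  rcases h2 with ⟨h2, e2⟩ | ⟨h2, e2⟩ <;> rcases h3 with ⟨h3, e3⟩ | ⟨h3, e3⟩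
  · rcases h5 with ⟨h5, e5⟩ | ⟨h5, e5⟩ <;> rcases h6 with ⟨h6, e6⟩ | ⟨h6, e6⟩
    · refine Or.inl ⟨h2.symm, h3.symm, fun h => h1 ⟨h, h2.symm.trans h3⟩, e2, e3, w1, ?_, e5, e6⟩
      exact fun h => h4 ⟨h, by rw [h5, h2]⟩
    all_goals exfalso; grind [SimpleGraph.irrefl]
  · right
    rcases hs : b2 with _ | s
    · rcases hs' : p2 with _ | s'
      · simp_all
      · exact ⟨s', by grind⟩
    · have hbs := hb s hs
      refine ⟨s, by rwa [h3], ?_, hbs, ?_⟩ <;> grind [SimpleGraph.irrefl]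
  · right
    rcases hs : a2 with _ | s
    · rcases hs' : p2 with _ | s'
      · simp_all
      · exact ⟨s', by grind⟩
    · have has := ha s hs
      refine ⟨s, by rwa [h2], has, ?_, ?_⟩ <;> grind [SimpleGraph.irrefl]
  · exfalso
    have : p2 = none := by
      by_contra hne
      rcases e2 with e2 | e2 <;> rcases e3 with e3 | e3 <;> simp_all
    subst this
    grind [SimpleGraph.irrefl]

/-- Two rungs never span a square, so among three pairwise spanning edges at most one is a rung.
With no rung they project to such a triple in `G`; with one rung, the other two lie along its fin
and project to a square with three corners in `L s`, which `hL` forbids. -/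
theorem finned_twoDimensional (hG : G.TwoDimensional)
    (hL : ∀ s u a b, u ∈ L s → a ∈ L s → b ∈ L s → ¬ G.SpanSquare u a b) :
    (finned G L).TwoDimensional := by
  intro p a b c h1 h2 h3
  have e1 := finned_spanSquare h1
  have e2 := finned_spanSquare h2
  have e3 := finned_spanSquare h3
  have e4 := hG p.1.1 a.1.1 b.1.1 c.1.1
  clear h1 h2 h3 hG
  rcases e1 with ⟨a1, a2, a3⟩ | ⟨s, a1, a2, a3, a4⟩ <;>
    rcases e2 with ⟨b1, b2, b3⟩ | ⟨t, b1, b2, b3, b4⟩ <;>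
    rcases e3 with ⟨c1, c2, c3⟩ | ⟨r, c1, c2, c3, c4⟩
  · exact e4 a3 b3 c3
  all_goals grind

theorem finned_connected (hG : G.Connected) : (finned G L).Connected := by
  have h1 : ∀ v w, (finned G L).Reachable (finBase L v) (finBase L w) := fun v w =>
    (hG v w).map ⟨finBase L, fun h => finned_adj_base.2 h⟩
  have h2 : ∀ p : FinVertex L, (finned G L).Reachable p (finBase L p.1.1) := by
    intro p
    rcases finVertex_cases p with ⟨v, rfl⟩ | ⟨s, v, h, rfl⟩
    · exact .refl _
    · exact (finned_adj_rung h).symm.reachable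
  obtain ⟨v⟩ := hG.nonempty
  have : Nonempty (FinVertex L) := ⟨finBase L v⟩
  exact ⟨fun p q => (h2 p).trans ((h1 _ _).trans (h2 q).symm)⟩

/-- The rank is raised by one on the free sides of the fins. At a base vertex rungs lead upwards, so
`hquad` for `G` applies. At a free vertex, going down the rung commutes with going down along the
fin, while two different descents within the fin would produce a square excluded by `hL`. -/
theorem finned_simplyConnected (hconn : G.Connected) (f : V → ℕ) (b : V) (hb : f b = 0)
    (hne : ∀ v w, G.Adj v w → f v ≠ f w)
    (hquad : ∀ v u u', G.Adj v u → G.Adj v u' → f u < f v → f u' < f v → u ≠ u' →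
      ∃ w, w ≠ v ∧ G.Adj w u ∧ G.Adj w u' ∧ f w < f v)
    (hL : ∀ s u a b, u ∈ L s → a ∈ L s → b ∈ L s → ¬ G.SpanSquare u a b) :
    (CubeComplex.ofGraph (finned G L)).IsSimplyConnected := by
  classical
  refine CubeComplex.ofGraph_isSimplyConnected (finned_connected hconn)
    (fun p => f p.1.1 + if p.1.2 = none then 0 else 1) (finBase L b) (by simp [hb]) ?_ ?_
  · rintro p q (⟨h1, h2⟩ | ⟨h1, h2⟩)
    · have := hne _ _ h2
      rw [h1]
      omega
    · rcases h2 with ⟨h2, h3⟩ | ⟨h2, h3⟩ <;> simp [h1, h2, h3]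
  · rintro p a b h1 h2 h3 h4 h5
    rcases h1 with ⟨h1, k1⟩ | ⟨h1, k1⟩ <;> rcases h2 with ⟨h2, k2⟩ | ⟨h2, k2⟩
    · rw [← h1] at h3
      rw [← h2] at h4
      obtain ⟨w, w1, w2, w3, w4⟩ := hquad _ _ _ k1 k2 (by omega) (by omega)
        (fun h => h5 (Subtype.ext (Prod.ext h (h1.symm.trans h2))))
      rcases finVertex_cases p with ⟨v, rfl⟩ | ⟨s, v, h, rfl⟩
      · refine ⟨finBase L w, fun h => w1 (finBase_injective h), Or.inl ⟨h1, w2⟩,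
          Or.inl ⟨h2, w3⟩, by simpa using w4⟩
      · exact absurd ⟨fun h => h5 (Subtype.ext (Prod.ext h (h1.symm.trans h2))), k1, k2, w, w1,
          w2, w3⟩ (hL s _ _ _ h (a.2 s h1.symm) (b.2 s h2.symm))
    · have hb : b.1.2 = none := by
        rcases k2 with k2 | k2
        · simp [h2, k2] at h4
        · exact k2.2
      have hp : p.1.2 ≠ none := fun h => by simp [h2, hb, h] at h4
      refine ⟨finBase L a.1.1, fun h => hp (h ▸ rfl), Or.inr ⟨rfl, Or.inl ⟨rfl, h1 ▸ hp⟩⟩,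
        Or.inl ⟨hb.symm, ?_⟩, ?_⟩
      · rw [finBase_fst, ← h2]
        exact k1.symm
      · rw [← h1] at h3
        simp only [finBase_fst, finBase_snd, if_true, hp, if_false] at h3 ⊢
        omega
    · have ha : a.1.2 = none := by
        rcases k1 with k1 | k1
        · simp [h1, k1] at h3
        · exact k1.2
      have hp : p.1.2 ≠ none := fun h => by simp [h1, ha, h] at h3
      refine ⟨finBase L b.1.1, fun h => hp (h ▸ rfl), Or.inl ⟨ha.symm, ?_⟩,
        Or.inr ⟨rfl, Or.inl ⟨rfl, h2 ▸ hp⟩⟩, ?_⟩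
      · rw [finBase_fst, ← h1]
        exact k2.symm
      · rw [← h2] at h4
        simp only [finBase_fst, finBase_snd, if_true, hp, if_false] at h4 ⊢
        omega
    · exfalso
      have ha : a.1.2 = none := by
        rcases k1 with k1 | k1
        · simp [h1, k1] at h3
        · exact k1.2
      have hb : b.1.2 = none := by
        rcases k2 with k2 | k2
        · simp [h2, k2] at h4
        · exact k2.2
      exact h5 (Subtype.ext (Prod.ext (h1.symm.trans h2) (ha.trans hb.symm)))

open Classical in
/-- The projection of a finned graph to the original graph and the position relative to the fins
are compatible with distances. -/
theorem le_dist_finned (hconn : G.Connected) (p q : FinVertex L) :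
    G.dist p.1.1 q.1.1 + (if p.1.2 = q.1.2 then 0 else 1) ≤ (finned G L).dist p q := by
  have key : ∀ {p q : FinVertex L} (w : (finned G L).Walk p q),
      G.dist p.1.1 q.1.1 + (if p.1.2 = q.1.2 then 0 else 1) ≤ w.length := by
    intro p q w
    induction w with
    | nil => simp
    | @cons a b c h w ih =>
      rw [Walk.length_cons]
      rcases h with ⟨h1, h2⟩ | ⟨h1, h2⟩
      · have := hconn.dist_triangle (u := a.1.1) (v := b.1.1) (w := c.1.1)
        rw [dist_eq_one_iff_adj.2 h2] at this
        rw [h1]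
        omega
      · rw [h1]
        split_ifs at ih ⊢ <;> omega
  obtain ⟨w, hw⟩ := (finned_connected (L := L) hconn).exists_walk_length_eq_dist p q
  rw [← hw]
  exact key w

theorem dist_finned_le (hconn : G.Connected) (v w : V) :
    (finned G L).dist (finBase L v) (finBase L w) ≤ G.dist v w :=
  dist_map_le ⟨finBase L, fun h => finned_adj_base.2 h⟩ (hconn v w)

theorem dist_finBase (hconn : G.Connected) (v w : V) :
    (finned G L).dist (finBase L v) (finBase L w) = G.dist v w := by
  refine le_antisymm (dist_finned_le hconn v w) ?_
  have := le_dist_finned (L := L) hconn (finBase L v) (finBase L w)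
  simpa using this

/-- A group action that permutes the fins. -/
def finnedHom {Γ : Type u} [Group Γ] [MulAction Γ Q] (ρ : Γ →* (G ≃g G))
    (hL : ∀ (g : Γ) s v, v ∈ L s → ρ g v ∈ L (g • s)) : Γ →* (finned G L ≃g finned G L) :=
  let φ : Γ → FinVertex L → FinVertex L := fun g p =>
    ⟨(ρ g p.1.1, p.1.2.map (g • ·)), by
      intro s hs
      obtain ⟨t, ht, rfl⟩ := Option.map_eq_some_iff.1 hs
      exact hL g t _ (p.2 t ht)⟩
  have hφ : ∀ g h p, φ g (φ h p) = φ (g * h) p := fun g h p => by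
    apply Subtype.ext
    refine Prod.ext ?_ ?_
    · simp [φ]
    · simp [φ, mul_smul, Function.comp_def]
  have hone : ∀ p, φ 1 p = p := fun p => by
    apply Subtype.ext
    refine Prod.ext ?_ ?_
    · simp [φ]
    · simp [φ]
  { toFun := fun g =>
      { toFun := φ g
        invFun := φ g⁻¹
        left_inv := fun p => by rw [hφ, inv_mul_cancel, hone]
        right_inv := fun p => by rw [hφ, mul_inv_cancel, hone]
        map_rel_iff' := by
          intro p q
          have hinj : Function.Injective (Option.map (g • · : Q → Q)) :=
            Option.map_injective (MulAction.injective g)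
          change _ ∨ _ ↔ _ ∨ _
          refine or_congr (and_congr hinj.eq_iff (ρ g).map_rel_iff) (and_congr ?_ ?_)
          · exact (ρ g).injective.eq_iff
          · simp [φ] }
    map_one' := by
      ext p : 1
      exact hone p
    map_mul' := fun g h => by
      ext p : 1
      exact (hφ g h p).symm }

end Finned

end SimpleGraph

/-! ### The universal cover of a product quotient with an annulus attached -/

namespace CubeComplex

theorem corner_cases {n : ℕ} (hn : n ≤ 2) (x y : Corner n) :
    y = x ∨ (∃ i, y = flipAt x i) ∨ ∃ i j, i ≠ j ∧ y = flipAt (flipAt x i) j := by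
  interval_cases n
  · exact Or.inl (Subsingleton.elim _ _)
  · revert x y
    decide
  · revert x y
    decide

/-- A cube is determined by its corners and has dimension at most 2, so only finitely many cubes
have all corners in `B`. -/
theorem graphAction_isCocompact {V : Type u} {G : SimpleGraph V} {Γ : Type v} [Group Γ]
    (ρ : Γ →* (G ≃g G)) (hG : G.TwoDimensional) {B : Set V} (hB : B.Finite)
    (h : ∀ {n : ℕ} (c : (ofGraph G).cube n), ∃ g : Γ, ∀ x, ρ g (c.1 x) ∈ B) :
    (graphAction ρ).IsCocompact := by
  refine ⟨⋃ n ∈ Set.Iic 2, Sigma.mk n '' {c : (ofGraph G).cube n | ∀ x, c.1 x ∈ B},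
    (Set.finite_Iic 2).biUnion fun n _ => Set.Finite.image _ ?_, fun {n} c => ?_⟩
  · refine Set.Finite.of_finite_image (f := Subtype.val) ?_ Subtype.val_injective.injOn
    refine (Set.Finite.pi' fun _ : Corner n => hB).subset ?_
    rintro _ ⟨c, hc, rfl⟩
    exact hc
  · obtain ⟨g, hg⟩ := h c
    refine ⟨g, Set.mem_biUnion (cube_dim_le hG c) ?_⟩
    refine ⟨((graphAction ρ).act g).toFun c, ?_, rfl⟩
    exact hg

end CubeComplex

namespace AntiTorus

open CubeComplex SimpleGraph

variable {V₁ V₂ Γ : Type u} [Group Γ] {T₁ : SimpleGraph V₁} {T₂ : SimpleGraph V₂}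
  {ρ : Γ →* (T₁.boxProd T₂ ≃g T₁.boxProd T₂)} {g₁ g₂ : Γ} (h : AntiTorus ρ g₁ g₂)

theorem isLine₁ : T₁.IsLine h.ℓ₁ := ⟨h.ℓ₁_injective, h.ℓ₁_adj⟩

theorem isLine₂ : T₂.IsLine h.ℓ₂ := ⟨h.ℓ₂_injective, h.ℓ₂_adj⟩

/-- The translate of the axis `ℓ₁ × {p₂}` by a coset of the cyclic group generated by `g₁`. -/
def axisLine (s : Γ ⧸ Subgroup.zpowers g₁) : Set (V₁ × V₂) :=
  {v | ∃ γ : Γ, (γ : Γ ⧸ Subgroup.zpowers g₁) = s ∧ ∃ t, v = ρ γ (h.ℓ₁ t, h.ℓ₂ 0)}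

theorem exists_zpow_of_mk_eq {γ γ' : Γ} (hγ : (γ : Γ ⧸ Subgroup.zpowers g₁) = γ') :
    ∃ k : ℤ, γ' = γ * g₁ ^ k := by
  obtain ⟨k, hk⟩ := Subgroup.mem_zpowers_iff.1 (QuotientGroup.eq.1 hγ)
  exact ⟨k, by rw [hk, mul_inv_cancel_left]⟩

theorem mk_mul_zpow (γ : Γ) (k : ℤ) :
    ((γ * g₁ ^ k : Γ) : Γ ⧸ Subgroup.zpowers g₁) = γ :=
  (QuotientGroup.eq.2 (by
    rw [inv_mul_cancel_left]
    exact Subgroup.mem_zpowers_iff.2 ⟨k, rfl⟩)).symm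

/-- Another representative of the coset differs by a power of `g₁`, which only slides the axis along
itself. -/
theorem mem_axisLine {γ : Γ} {v : V₁ × V₂} :
    v ∈ h.axisLine (γ : Γ ⧸ Subgroup.zpowers g₁) ↔ ∃ t, v = ρ γ (h.ℓ₁ t, h.ℓ₂ 0) := by
  refine ⟨?_, fun ht => ⟨γ, rfl, ht⟩⟩
  rintro ⟨γ', hγ, t, rfl⟩
  obtain ⟨k, rfl⟩ := exists_zpow_of_mk_eq hγ.symm
  exact ⟨t + k * h.τ₁, by rw [map_mul, RelIso.mul_apply, h.axis_zpow]⟩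

theorem axisLine_smul (g : Γ) (s : Γ ⧸ Subgroup.zpowers g₁) (v : V₁ × V₂)
    (hv : v ∈ h.axisLine s) : ρ g v ∈ h.axisLine (g • s) := by
  obtain ⟨γ, rfl, t, rfl⟩ := hv
  exact ⟨g * γ, rfl, t, by rw [map_mul, RelIso.mul_apply]⟩

/-- After applying `(ρ γ).symm`, all three vertices have second coordinate p₂, but a square has an
edge in the second factor. -/
theorem not_spanSquare_axisLine (hT₁ : T₁.IsTree) (hT₂ : T₂.IsTree)
    (s : Γ ⧸ Subgroup.zpowers g₁) (u a b : V₁ × V₂) (hu : u ∈ h.axisLine s)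
    (ha : a ∈ h.axisLine s) (hb : b ∈ h.axisLine s) : ¬ (T₁.boxProd T₂).SpanSquare u a b := by
  obtain ⟨γ, rfl⟩ := QuotientGroup.mk_surjective s
  obtain ⟨t, rfl⟩ := h.mem_axisLine.1 hu
  obtain ⟨t', rfl⟩ := h.mem_axisLine.1 ha
  obtain ⟨t'', rfl⟩ := h.mem_axisLine.1 hb
  intro hs
  have := hs.map (ρ γ).symm
  simp only [RelIso.symm_apply_apply] at this
  have := hT₁.boxProd_spanSquare hT₂ this
  simp at this

/-- The 1-skeleton of the universal cover: the product of trees with a strip attached along each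
translate of the axis. -/
abbrev modelGraph : SimpleGraph (FinVertex h.axisLine) := finned (T₁.boxProd T₂) h.axisLine

/-- The action on the 1-skeleton of the universal cover. -/
def modelHom : Γ →* (h.modelGraph ≃g h.modelGraph) := finnedHom ρ h.axisLine_smul

theorem modelHom_snd (g : Γ) (p : FinVertex h.axisLine) :
    (h.modelHom g p).1.2 = p.1.2.map (g • ·) := rfl

theorem modelGraph_twoDimensional (hT₁ : T₁.IsTree) (hT₂ : T₂.IsTree) :
    h.modelGraph.TwoDimensional :=
  finned_twoDimensional (hT₁.boxProd_twoDimensional hT₂) (h.not_spanSquare_axisLine hT₁ hT₂)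

theorem model_isCAT0 (hT₁ : T₁.IsTree) (hT₂ : T₂.IsTree) : (ofGraph h.modelGraph).IsCAT0 where
  simplyConnected := finned_simplyConnected (hT₁.connected.boxProd hT₂.connected)
    (fun v => T₁.dist (h.ℓ₁ 0) v.1 + T₂.dist (h.ℓ₂ 0) v.2) (h.ℓ₁ 0, h.ℓ₂ 0) (by simp)
    (fun _ _ hvw => hT₁.boxProd_rank_ne hT₂ (h.ℓ₁ 0, h.ℓ₂ 0) hvw)
    (fun v a b => hT₁.boxProd_quadrangle hT₂ (h.ℓ₁ 0, h.ℓ₂ 0) v a b)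
    (h.not_spanSquare_axisLine hT₁ hT₂)
  nonpositivelyCurved := ofGraph_isNonpositivelyCurved (h.modelGraph_twoDimensional hT₁ hT₂)

/-! #### The strips -/

/-- The strip attached to the axis `ℓ₁ × {p₂}`. -/
def stripPoint (x : ℤ × Bool) : FinVertex h.axisLine :=
  ⟨((h.ℓ₁ x.1, h.ℓ₂ 0), if x.2 then some ((1 : Γ) : Γ ⧸ Subgroup.zpowers g₁) else none), by
    intro s hs
    split_ifs at hs
    obtain rfl := Option.some.inj hs
    exact h.mem_axisLine.2 ⟨x.1, by simp⟩⟩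

theorem stripPoint_fst (x : ℤ × Bool) : (h.stripPoint x).1.1 = (h.ℓ₁ x.1, h.ℓ₂ 0) := rfl

theorem stripPoint_snd (x : ℤ × Bool) : (h.stripPoint x).1.2 =
    if x.2 then some ((1 : Γ) : Γ ⧸ Subgroup.zpowers g₁) else none := rfl

theorem stripPoint_injective : Function.Injective h.stripPoint := by
  rintro ⟨t, s⟩ ⟨t', s'⟩ hx
  have h1 := congrArg (fun p : FinVertex h.axisLine => p.1.1.1) hx
  have h2 := congrArg (fun p : FinVertex h.axisLine => p.1.2) hx
  have h3 : t = t' := h.ℓ₁_injective h1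
  simp only [stripPoint_snd] at h2
  cases s <;> cases s' <;> simp_all

theorem stripGraph_adj {x y : ℤ × Bool} : stripGraph.Adj x y ↔
    ((x.1 + 1 = y.1 ∨ y.1 + 1 = x.1) ∧ x.2 = y.2) ∨ (x.2 ≠ y.2 ∧ x.1 = y.1) := by
  simp [boxProd_adj, hasse_adj, Order.covBy_iff_add_one_eq]

theorem ℓ₁_adj_iff (hT₁ : T₁.IsTree) {s t : ℤ} :
    T₁.Adj (h.ℓ₁ s) (h.ℓ₁ t) ↔ s + 1 = t ∨ t + 1 = s := by
  rw [← dist_eq_one_iff_adj, h.isLine₁.dist_eq hT₁]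
  omega

theorem stripPoint_adj (hT₁ : T₁.IsTree) {x y : ℤ × Bool} :
    h.modelGraph.Adj (h.stripPoint x) (h.stripPoint y) ↔ stripGraph.Adj x y := by
  rw [finned_adj, stripGraph_adj]
  simp only [stripPoint_fst, stripPoint_snd, boxProd_adj, Prod.mk.injEq, h.ℓ₁_adj_iff hT₁,
    SimpleGraph.irrefl, h.ℓ₁_injective.eq_iff]
  rcases x with ⟨s, _ | _⟩ <;> rcases y with ⟨t, _ | _⟩ <;> simp

theorem modelHom_zpow_stripPoint (k : ℤ) (x : ℤ × Bool) :
    h.modelHom (g₁ ^ k) (h.stripPoint x) = h.stripPoint (stripHom h.τ₁ (.ofAdd k) x) := by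
  apply Subtype.ext
  refine Prod.ext (h.axis_zpow k x.1) ?_
  rw [modelHom_snd, stripPoint_snd, stripPoint_snd]
  rcases x with ⟨t, _ | _⟩
  · rfl
  · change some (((g₁ ^ k * 1 : Γ)) : Γ ⧸ Subgroup.zpowers g₁) = _
    rw [mul_one, ← one_mul (g₁ ^ k), mk_mul_zpow]
    rfl

/-- A cube of the strip `ℤ × [0,1]` as a cube of the universal cover. -/
def stripCube (hT₁ : T₁.IsTree) {n : ℕ} (d : (ofGraph stripGraph).cube n) :
    (ofGraph h.modelGraph).cube n :=
  ⟨fun x => h.stripPoint (d.1 x), fun _ _ hx => d.2.1 (h.stripPoint_injective hx),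
    fun x y hx => (h.stripPoint_adj hT₁).2 (d.2.2 x y hx)⟩

/-- A cube of the product of trees as a cube of the universal cover. -/
def baseCube {n : ℕ} (b : (ofGraph (T₁.boxProd T₂)).cube n) : (ofGraph h.modelGraph).cube n :=
  ⟨fun x => finBase h.axisLine (b.1 x), fun _ _ hx => b.2.1 (finBase_injective hx),
    fun x y hx => finned_adj_base.2 (b.2.2 x y hx)⟩

theorem baseCube_injective {n : ℕ} : Function.Injective (h.baseCube (n := n)) := fun b b' hb => by
  apply Subtype.ext
  funext x
  exact finBase_injective (congrFun (congrArg Subtype.val hb) x)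

theorem stripCube_injective (hT₁ : T₁.IsTree) {n : ℕ} :
    Function.Injective (h.stripCube hT₁ (n := n)) := fun b b' hb => by
  apply Subtype.ext
  funext x
  exact h.stripPoint_injective (congrFun (congrArg Subtype.val hb) x)

theorem act_baseCube (g : Γ) {n : ℕ} (b : (ofGraph (T₁.boxProd T₂)).cube n) :
    ((graphAction h.modelHom).act g).toFun (h.baseCube b) =
      h.baseCube (((graphAction ρ).act g).toFun b) := rfl

theorem act_stripCube (hT₁ : T₁.IsTree) (k : ℤ) {n : ℕ} (d : (ofGraph stripGraph).cube n) :
    ((graphAction h.modelHom).act (g₁ ^ k)).toFun (h.stripCube hT₁ d) =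
      h.stripCube hT₁ (((graphAction (stripHom h.τ₁)).act (.ofAdd k)).toFun d) := by
  apply Subtype.ext
  funext x
  exact h.modelHom_zpow_stripPoint k (d.1 x)

theorem exists_baseCube {n : ℕ} (c : (ofGraph h.modelGraph).cube n)
    (hc : ∀ x, (c.1 x).1.2 = none) : ∃ b, c = h.baseCube b := by
  have hx : ∀ x, c.1 x = finBase h.axisLine (c.1 x).1.1 := fun x =>
    eq_finBase_iff.2 ⟨rfl, hc x⟩
  refine ⟨⟨fun x => (c.1 x).1.1, fun x y hxy => c.2.1 ?_, fun x y hxy => ?_⟩,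
    Subtype.ext (funext hx)⟩
  · rw [hx x, hx y]
    exact congrArg _ hxy
  · have := c.2.2 x y hxy
    rwa [hx x, hx y, finned_adj_base] at this

/-- A cube that touches the free side of a fin lies in that fin. The fin can only be left through a
rung, so the corner opposite to `x₀` is the only critical one. It is reached through a neighbour
still on the free side, since the edges at `x₀` in two directions cannot both be rungs without
having the same end. A representative `γ` of the coset then carries the standard strip to this fin.
-/
theorem exists_stripCube (hT₁ : T₁.IsTree) (hT₂ : T₂.IsTree) {n : ℕ}
    (c : (ofGraph h.modelGraph).cube n) (x₀ : Corner n) (hc : (c.1 x₀).1.2 ≠ none) :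
    ∃ (γ : Γ) (d : (ofGraph stripGraph).cube n), (d.1 x₀).2 = true ∧
      c = ((graphAction h.modelHom).act γ).toFun (h.stripCube hT₁ d) := by
  obtain ⟨s, hs⟩ := Option.ne_none_iff_exists'.1 hc
  have step : ∀ x i, (c.1 x).1.2 = some s →
      ((c.1 (flipAt x i)).1.2 = some s) ∨
        (c.1 (flipAt x i)).1.2 = none ∧ (c.1 (flipAt x i)).1.1 = (c.1 x).1.1 := by
    intro x i hx
    have := cube_adj_flipAt c x i
    rw [finned_adj, hx] at this
    grind
  have good : ∀ x, (c.1 x).1.1 ∈ h.axisLine s ∧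
      ((c.1 x).1.2 = none ∨ (c.1 x).1.2 = some s) := by
    have one : ∀ x i, (c.1 x).1.2 = some s → (c.1 (flipAt x i)).1.1 ∈ h.axisLine s ∧
        ((c.1 (flipAt x i)).1.2 = none ∨ (c.1 (flipAt x i)).1.2 = some s) := by
      intro x i hx
      rcases step x i hx with h1 | ⟨h1, h2⟩
      · exact ⟨(c.1 _).2 s h1, Or.inr h1⟩
      · exact ⟨h2 ▸ (c.1 x).2 s hx, Or.inl h1⟩
    intro x
    rcases corner_cases (cube_dim_le (h.modelGraph_twoDimensional hT₁ hT₂) c) x₀ x with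
      rfl | ⟨i, rfl⟩ | ⟨i, j, hij, rfl⟩
    · exact ⟨(c.1 x).2 s hs, Or.inr hs⟩
    · exact one _ _ hs
    · rcases step x₀ i hs with h1 | ⟨h1, h2⟩
      · exact one _ _ h1
      · rcases step x₀ j hs with h3 | ⟨h3, h4⟩
        · rw [flipAt_comm x₀ hij]
          exact one _ _ h3
        · refine absurd (c.2.1 (Subtype.ext (Prod.ext (h2.trans h4.symm) (h1.trans h3.symm)))) ?_
          exact flipAt_injective x₀ hij
  obtain ⟨γ, rfl⟩ := QuotientGroup.mk_surjective s
  have pre : ∀ x, ∃ y : ℤ × Bool, c.1 x = h.modelHom γ (h.stripPoint y) := by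
    intro x
    obtain ⟨h1, h2⟩ := good x
    obtain ⟨t, ht⟩ := h.mem_axisLine.1 h1
    rcases h2 with h2 | h2
    · exact ⟨(t, false), Subtype.ext (Prod.ext ht h2)⟩
    · refine ⟨(t, true), Subtype.ext (Prod.ext ht (h2.trans ?_))⟩
      rw [modelHom_snd, stripPoint_snd]
      change _ = some (((γ * 1 : Γ)) : Γ ⧸ Subgroup.zpowers g₁)
      rw [mul_one]
  choose d hd using pre
  refine ⟨γ, ⟨d, fun x y hxy => c.2.1 (by rw [hd, hd, hxy]), fun x y hxy => ?_⟩, ?_, ?_⟩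
  · have := c.2.2 x y hxy
    rwa [hd, hd, (h.modelHom γ).map_adj_iff, h.stripPoint_adj hT₁] at this
  · have h1 := hs
    rw [hd, modelHom_snd, stripPoint_snd] at h1
    by_contra hne
    simp [hne] at h1
  · exact Subtype.ext (funext hd)

theorem mk_mem_annulusBoundary {n : ℕ} {d : (ofGraph stripGraph).cube n} :
    Quotient.mk ((graphAction (stripHom h.τ₁)).orbitSetoid n) d ∈
      (annulusBoundary h.τ₁ h.τ₁_pos).carrier n ↔ ∀ x, (d.1 x).2 = false := by
  constructor
  · rintro ⟨c, hc, hcd⟩ x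
    obtain ⟨k, hk⟩ := Quotient.exact (s := (graphAction (stripHom h.τ₁)).orbitSetoid n) hcd
    rw [← hk]
    exact hc x
  · exact fun hd => ⟨d, hd, rfl⟩

/-- `loop` is defined through a chosen representative. Any other one differs by a multiple of `τ₁`,
which a power of `g₁` realizes on the axis. -/
theorem loop_mk (hfree : (graphAction ρ).IsFree) {n : ℕ} {d : (ofGraph stripGraph).cube n}
    (hd : ∀ x, (d.1 x).2 = false)
    (hd' : Quotient.mk ((graphAction (stripHom h.τ₁)).orbitSetoid n) d ∈
      (annulusBoundary h.τ₁ h.τ₁_pos).carrier n) :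
    (h.loop hfree).toFun ⟨_, hd'⟩ =
      Quotient.mk ((graphAction ρ).orbitSetoid n) (h.axisCube d hd) := by
  obtain ⟨k, hk⟩ := Quotient.exact (s := (graphAction (stripHom h.τ₁)).orbitSetoid n)
    hd'.choose_spec.2
  refine Quotient.sound (s := (graphAction ρ).orbitSetoid n) ⟨g₁ ^ k.toAdd, ?_⟩
  apply Subtype.ext
  funext x
  have hx : (hd'.choose.1 x).1 + k.toAdd * h.τ₁ = (d.1 x).1 :=
    congrArg Prod.fst (congrFun (congrArg Subtype.val hk) x)
  refine (h.axis_zpow k.toAdd (hd'.choose.1 x).1).trans ?_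
  rw [hx]
  rfl

/-- This is the gluing relation upstairs, matching the use of `loop` in the glued complex. -/
theorem stripCube_eq_baseCube (hT₁ : T₁.IsTree) {n : ℕ} {d : (ofGraph stripGraph).cube n}
    (hd : ∀ x, (d.1 x).2 = false) : h.stripCube hT₁ d = h.baseCube (h.axisCube d hd) := by
  apply Subtype.ext
  funext x
  refine eq_finBase_iff.2 ⟨rfl, ?_⟩
  change (if (d.1 x).2 then _ else _) = _
  simp [hd x]

/-- If two translated cubes of the strip, not contained in the axis, agree up to a face map, they
differ by a translation along the axis. -/
theorem exists_zpow_of_stripCube_eq (hT₁ : T₁.IsTree) {n : ℕ} {γ γ' : Γ}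
    {d d' : (ofGraph stripGraph).cube n} {x₀ : Corner n} (hd : (d.1 x₀).2 = true)
    (hc : ((graphAction h.modelHom).act γ).toFun (h.stripCube hT₁ d) =
      ((graphAction h.modelHom).act γ').toFun (h.stripCube hT₁ d')) :
    ∃ k : ℤ, γ = γ' * g₁ ^ k ∧
      ((graphAction (stripHom h.τ₁)).act (.ofAdd k)).toFun d = d' := by
  -- The corner `x₀` is on the free side, so its label remembers the coset of the translating
  -- element.
  have h1 := congrArg (fun p : FinVertex h.axisLine => p.1.2)
    (congrFun (congrArg Subtype.val hc) x₀)
  change ((h.stripPoint (d.1 x₀)).1.2.map (γ • ·)) = ((h.stripPoint (d'.1 x₀)).1.2.map (γ' • ·))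
    at h1
  rw [stripPoint_snd, stripPoint_snd, hd] at h1
  have h2 : (d'.1 x₀).2 = true := by
    by_contra hne
    simp [hne] at h1
  rw [h2] at h1
  have h3 : (((γ' * 1 : Γ)) : Γ ⧸ Subgroup.zpowers g₁) = ((γ * 1 : Γ) : Γ ⧸ Subgroup.zpowers g₁) :=
    (Option.some.inj h1).symm
  rw [mul_one, mul_one] at h3
  obtain ⟨k, hk⟩ := exists_zpow_of_mk_eq h3
  refine ⟨k, hk, ?_⟩
  rw [hk, Action.act_mul, h.act_stripCube] at hc
  have h4 := congrArg ((graphAction h.modelHom).act γ'⁻¹).toFun hc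
  rw [← Action.act_mul, ← Action.act_mul, inv_mul_cancel, Action.act_one, Action.act_one] at h4
  exact h.stripCube_injective hT₁ h4

end AntiTorus

namespace AntiTorus

open CubeComplex SimpleGraph

variable {V₁ V₂ Γ : Type u} [Group Γ] {T₁ : SimpleGraph V₁} {T₂ : SimpleGraph V₂}
  {ρ : Γ →* (T₁.boxProd T₂ ≃g T₁.boxProd T₂)} {g₁ g₂ : Γ} (h : AntiTorus ρ g₁ g₂)

/-! #### The covering map -/

/-- The graph of the covering map. -/
def Covers (hT₁ : T₁.IsTree) (hfree : (graphAction ρ).IsFree) {n : ℕ}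
    (c : (ofGraph h.modelGraph).cube n) (z : (h.gluedComplex hfree).cube n) : Prop :=
  (∃ b, c = h.baseCube b ∧ z = Sum.inl (Quotient.mk ((graphAction ρ).orbitSetoid n) b)) ∨
  ∃ (γ : Γ) (d : (ofGraph stripGraph).cube n)
    (hd : Quotient.mk ((graphAction (stripHom h.τ₁)).orbitSetoid n) d ∉
      (annulusBoundary h.τ₁ h.τ₁_pos).carrier n),
    c = ((graphAction h.modelHom).act γ).toFun (h.stripCube hT₁ d) ∧ z = Sum.inr ⟨_, hd⟩

section Covers

variable {h} {hT₁ : T₁.IsTree} {hfree : (graphAction ρ).IsFree}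

theorem exists_corner {n : ℕ} {d : (ofGraph stripGraph).cube n}
    (hd : Quotient.mk ((graphAction (stripHom h.τ₁)).orbitSetoid n) d ∉
      (annulusBoundary h.τ₁ h.τ₁_pos).carrier n) : ∃ x, (d.1 x).2 = true := by
  by_contra! hne
  exact hd (h.mk_mem_annulusBoundary.2 fun x => Bool.eq_false_iff.2 (hne x))

theorem baseCube_ne {n : ℕ} {b : (ofGraph (T₁.boxProd T₂)).cube n} {γ : Γ}
    {d : (ofGraph stripGraph).cube n} {x₀ : Corner n} (hd : (d.1 x₀).2 = true) :
    h.baseCube b ≠ ((graphAction h.modelHom).act γ).toFun (h.stripCube hT₁ d) := by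
  intro hc
  have h1 := congrArg (fun p : FinVertex h.axisLine => p.1.2)
    (congrFun (congrArg Subtype.val hc) x₀)
  change none = ((h.stripPoint (d.1 x₀)).1.2.map (γ • ·)) at h1
  rw [stripPoint_snd, hd] at h1
  simp at h1

theorem Covers.unique {n : ℕ} {c : (ofGraph h.modelGraph).cube n}
    {z z' : (h.gluedComplex hfree).cube n} (hz : h.Covers hT₁ hfree c z)
    (hz' : h.Covers hT₁ hfree c z') : z = z' := by
  rcases hz with ⟨b, rfl, rfl⟩ | ⟨γ, d, hd, rfl, rfl⟩ <;>
    rcases hz' with ⟨b', hc, rfl⟩ | ⟨γ', d', hd', hc, rfl⟩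
  · rw [h.baseCube_injective hc]
  · exact absurd hc (baseCube_ne (exists_corner hd').choose_spec)
  · exact absurd hc.symm (baseCube_ne (exists_corner hd).choose_spec)
  · obtain ⟨x₀, hx₀⟩ := exists_corner hd
    obtain ⟨k, -, hk⟩ := h.exists_zpow_of_stripCube_eq hT₁ hx₀ hc
    exact congrArg Sum.inr (Subtype.ext (Quotient.sound
      (s := (graphAction (stripHom h.τ₁)).orbitSetoid n) ⟨_, hk⟩))

theorem exists_covers (hT₂ : T₂.IsTree) {n : ℕ} (c : (ofGraph h.modelGraph).cube n) :
    ∃ z, h.Covers hT₁ hfree c z := by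
  by_cases hc : ∀ x, (c.1 x).1.2 = none
  · obtain ⟨b, hb⟩ := h.exists_baseCube c hc
    exact ⟨_, Or.inl ⟨b, hb, rfl⟩⟩
  · push Not at hc
    obtain ⟨x₀, hx₀⟩ := hc
    obtain ⟨γ, d, hd, rfl⟩ := h.exists_stripCube hT₁ hT₂ c x₀ hx₀
    refine ⟨_, Or.inr ⟨γ, d, fun hd' => ?_, rfl, rfl⟩⟩
    rw [h.mk_mem_annulusBoundary.1 hd' x₀] at hd
    exact Bool.noConfusion hd

/-- The delicate case is a face of a strip cube that falls onto the axis: there `attach` switches to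
the loop, and upstairs the face becomes a translate of an axis cube in the base. -/
theorem Covers.face {m n : ℕ} {c : (ofGraph h.modelGraph).cube n}
    {z : (h.gluedComplex hfree).cube n} (hz : h.Covers hT₁ hfree c z) (φ : CubeMap m n) :
    h.Covers hT₁ hfree ((ofGraph h.modelGraph).face φ c) ((h.gluedComplex hfree).face φ z) := by
  rcases hz with ⟨b, rfl, rfl⟩ | ⟨γ, d, hd, rfl, rfl⟩
  · exact Or.inl ⟨(ofGraph _).face φ b, rfl, rfl⟩
  · by_cases hd' : Quotient.mk ((graphAction (stripHom h.τ₁)).orbitSetoid m)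
      ((ofGraph stripGraph).face φ d) ∈ (annulusBoundary h.τ₁ h.τ₁_pos).carrier m
    · have hd0 := h.mk_mem_annulusBoundary.1 hd'
      refine Or.inl ⟨((graphAction ρ).act γ).toFun (h.axisCube _ hd0), ?_, ?_⟩
      · rw [← Hom.map_face, ← act_baseCube, ← h.stripCube_eq_baseCube hT₁ hd0]
        rfl
      · refine (dif_pos hd').trans (congrArg Sum.inl ((h.loop_mk hfree hd0 hd').trans ?_))
        exact Quotient.sound (s := (graphAction ρ).orbitSetoid m) ⟨γ, rfl⟩
    · exact Or.inr ⟨γ, (ofGraph stripGraph).face φ d, hd', rfl, dif_neg hd'⟩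

theorem Covers.act {n : ℕ} {c : (ofGraph h.modelGraph).cube n}
    {z : (h.gluedComplex hfree).cube n} (hz : h.Covers hT₁ hfree c z) (g : Γ) :
    h.Covers hT₁ hfree (((graphAction h.modelHom).act g).toFun c) z := by
  rcases hz with ⟨b, rfl, rfl⟩ | ⟨γ, d, hd, rfl, rfl⟩
  · exact Or.inl ⟨_, h.act_baseCube g b, congrArg Sum.inl
      (Quotient.sound (s := (graphAction ρ).orbitSetoid n) ⟨g, rfl⟩)⟩
  · exact Or.inr ⟨g * γ, d, hd, (Action.act_mul _ _ _ _).symm, rfl⟩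

/-- Strip cubes over the same cube of the annulus differ by a translation of the strip by a multiple
of `τ₁`, and this is the effect of a power of `g₁`. So the fibres are single orbits. -/
theorem Covers.exists_act {n : ℕ} {c c' : (ofGraph h.modelGraph).cube n}
    {z : (h.gluedComplex hfree).cube n} (hz : h.Covers hT₁ hfree c z)
    (hz' : h.Covers hT₁ hfree c' z) : ∃ g, ((graphAction h.modelHom).act g).toFun c = c' := by
  rcases hz with ⟨b, rfl, rfl⟩ | ⟨γ, d, hd, rfl, rfl⟩ <;>
    rcases hz' with ⟨b', rfl, hc⟩ | ⟨γ', d', hd', rfl, hc⟩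
  · obtain ⟨g, hg⟩ := Quotient.exact (s := (graphAction ρ).orbitSetoid n) (Sum.inl.inj hc)
    exact ⟨g, by rw [act_baseCube, hg]⟩
  · exact absurd hc (by simp)
  · exact absurd hc (by simp)
  · obtain ⟨k, rfl⟩ := Quotient.exact (s := (graphAction (stripHom h.τ₁)).orbitSetoid n)
      (congrArg Subtype.val (Sum.inr.inj hc))
    refine ⟨γ' * g₁ ^ k.toAdd * γ⁻¹, ?_⟩
    rw [← Action.act_mul, inv_mul_cancel_right, Action.act_mul, h.act_stripCube]
    rfl

end Covers

/-- The covering map from the model to the glued complex. -/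
noncomputable def modelMap (hT₁ : T₁.IsTree) (hfree : (graphAction ρ).IsFree) 
    (hT₂ : T₂.IsTree) :
    Hom (ofGraph h.modelGraph) (h.gluedComplex hfree) where
  toFun c := (exists_covers (hT₁ := hT₁) (hfree := hfree) hT₂ c).choose
  map_face φ c := (exists_covers hT₂ _).choose_spec.unique
    ((exists_covers hT₂ c).choose_spec.face φ)

theorem covers_modelMap (hT₁ : T₁.IsTree) (hfree : (graphAction ρ).IsFree) 
    (hT₂ : T₂.IsTree) {n : ℕ} (c : (ofGraph h.modelGraph).cube n) :
    h.Covers hT₁ hfree c ((h.modelMap hT₁ hfree hT₂).toFun c) :=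
  (exists_covers hT₂ c).choose_spec

theorem modelMap_eq_iff (hT₁ : T₁.IsTree) (hfree : (graphAction ρ).IsFree) 
    (hT₂ : T₂.IsTree) {n : ℕ} (c c' : (ofGraph h.modelGraph).cube n) :
    (h.modelMap hT₁ hfree hT₂).toFun c = (h.modelMap hT₁ hfree hT₂).toFun c' ↔
      ∃ g, ((graphAction h.modelHom).act g).toFun c = c' := by
  constructor
  · intro hc
    exact (h.covers_modelMap hT₁ hfree hT₂ c).exists_act (hc ▸ h.covers_modelMap hT₁ hfree hT₂ c')
  · rintro ⟨g, rfl⟩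
    exact ((h.covers_modelMap hT₁ hfree hT₂ c).act g).unique (h.covers_modelMap hT₁ hfree hT₂ _)

theorem modelMap_surjective (hT₁ : T₁.IsTree) (hfree : (graphAction ρ).IsFree) 
    (hT₂ : T₂.IsTree) (n : ℕ) :
    Function.Surjective ((h.modelMap hT₁ hfree hT₂).toFun (n := n)) := by
  rintro (⟨⟨b⟩⟩ | ⟨⟨d⟩, hd⟩)
  · exact ⟨h.baseCube b, (h.covers_modelMap hT₁ hfree hT₂ _).unique (Or.inl ⟨b, rfl, rfl⟩)⟩
  · exact ⟨((graphAction h.modelHom).act 1).toFun (h.stripCube hT₁ d),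
      (h.covers_modelMap hT₁ hfree hT₂ _).unique (Or.inr ⟨1, d, hd, rfl, rfl⟩)⟩

/-! #### The action on the model -/

/-- An element that preserves a cube of a strip preserves the strip, so it is conjugate to a power
of `g₁` and acts on the strip by a translation; the translations of the strip act freely. -/
theorem modelAction_isFree (hT₁ : T₁.IsTree) (hfree : (graphAction ρ).IsFree) 
    (hT₂ : T₂.IsTree) : (graphAction h.modelHom).IsFree := by
  intro g n c φ hc
  by_cases hb : ∀ x, (c.1 x).1.2 = none
  · obtain ⟨b, rfl⟩ := h.exists_baseCube c hb
    exact hfree g b φ (h.baseCube_injective hc)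
  · push Not at hb
    obtain ⟨x₀, hx₀⟩ := hb
    obtain ⟨γ, d, hd, rfl⟩ := h.exists_stripCube hT₁ hT₂ c x₀ hx₀
    rw [← Action.act_mul, ← Hom.map_face] at hc
    obtain ⟨k, hk, hk'⟩ := h.exists_zpow_of_stripCube_eq hT₁
      (d' := (ofGraph stripGraph).face φ d) hd hc
    have h1 : k = 0 := stripHom_free h.τ₁_pos _ d φ hk'
    rw [h1, zpow_zero, mul_one] at hk
    exact mul_eq_right.1 hk

theorem act_injective (hfree : (graphAction ρ).IsFree) (v : V₁ × V₂) :
    Function.Injective fun g => ρ g v := by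
  intro g g' hg
  have : (g'⁻¹ * g) = 1 := by
    refine hfree _ (vtx _ v) (CubeMap.id 0) (pt_injective ?_)
    change ρ (g'⁻¹ * g) v = v
    rw [map_mul, RelIso.mul_apply]
    change ρ g v = ρ g' v at hg
    rw [hg, map_inv, RelIso.inv_apply_self]
  exact (inv_mul_eq_one.1 this).symm

/-- Freeness makes the orbit map injective, and balls are finite by local finiteness. -/
theorem finite_setOf_dist_le (hfree : (graphAction ρ).IsFree) (hT₁ : T₁.IsTree) (hT₂ : T₂.IsTree)
    (hf₁ : ∀ v, (T₁.neighborSet v).Finite) (hf₂ : ∀ v, (T₂.neighborSet v).Finite)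
    (v : V₁ × V₂) (r : ℕ) : {g : Γ | (T₁.boxProd T₂).dist v (ρ g v) ≤ r}.Finite :=
  Set.Finite.preimage (f := fun g => ρ g v) (act_injective hfree v).injOn
    (finite_ball (hT₁.connected.boxProd hT₂.connected) (finite_neighborSet_boxProd hf₁ hf₂) v r)

theorem modelAction_isProper (hT₁ : T₁.IsTree) (hfree : (graphAction ρ).IsFree) 
    (hT₂ : T₂.IsTree)
    (hf₁ : ∀ v, (T₁.neighborSet v).Finite) (hf₂ : ∀ v, (T₂.neighborSet v).Finite) :
    (graphAction h.modelHom).IsProper := by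
  intro x r
  refine (finite_setOf_dist_le hfree hT₁ hT₂ hf₁ hf₂ (pt x).1.1 r).subset fun g hg => ?_
  rw [Set.mem_ofPred_eq, dist_ofGraph] at hg
  exact (Nat.le_of_add_right_le (le_dist_finned (hT₁.connected.boxProd hT₂.connected) _ _)).trans hg

theorem natAbs_sub_le {n : ℕ} (hn : n ≤ 2) (d : (ofGraph stripGraph).cube n) (x y : Corner n) :
    ((d.1 y).1 - (d.1 x).1).natAbs ≤ 2 := by
  have step : ∀ x i, ((d.1 (flipAt x i)).1 - (d.1 x).1).natAbs ≤ 1 := fun x i => by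
    have := stripGraph_adj.1 (cube_adj_flipAt d x i)
    omega
  rcases corner_cases hn x y with rfl | ⟨i, rfl⟩ | ⟨i, j, -, rfl⟩
  · simp
  · exact (step _ _).trans (by norm_num)
  · have h1 := step x i
    have h2 := step (flipAt x i) j
    omega

theorem modelAction_isCocompact (hT₁ : T₁.IsTree) 
    (hT₂ : T₂.IsTree) (hcoc : (graphAction ρ).IsCocompact) :
    (graphAction h.modelHom).IsCocompact := by
  obtain ⟨S, hS, hcov⟩ := hcoc
  -- Besides the vertices of the representatives in `S`, a bounded piece of the standard strip is
  -- enough: division with remainder by `τ₁` moves the coordinate of `x₀` into [0, τ₁), and the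
  -- other corners of the cube are at most 2 away.
  refine graphAction_isCocompact h.modelHom (h.modelGraph_twoDimensional hT₁ hT₂)
    (B := (⋃ c ∈ S, Set.range fun x => finBase h.axisLine (c.2.1 x)) ∪
      h.stripPoint '' (Set.Icc (-2) ((h.τ₁ : ℤ) + 2) ×ˢ Set.univ))
    ((hS.biUnion fun c _ => Set.finite_range _).union
      (((Set.finite_Icc _ _).prod Set.finite_univ).image _)) fun {n} c => ?_
  by_cases hb : ∀ x, (c.1 x).1.2 = none
  · obtain ⟨b, rfl⟩ := h.exists_baseCube c hb
    obtain ⟨g, hg⟩ := hcov b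
    exact ⟨g, fun x => Or.inl (Set.mem_biUnion hg ⟨x, rfl⟩)⟩
  · push Not at hb
    obtain ⟨x₀, hx₀⟩ := hb
    obtain ⟨γ, d, hd, rfl⟩ := h.exists_stripCube hT₁ hT₂ c x₀ hx₀
    refine ⟨g₁ ^ (-((d.1 x₀).1 / h.τ₁)) * γ⁻¹, fun x => Or.inr ?_⟩
    change h.modelHom _ (h.modelHom γ (h.stripPoint (d.1 x))) ∈ _
    rw [map_mul, RelIso.mul_apply, map_inv, RelIso.inv_apply_self, modelHom_zpow_stripPoint]
    refine Set.mem_image_of_mem _ ⟨?_, trivial⟩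
    have h1 := natAbs_sub_le (cube_dim_le (h.modelGraph_twoDimensional hT₁ hT₂)
      (h.stripCube hT₁ d)) d x₀ x
    have h2 := Int.emod_add_mul_ediv (d.1 x₀).1 h.τ₁
    have h3 := Int.emod_nonneg (d.1 x₀).1 (b := h.τ₁) (by exact_mod_cast h.τ₁_pos.ne')
    have h4 := Int.emod_lt_of_pos (d.1 x₀).1 (b := h.τ₁) (by exact_mod_cast h.τ₁_pos)
    change (d.1 x).1 + -((d.1 x₀).1 / h.τ₁) * h.τ₁ ∈ _
    rw [neg_mul, mul_comm, Set.mem_Icc]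
    omega

theorem modelAction_isCubulation (hT₁ : T₁.IsTree) (hfree : (graphAction ρ).IsFree) 
    (hT₂ : T₂.IsTree)
    (hf₁ : ∀ v, (T₁.neighborSet v).Finite) (hf₂ : ∀ v, (T₂.neighborSet v).Finite)
    (hcoc : (graphAction ρ).IsCocompact) : (graphAction h.modelHom).IsCubulation where
  cat0 := h.model_isCAT0 hT₁ hT₂
  proper := h.modelAction_isProper hT₁ hfree hT₂ hf₁ hf₂
  cocompact := h.modelAction_isCocompact hT₁ hT₂ hcoc

theorem modelMap_isUniversalCover (hT₁ : T₁.IsTree) (hfree : (graphAction ρ).IsFree) 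
    (hT₂ : T₂.IsTree) :
    (h.modelMap hT₁ hfree hT₂).IsUniversalCover where
  covering := Hom.isCovering_of_orbits (graphAction h.modelHom) _
    (fun g v hg => h.modelAction_isFree hT₁ hfree hT₂ g v (CubeMap.id 0) hg)
    (h.modelMap_surjective hT₁ hfree hT₂) (h.modelMap_eq_iff hT₁ hfree hT₂)
  simplyConnected := (h.model_isCAT0 hT₁ hT₂).simplyConnected

end AntiTorus

namespace AntiTorus

open CubeComplex SimpleGraph

variable {V₁ V₂ Γ : Type u} [Group Γ] {T₁ : SimpleGraph V₁} {T₂ : SimpleGraph V₂}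
  {ρ : Γ →* (T₁.boxProd T₂ ≃g T₁.boxProd T₂)} {g₁ g₂ : Γ} (h : AntiTorus ρ g₁ g₂)

/-! #### The action of the second generator on the first tree -/

theorem translate_zpow (k t : ℤ) :
    ρ (g₂ ^ k) (h.ℓ₁ 0, h.ℓ₂ t) = (h.ℓ₁ 0, h.ℓ₂ (t + k * h.τ₂)) := by
  induction k generalizing t with
  | zero => simp
  | succ k ih =>
    rw [zpow_add_one, map_mul, RelIso.mul_apply, h.translate₂, ih]
    congr 2
    ring
  | pred k ih =>
    have h1 := h.translate₂ (t - h.τ₂)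
    rw [sub_add_cancel] at h1
    rw [zpow_sub_one, map_mul, RelIso.mul_apply, ← h1, map_inv, RelIso.inv_apply_self, ih]
    congr 2
    ring

/-- The map induced on the first tree by a power of `g₂`, which preserves `T₁ × ℓ₂`. -/
def drift (k : ℤ) (x : V₁) : V₁ := (ρ (g₂ ^ k) (x, h.ℓ₂ 0)).1

/-- The statement holds for the line over p₁ and spreads along walks in T₁. Over an edge of T₁ the
product with ℓ₂ is a row of squares; the images of its edges over ℓ₂ on the known side are edges in
the second factor, so by `boxProd_square` the rungs go to edges of the first factor, and the new
side is carried along with the same shift and a constant first coordinate. -/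
theorem zpow_apply (hT₁ : T₁.IsTree) (hT₂ : T₂.IsTree) (k : ℤ) (x : V₁) (t : ℤ) :
    ρ (g₂ ^ k) (x, h.ℓ₂ t) = (h.drift k x, h.ℓ₂ (t + k * h.τ₂)) := by
  have key : ∀ {z x : V₁} (_ : T₁.Walk z x),
      (∃ y, ∀ t, ρ (g₂ ^ k) (z, h.ℓ₂ t) = (y, h.ℓ₂ (t + k * h.τ₂))) →
      ∃ y, ∀ t, ρ (g₂ ^ k) (x, h.ℓ₂ t) = (y, h.ℓ₂ (t + k * h.τ₂)) := by
    intro z x w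
    induction w with
    | nil => exact id
    | @cons z z' x e w ih =>
      rintro ⟨y, hy⟩
      refine ih ⟨(ρ (g₂ ^ k) (z', h.ℓ₂ 0)).1, ?_⟩
      have sq : ∀ t, (ρ (g₂ ^ k) (z', h.ℓ₂ t)).2 = h.ℓ₂ (t + k * h.τ₂) ∧
          (ρ (g₂ ^ k) (z', h.ℓ₂ (t + 1))).1 = (ρ (g₂ ^ k) (z', h.ℓ₂ t)).1 := by
        intro t
        have := hT₁.boxProd_square hT₂ (u := ρ (g₂ ^ k) (z, h.ℓ₂ t))
          (a := ρ (g₂ ^ k) (z', h.ℓ₂ t)) (b := ρ (g₂ ^ k) (z, h.ℓ₂ (t + 1)))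
          (w := ρ (g₂ ^ k) (z', h.ℓ₂ (t + 1)))
          (fun hn => e.ne (congrArg Prod.fst ((ρ (g₂ ^ k)).injective hn)).symm)
          (fun hn => e.ne (congrArg Prod.fst ((ρ (g₂ ^ k)).injective hn)))
          ((ρ (g₂ ^ k)).map_adj_iff.2 (by simp [boxProd_adj, e]))
          ((ρ (g₂ ^ k)).map_adj_iff.2 (by simp [boxProd_adj, h.ℓ₂_adj]))
          ((ρ (g₂ ^ k)).map_adj_iff.2 (by simp [boxProd_adj, (h.ℓ₂_adj t).symm]))
          ((ρ (g₂ ^ k)).map_adj_iff.2 (by simp [boxProd_adj, e.symm]))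
        rw [hy, hy] at this
        rcases this with ⟨h1, -, h2⟩ | ⟨-, h1, -⟩
        · exact ⟨h1, by rw [h2]⟩
        -- In this alternative a step along ℓ₂ would have zero length.
        · have := h.ℓ₂_injective h1
          omega
      intro t
      refine Prod.ext ?_ (sq t).1
      induction t with
      | zero => rfl
      | succ t ih => exact (sq t).2.trans ih
      | pred t ih =>
        rw [← ih, ← (sq (-(t : ℤ) - 1)).2, sub_add_cancel]
  obtain ⟨w⟩ := hT₁.connected (h.ℓ₁ 0) x
  obtain ⟨y, hy⟩ := key w ⟨h.ℓ₁ 0, h.translate_zpow k⟩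
  rw [hy, drift, hy]

theorem drift_add (hT₁ : T₁.IsTree) (hT₂ : T₂.IsTree) (k l : ℤ) (x : V₁) :
    h.drift (k + l) x = h.drift k (h.drift l x) := by
  have h1 := h.zpow_apply hT₁ hT₂ (k + l) x 0
  rw [zpow_add, map_mul, RelIso.mul_apply, h.zpow_apply hT₁ hT₂, h.zpow_apply hT₁ hT₂] at h1
  exact (congrArg Prod.fst h1).symm

theorem drift_zero (x : V₁) : h.drift 0 x = x := by simp [drift]

theorem drift_base (k : ℤ) : h.drift k (h.ℓ₁ 0) = h.ℓ₁ 0 :=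
  congrArg Prod.fst (h.translate_zpow k 0)

/-- The automorphism of the first tree induced by a power of `g₂`. -/
def driftIso (hT₁ : T₁.IsTree) (hT₂ : T₂.IsTree) (k : ℤ) : T₁ ≃g T₁ where
  toFun := h.drift k
  invFun := h.drift (-k)
  left_inv x := by rw [← h.drift_add hT₁ hT₂, neg_add_cancel, h.drift_zero]
  right_inv x := by rw [← h.drift_add hT₁ hT₂, add_neg_cancel, h.drift_zero]
  map_rel_iff' := by
    intro x y
    have : (T₁.boxProd T₂).Adj (ρ (g₂ ^ k) (x, h.ℓ₂ 0)) (ρ (g₂ ^ k) (y, h.ℓ₂ 0)) ↔ _ :=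
      (ρ (g₂ ^ k)).map_adj_iff
    rw [h.zpow_apply hT₁ hT₂, h.zpow_apply hT₁ hT₂] at this
    simpa [boxProd_adj] using this

theorem dist_drift (hT₁ : T₁.IsTree) (hT₂ : T₂.IsTree) (k : ℤ) (x y : V₁) :
    T₁.dist (h.drift k x) (h.drift k y) = T₁.dist x y :=
  dist_iso (h.driftIso hT₁ hT₂ k) x y

theorem isLine_drift (hT₁ : T₁.IsTree) (hT₂ : T₂.IsTree) (k : ℤ) :
    T₁.IsLine fun t => h.drift k (h.ℓ₁ t) where
  injective := (h.driftIso hT₁ hT₂ k).injective.comp h.ℓ₁_injective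
  adj t := (h.driftIso hT₁ hT₂ k).map_adj_iff.2 (h.ℓ₁_adj t)

/-- Some nontrivial power of `g₂` fixes a long segment of the line `ℓ₁`. -/
theorem exists_drift_eq (hT₁ : T₁.IsTree) (hT₂ : T₂.IsTree)
    (hf₁ : ∀ v, (T₁.neighborSet v).Finite) (R : ℕ) :
    ∃ k : ℤ, k ≠ 0 ∧ ∀ t : ℤ, t.natAbs ≤ R → h.drift k (h.ℓ₁ t) = h.ℓ₁ t := by
  -- The drifts are isometries fixing `ℓ₁ 0`, so on the segment of radius `R` they restrict to maps
  -- into a finite ball, and there are finitely many such maps. Two exponents with the same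
  -- restriction differ by the required `k`.
  have hfin : (Set.univ.pi fun _ : Set.Icc (-(R : ℤ)) R =>
      {w | T₁.dist (h.ℓ₁ 0) w ≤ R}).Finite :=
    Set.Finite.pi fun _ => finite_ball hT₁.connected hf₁ _ _
  obtain ⟨k, l, hkl, he⟩ := Set.Finite.exists_lt_map_eq_of_forall_mem
    (f := fun (k : ℤ) (t : Set.Icc (-(R : ℤ)) R) => h.drift k (h.ℓ₁ t))
    (t := Set.univ.pi fun _ : Set.Icc (-(R : ℤ)) R => {w | T₁.dist (h.ℓ₁ 0) w ≤ R})
    (fun k t _ => by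
      have h1 : T₁.dist (h.drift k (h.ℓ₁ 0)) (h.drift k (h.ℓ₁ t)) ≤ R := by
        have := t.2.1
        have := t.2.2
        rw [h.dist_drift hT₁ hT₂, h.isLine₁.dist_eq hT₁]
        omega
      rwa [h.drift_base] at h1) hfin
  refine ⟨l - k, by omega, fun t ht => ?_⟩
  have h1 := congrFun he ⟨t, by omega, by omega⟩
  have h2 : h.drift l (h.ℓ₁ t) = h.drift k (h.drift (l - k) (h.ℓ₁ t)) := by
    rw [← h.drift_add hT₁ hT₂, add_sub_cancel]
  exact ((h.driftIso hT₁ hT₂ k).injective (h1.trans h2)).symm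

/-- No nontrivial power of `g₂` preserves the line `ℓ₁` with its direction. -/
theorem exists_notMem_drift (hfree : (graphAction ρ).IsFree) (hT₁ : T₁.IsTree) (hT₂ : T₂.IsTree)
    (hf₁ : ∀ v, (T₁.neighborSet v).Finite) (hf₂ : ∀ v, (T₂.neighborSet v).Finite) {k : ℤ}
    (hk : k ≠ 0) (h1 : h.drift k (h.ℓ₁ 1) = h.ℓ₁ 1) :
    ∃ t, h.ℓ₁ t ∉ Set.range fun s => h.drift k (h.ℓ₁ s) := by
  by_contra! hall
  -- A point of ℓ₁ is determined by its distances to the two fixed points `ℓ₁ 0` and `ℓ₁ 1`; fixing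
  -- the second one rules out a reflection.
  have hfix : ∀ t, h.drift k (h.ℓ₁ t) = h.ℓ₁ t := by
    intro t
    obtain ⟨s, hs⟩ := hall t
    simp only at hs
    have e0 := h.dist_drift hT₁ hT₂ k (h.ℓ₁ 0) (h.ℓ₁ s)
    have e1 := h.dist_drift hT₁ hT₂ k (h.ℓ₁ 1) (h.ℓ₁ s)
    rw [hs, h.drift_base, h.isLine₁.dist_eq hT₁, h.isLine₁.dist_eq hT₁] at e0
    rw [hs, h1, h.isLine₁.dist_eq hT₁, h.isLine₁.dist_eq hT₁] at e1
    obtain rfl : s = t := by omega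
    exact hs
  -- Since g₂ᵏ fixes ℓ₁ pointwise in the first factor, it moves each translate of (p₁, p₂) under a
  -- power of `g₁` by |k|τ₂. So all conjugates of g₂ᵏ by powers of `g₁` move (p₁, p₂) by this
  -- distance, and only finitely many group elements do.
  obtain ⟨m, n, hmn, he⟩ := Set.Finite.exists_lt_map_eq_of_forall_mem
    (f := fun m : ℤ => (g₁ ^ m)⁻¹ * g₂ ^ k * g₁ ^ m) (t := _) (fun m => by
      change (T₁.boxProd T₂).dist (h.ℓ₁ 0, h.ℓ₂ 0) (ρ _ (h.ℓ₁ 0, h.ℓ₂ 0)) ≤ (k * h.τ₂).natAbs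
      have e : ρ (g₁ ^ m) (h.ℓ₁ 0, h.ℓ₂ 0) = (h.ℓ₁ (m * h.τ₁), h.ℓ₂ 0) := by
        rw [h.axis_zpow, zero_add]
      rw [← dist_iso (ρ (g₁ ^ m)), ← RelIso.mul_apply, ← map_mul, ← mul_assoc, ← mul_assoc,
        mul_inv_cancel, one_mul, map_mul, RelIso.mul_apply, e, h.zpow_apply hT₁ hT₂, hfix,
        dist_boxProd hT₁.connected hT₂.connected, SimpleGraph.dist_self,
        h.isLine₂.dist_eq hT₂]
      simp)
    (finite_setOf_dist_le hfree hT₁ hT₂ hf₁ hf₂ (h.ℓ₁ 0, h.ℓ₂ 0) _)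
  refine h.not_commute (n - m) k (by omega) hk ?_
  rw [commute_iff_eq, zpow_sub]
  have he' : (g₁ ^ m)⁻¹ * g₂ ^ k * g₁ ^ m = (g₁ ^ n)⁻¹ * g₂ ^ k * g₁ ^ n := he
  have e1 : g₁ ^ n * (g₁ ^ m)⁻¹ = (g₁ ^ m)⁻¹ * g₁ ^ n := by
    rw [← zpow_neg, ← zpow_add, ← zpow_add, add_comm]
  calc g₁ ^ n * (g₁ ^ m)⁻¹ * g₂ ^ k
      = g₁ ^ n * ((g₁ ^ m)⁻¹ * g₂ ^ k * g₁ ^ m) * (g₁ ^ m)⁻¹ := by group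
    _ = g₂ ^ k * (g₁ ^ n * (g₁ ^ m)⁻¹) := by rw [he']; group

end AntiTorus

/-! ### Layers in finned products of trees -/

namespace CubeComplex

open SimpleGraph

theorem Subcomplex.mem_span_verts {X : CubeComplex.{u}} {S : Set X.Vertex} {v : X.Vertex} :
    v ∈ (Subcomplex.span S).verts ↔ v ∈ S := by
  change (∀ x, X.vert v x ∈ S) ↔ _
  simp [vert_zero]

section Layers

variable {V₁ V₂ Q : Type u} {T₁ : SimpleGraph V₁} {T₂ : SimpleGraph V₂} {L : Q → Set (V₁ × V₂)}

/-- The subcomplex spanned by the vertices `A × {p}`. -/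
def layer (T₁ : SimpleGraph V₁) (T₂ : SimpleGraph V₂) (L : Q → Set (V₁ × V₂)) (A : Set V₁)
    (p : V₂) : (ofGraph (finned (T₁.boxProd T₂) L)).Subcomplex :=
  Subcomplex.span {v | (pt v).1.2 = none ∧ (pt v).1.1.1 ∈ A ∧ (pt v).1.1.2 = p}

theorem mem_layer_verts {A : Set V₁} {p : V₂} {v : (ofGraph (finned (T₁.boxProd T₂) L)).Vertex} :
    v ∈ (layer T₁ T₂ L A p).verts ↔
      (pt v).1.2 = none ∧ (pt v).1.1.1 ∈ A ∧ (pt v).1.1.2 = p := Subcomplex.mem_span_verts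

theorem dist_layer (hT₁ : T₁.IsTree) (hT₂ : T₂.IsTree) {A B : Set V₁} {p : V₂}
    {v w : (ofGraph (finned (T₁.boxProd T₂) L)).Vertex} (hv : v ∈ (layer T₁ T₂ L A p).verts)
    (hw : w ∈ (layer T₁ T₂ L B p).verts) :
    (ofGraph (finned (T₁.boxProd T₂) L)).skeleton.dist v w =
      T₁.dist (pt v).1.1.1 (pt w).1.1.1 := by
  obtain ⟨v1, -, v2⟩ := mem_layer_verts.1 hv
  obtain ⟨w1, -, w2⟩ := mem_layer_verts.1 hw
  have ev : pt v = finBase L (pt v).1.1 := eq_finBase_iff.2 ⟨rfl, v1⟩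
  have ew : pt w = finBase L (pt w).1.1 := eq_finBase_iff.2 ⟨rfl, w1⟩
  rw [dist_ofGraph, ev, ew, dist_finBase (hT₁.connected.boxProd hT₂.connected),
    dist_boxProd hT₁.connected hT₂.connected, v2, w2]
  simp

/-- Distances in the finned product are at least the sum of the T₁-distance, the T₂-distance and a
penalty for changing the fin label. Between two vertices of the layer only the first term can occur,
and lines in T₁ are convex. -/
theorem isConvex_layer (hT₁ : T₁.IsTree) (hT₂ : T₂.IsTree) {m : ℤ → V₁} (hm : T₁.IsLine m)
    (p : V₂) : (layer T₁ T₂ L (Set.range m) p).IsConvex where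
  full c hc := fun x => Subcomplex.mem_span_verts.1 (hc x)
  geodesic v hv w hw z hz := by
    have h0 := dist_layer hT₁ hT₂ hv hw
    obtain ⟨v1, ⟨s, hs⟩, v2⟩ := mem_layer_verts.1 hv
    obtain ⟨w1, ⟨t, ht⟩, w2⟩ := mem_layer_verts.1 hw
    have hconn := hT₁.connected.boxProd hT₂.connected
    have h1 := le_dist_finned (L := L) hconn (pt v) (pt z)
    have h2 := le_dist_finned (L := L) hconn (pt z) (pt w)
    rw [h0, dist_ofGraph, dist_ofGraph] at hz
    rw [dist_boxProd hT₁.connected hT₂.connected] at h1 h2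
    rw [v1, v2, ← hs] at h1
    rw [w1, w2, ← ht] at h2
    rw [← hs, ← ht] at hz
    have h3 := hT₁.connected.dist_triangle (u := m s) (v := (pt z).1.1.1) (w := m t)
    refine mem_layer_verts.2 ⟨?_, hm.mem_range_of_dist_add hT₁ (s := s) (t := t) ?_, ?_⟩
    · by_contra hne
      rw [if_neg (fun h => hne h.symm)] at h1
      omega
    · omega
    · refine ((hT₂.connected.dist_eq_zero_iff).1 ?_)
      omega

/-- In a tree, the path from a point of `m'` to the common point passes through the point of `m`
closest to the start. By convexity of `m'` that closest point is on both lines. Conversely, common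
points are their own projections. -/
theorem proj_layer (hT₁ : T₁.IsTree) (hT₂ : T₂.IsTree) {m m' : ℤ → V₁} (hm : T₁.IsLine m)
    (hm' : T₁.IsLine m') {s s' : ℤ} (hs : m s = m' s') (p : V₂) :
    Subcomplex.proj (layer T₁ T₂ L (Set.range m) p) (layer T₁ T₂ L (Set.range m') p) =
      layer T₁ T₂ L (Set.range m ∩ Set.range m') p := by
  refine congrArg Subcomplex.span (Set.ext fun v => ⟨?_, ?_⟩)
  · rintro ⟨hv, w, hw, hle⟩
    obtain ⟨v1, ⟨t, ht⟩, v2⟩ := mem_layer_verts.1 hv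
    obtain ⟨w1, ⟨t', ht'⟩, w2⟩ := mem_layer_verts.1 hw
    refine ⟨v1, ⟨⟨t, ht⟩, ?_⟩, v2⟩
    have hcl : ∀ r, T₁.dist (pt w).1.1.1 (m t) ≤ T₁.dist (pt w).1.1.1 (m r) := by
      intro r
      have hr : vtx _ (finBase L (m r, p)) ∈ (layer T₁ T₂ L (Set.range m) p).verts :=
        mem_layer_verts.2 ⟨rfl, ⟨r, rfl⟩, rfl⟩
      have := hle _ hr
      rwa [dist_layer hT₁ hT₂ hw hv, dist_layer hT₁ hT₂ hw hr, ← ht] at this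
    rw [← ht]
    refine hm'.mem_range_of_dist_add hT₁ (s := t') (t := s') ?_
    rw [ht', ← hs, hm.dist_eq_of_closest hT₁ hcl s, hm.dist_eq hT₁]
  · rintro ⟨v1, ⟨hv, hv'⟩, v2⟩
    exact ⟨mem_layer_verts.2 ⟨v1, hv, v2⟩, v, mem_layer_verts.2 ⟨v1, hv', v2⟩, by simp⟩

/-- Edges of the first factor that differ by a translation in the second factor are dual to the
same hyperplane. -/
theorem sameHyperplane_layer (hT₂ : T₂.Connected) {x y : V₁} (e : T₁.Adj x y) (p q : V₂) :
    SameHyperplane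
      (mkEdge (finned_adj_base (L := L).2 (boxProd_adj_left (H := T₂) (b := p).2 e)))
      (mkEdge (finned_adj_base (L := L).2 (boxProd_adj_left (H := T₂) (b := q).2 e))) := by
  obtain ⟨w⟩ := hT₂ p q
  induction w with
  | nil => exact .refl _
  | @cons p p' q e' w ih =>
    refine .trans _ _ _ (.rel _ _ ⟨mkSquare (u := finBase L (x, p)) (a := finBase L (y, p))
      (b := finBase L (x, p')) (w := finBase L (y, p')) ?_ ?_ ?_ ?_ ?_ ?_, ?_, ?_⟩) ih
    · exact fun hn => e.ne (congrArg Prod.fst (finBase_injective hn)).symm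
    · exact fun hn => e.ne (congrArg Prod.fst (finBase_injective hn))
    · exact finned_adj_base.2 (boxProd_adj_left.2 e)
    · exact finned_adj_base.2 (boxProd_adj_right.2 e')
    · exact finned_adj_base.2 (boxProd_adj_right.2 e'.symm)
    · exact finned_adj_base.2 (boxProd_adj_left.2 e.symm)
    · exact edge_ext rfl rfl
    · exact edge_ext rfl rfl

theorem crosses_layer (hT₂ : T₂.Connected) {A : Set V₁} {p q : V₂}
    {e : (ofGraph (finned (T₁.boxProd T₂) L)).Edge} (he : (layer T₁ T₂ L A p).Crosses e) :
    (layer T₁ T₂ L A q).Crosses e := by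
  obtain ⟨e', hm, hs⟩ := he
  obtain ⟨a1, a2, a3⟩ := hm fun _ => false
  obtain ⟨b1, b2, b3⟩ := hm fun _ => true
  have h0 := edge_adj e'
  change (pt ((ofGraph _).src e')).1.2 = _ at a1
  change (pt ((ofGraph _).src e')).1.1.2 = _ at a3
  change (pt ((ofGraph _).tgt e')).1.2 = _ at b1
  change (pt ((ofGraph _).tgt e')).1.1.2 = _ at b3
  change (pt ((ofGraph _).src e')).1.1.1 ∈ _ at a2
  change (pt ((ofGraph _).tgt e')).1.1.1 ∈ _ at b2
  have ea : pt ((ofGraph _).src e') = finBase L ((pt ((ofGraph _).src e')).1.1.1, p) :=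
    eq_finBase_iff.2 ⟨Prod.ext rfl a3, a1⟩
  have eb : pt ((ofGraph _).tgt e') = finBase L ((pt ((ofGraph _).tgt e')).1.1.1, p) :=
    eq_finBase_iff.2 ⟨Prod.ext rfl b3, b1⟩
  rw [ea, eb, finned_adj_base, boxProd_adj_left] at h0
  have key := sameHyperplane_layer (L := L) hT₂ h0 p q
  have ee : e' = mkEdge (finned_adj_base (L := L).2 (boxProd_adj_left (H := T₂) (b := p).2 h0)) :=
    edge_ext (pt_injective ea) (pt_injective eb)
  rw [← ee] at key
  refine ⟨_, fun t => ?_, .trans _ _ _ hs key⟩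
  rcases corner_one t with rfl | rfl
  · exact ⟨rfl, a2, rfl⟩
  · exact ⟨rfl, b2, rfl⟩

theorem parallel_layer (hT₂ : T₂.Connected) (A : Set V₁) (p q : V₂) :
    (layer T₁ T₂ L A p).Parallel (layer T₁ T₂ L A q) :=
  fun _ => ⟨crosses_layer hT₂, crosses_layer hT₂⟩

/-- The oriented edge crosses the fin `s` from the base to the free side. -/
def IsRung {G : SimpleGraph (V₁ × V₂)} (s : Q) (e : (ofGraph (finned G L)).Edge) : Prop :=
  (pt ((ofGraph _).src e)).1.2 = none ∧ (pt ((ofGraph _).tgt e)).1.2 = some s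

/-- Free sides of different fins are not adjacent and a vertex has only one rung into a given fin,
so any other configuration would be a degenerate square. This makes `IsRung` an invariant of
hyperplanes. -/
theorem finned_opposite {V : Type u} {G : SimpleGraph V} {L : Q → Set V} {s : Q}
    {a b c d : FinVertex L} (hab : (finned G L).Adj a b) (hac : (finned G L).Adj a c)
    (hbd : (finned G L).Adj b d) (hcd : (finned G L).Adj c d) (hbc : b ≠ c) (had : a ≠ d)
    (ha : a.1.2 = none) (hb : b.1.2 = some s) : c.1.2 = none ∧ d.1.2 = some s := by
  obtain ⟨⟨a1, a2⟩, ha'⟩ := a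
  obtain ⟨⟨b1, b2⟩, hb'⟩ := b
  obtain ⟨⟨c1, c2⟩, hc'⟩ := c
  obtain ⟨⟨d1, d2⟩, hd'⟩ := d
  simp only [finned_adj, ne_eq, Subtype.mk.injEq, Prod.mk.injEq] at *
  subst ha hb
  rcases c2 with _ | c2 <;> rcases d2 with _ | d2 <;> simp_all

theorem IsRung.of_sameHyperplane {G : SimpleGraph (V₁ × V₂)} {s : Q}
    {e e' : (ofGraph (finned G L)).Edge} (h : SameHyperplane e e') : IsRung s e ↔ IsRung s e' := by
  induction h with
  | refl => rfl
  | symm _ _ _ ih => exact ih.symm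
  | trans _ _ _ _ _ ih₁ ih₂ => exact ih₁.trans ih₂
  | rel e e' h =>
    obtain ⟨c, rfl, rfl⟩ := h
    have hn : ∀ x y, c.1 x = c.1 y → x = y := fun x y h => c.2.1 h
    have e1 : (Function.update ![false, false] 0 (false : Bool) : Corner 2) = ![false, false] := by
      decide
    have e2 : (Function.update ![false, false] 0 (true : Bool) : Corner 2) = ![true, false] := by
      decide
    have e3 : (Function.update ![false, true] 0 (false : Bool) : Corner 2) = ![false, true] := by
      decide
    have e4 : (Function.update ![false, true] 0 (true : Bool) : Corner 2) = ![true, true] := by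
      decide
    change ((c.1 (Function.update ![false, false] 0 false)).1.2 = none ∧
      (c.1 (Function.update ![false, false] 0 true)).1.2 = some s) ↔
      ((c.1 (Function.update ![false, true] 0 false)).1.2 = none ∧
      (c.1 (Function.update ![false, true] 0 true)).1.2 = some s)
    rw [e1, e2, e3, e4]
    have ad := c.2.2
    constructor
    · rintro ⟨h1, h2⟩
      exact finned_opposite (ad _ _ (by decide)) (ad _ _ (by decide)) (ad _ _ (by decide))
        (ad _ _ (by decide)) (fun h => absurd (hn _ _ h) (by decide))
        (fun h => absurd (hn _ _ h) (by decide)) h1 h2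
    · rintro ⟨h1, h2⟩
      exact finned_opposite (ad _ _ (by decide)) (ad _ _ (by decide)) (ad _ _ (by decide))
        (ad _ _ (by decide)) (fun h => absurd (hn _ _ h) (by decide))
        (fun h => absurd (hn _ _ h) (by decide)) h1 h2

/-- A fin along a line in a layer has the layer over the line as its combinatorial hyperplane. -/
theorem combHyperplane_rung {m : ℤ → V₁} (hm : ∀ t, T₁.Adj (m t) (m (t + 1))) {q : V₂} {s : Q}
    (hs : ∀ v, v ∈ L s ↔ ∃ t, v = (m t, q)) :
    combHyperplane (mkEdge (finned_adj_rung (G := T₁.boxProd T₂) ((hs _).2 ⟨0, rfl⟩))) =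
      layer T₁ T₂ L (Set.range m) q := by
  have hrung : ∀ t, SameHyperplane
      (mkEdge (finned_adj_rung (G := T₁.boxProd T₂) ((hs _).2 ⟨t, rfl⟩)))
      (mkEdge (finned_adj_rung (G := T₁.boxProd T₂) ((hs _).2 ⟨t + 1, rfl⟩))) := by
    intro t
    have e : (T₁.boxProd T₂).Adj (m t, q) (m (t + 1), q) := boxProd_adj_left.2 (hm t)
    have ht := (hs _).2 ⟨t, rfl⟩
    have ht' := (hs _).2 ⟨t + 1, rfl⟩
    refine .rel _ _ ⟨mkSquare (u := finBase L (m t, q)) (a := finTip ht)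
      (b := finBase L (m (t + 1), q)) (w := finTip ht') ?_ ?_ (finned_adj_rung ht)
      (finned_adj_base.2 e) (finned_adj_tip ht' ht e.symm) (finned_adj_rung ht').symm, ?_, ?_⟩
    · exact fun hn => by simpa using congrArg (fun p : FinVertex L => p.1.2) hn
    · exact fun hn => by simpa using congrArg (fun p : FinVertex L => p.1.2) hn
    · exact edge_ext rfl rfl
    · exact edge_ext rfl rfl
  have hall : ∀ t, SameHyperplane
      (mkEdge (finned_adj_rung (G := T₁.boxProd T₂) ((hs _).2 ⟨0, rfl⟩)))
      (mkEdge (finned_adj_rung (G := T₁.boxProd T₂) ((hs _).2 ⟨t, rfl⟩))) := by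
    intro t
    induction t with
    | zero => exact .refl _
    | succ t ih => exact .trans _ _ _ ih (hrung _)
    | pred t ih =>
      refine .trans _ _ _ ih (.symm _ _ ?_)
      have := hrung (-(t : ℤ) - 1)
      simp only [sub_add_cancel] at this
      exact this
  refine congrArg Subcomplex.span (Set.ext fun v => ⟨?_, ?_⟩)
  · rintro ⟨e', he', rfl⟩
    obtain ⟨h1, h2⟩ := (IsRung.of_sameHyperplane (s := s) he').1 ⟨rfl, rfl⟩
    refine ⟨h1, ?_⟩
    have h3 := edge_adj e'
    rw [finned_adj, h1, h2] at h3
    have h4 : (pt ((ofGraph _).src e')).1.1 = (pt ((ofGraph _).tgt e')).1.1 := by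
      rcases h3 with ⟨h3, -⟩ | ⟨h3, -⟩
      · exact absurd h3 (by simp)
      · exact h3
    obtain ⟨t, ht⟩ := (hs _).1 ((pt ((ofGraph _).tgt e')).2 s h2)
    rw [h4, ht]
    exact ⟨⟨t, rfl⟩, rfl⟩
  · rintro ⟨h1, ⟨t, ht⟩, h2⟩
    refine ⟨_, hall t, pt_injective ?_⟩
    exact (eq_finBase_iff.2 ⟨Prod.ext ht.symm h2, h1⟩).symm

end Layers

end CubeComplex

/-! ### The anti-torus excludes factor systems on the model. -/

namespace AntiTorus

open CubeComplex SimpleGraph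

variable {V₁ V₂ Γ : Type u} [Group Γ] {T₁ : SimpleGraph V₁} {T₂ : SimpleGraph V₂}
  {ρ : Γ →* (T₁.boxProd T₂ ≃g T₁.boxProd T₂)} {g₁ g₂ : Γ} (h : AntiTorus ρ g₁ g₂)

theorem mem_axisLine_zpow (hT₁ : T₁.IsTree) (hT₂ : T₂.IsTree) (k : ℤ) (v : V₁ × V₂) :
    v ∈ h.axisLine ((g₂ ^ k : Γ) : Γ ⧸ Subgroup.zpowers g₁) ↔
      ∃ t, v = (h.drift k (h.ℓ₁ t), h.ℓ₂ (k * h.τ₂)) := by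
  rw [mem_axisLine]
  simp only [h.zpow_apply hT₁ hT₂, zero_add]

/-- Every factor system contains the images of the axis of `g₁` in its layer. -/
theorem layer_mem (hT₁ : T₁.IsTree) (hT₂ : T₂.IsTree)
    {𝔉 : Set (ofGraph h.modelGraph).Subcomplex} (hF : IsFactorSystem 𝔉) (k : ℤ) :
    layer T₁ T₂ h.axisLine (Set.range fun t => h.drift k (h.ℓ₁ t)) (h.ℓ₂ 0) ∈ 𝔉 := by
  have hm := h.isLine_drift hT₁ hT₂ k
  -- The edge is a rung of the strip of g₂ᵏ⟨g₁⟩. Its combinatorial hyperplane is the same line at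
  -- height `ℓ₂ (k * τ₂)`, and moving it to height `ℓ₂ 0` gives a parallel subcomplex.
  refine hF.hyperplanes _
    (mkEdge (finned_adj_rung ((h.mem_axisLine_zpow hT₁ hT₂ k _).2 ⟨0, rfl⟩)))
    (isConvex_layer hT₁ hT₂ hm _) ?_ ?_
  · refine ⟨vtx _ (finBase _ (h.drift k (h.ℓ₁ 0), h.ℓ₂ 0)), mem_layer_verts.2 ⟨rfl, ⟨0, rfl⟩, rfl⟩,
      vtx _ (finBase _ (h.drift k (h.ℓ₁ 1), h.ℓ₂ 0)), mem_layer_verts.2 ⟨rfl, ⟨1, rfl⟩, rfl⟩, ?_⟩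
    intro hn
    have := congrArg (fun v => (pt v).1.1.1) hn
    exact zero_ne_one (hm.injective this)
  · rw [combHyperplane_rung hm.adj (h.mem_axisLine_zpow hT₁ hT₂ k)]
    exact parallel_layer hT₂.connected _ _ _

theorem model_not_hasFactorSystem (hfree : (graphAction ρ).IsFree) (hT₁ : T₁.IsTree)
    (hT₂ : T₂.IsTree) (hf₁ : ∀ v, (T₁.neighborSet v).Finite)
    (hf₂ : ∀ v, (T₂.neighborSet v).Finite) : ¬ (ofGraph h.modelGraph).HasFactorSystem := by
  rintro ⟨𝔉, hF⟩
  obtain ⟨Δ, hΔ⟩ := hF.multiplicity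
  obtain ⟨ξ, hξ⟩ := hF.projections
  choose k hk hfix using h.exists_drift_eq hT₁ hT₂ hf₁
  let D : ℤ → (ofGraph h.modelGraph).Subcomplex := fun k => layer T₁ T₂ h.axisLine
    (Set.range h.ℓ₁ ∩ Set.range fun t => h.drift k (h.ℓ₁ t)) (h.ℓ₂ 0)
  have hD : ∀ (R : ℕ) (t : ℤ), t.natAbs ≤ R →
      vtx _ (finBase _ (h.ℓ₁ t, h.ℓ₂ 0)) ∈ (D (k R)).verts := fun R t ht =>
    mem_layer_verts.2 ⟨rfl, ⟨⟨t, rfl⟩, ⟨t, hfix R t ht⟩⟩, rfl⟩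
  -- With radius `R + ξ` the intersection contains two points of ℓ₁ at distance `ξ`, so the
  -- projection is too large for the exceptional clause and belongs to `𝔉`.
  have hmem : ∀ R : ℕ, D (k (R + ξ)) ∈ 𝔉 := by
    intro R
    have h0 := h.layer_mem hT₁ hT₂ hF 0
    simp only [h.drift_zero] at h0
    have h1 := hξ _ h0 _ (h.layer_mem hT₁ hT₂ hF (k (R + ξ)))
    rw [proj_layer hT₁ hT₂ h.isLine₁ (h.isLine_drift hT₁ hT₂ _) (s := 0) (s' := 0)
      (h.drift_base _).symm] at h1
    refine h1.resolve_right fun h2 => ?_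
    have h3 := h2 _ (hD (R + ξ) 0 (by simp)) _ (hD (R + ξ) ξ (by simp))
    rw [dist_ofGraph, pt_vtx, pt_vtx, dist_finBase (hT₁.connected.boxProd hT₂.connected),
      dist_boxProd hT₁.connected hT₂.connected, h.isLine₁.dist_eq hT₁] at h3
    simp at h3
  have hfin := Set.finite_of_encard_le_coe (hΔ (vtx _ (finBase _ (h.ℓ₁ 0, h.ℓ₂ 0))))
  have := hfin.to_subtype
  -- Bounded multiplicity at (p₁, p₂) forces infinitely many radii to give the same intersection. It
  -- misses some `ℓ₁ t`, but a radius larger than |t| in the same fibre contains that point.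
  obtain ⟨⟨F, hF'⟩, hinf⟩ := Finite.exists_infinite_fiber fun R : ℕ =>
    (⟨D (k (R + ξ)), hmem R, hD _ 0 (by simp)⟩ :
      {F | F ∈ 𝔉 ∧ vtx _ (finBase _ (h.ℓ₁ 0, h.ℓ₂ 0)) ∈ F.verts})
  rw [Set.infinite_coe_iff] at hinf
  -- Positivity of `R₀` puts `ℓ₁ 1` into the fixed segment even if `ξ = 0`.
  obtain ⟨R₀, hR₀, hpos⟩ := hinf.exists_gt 0
  obtain ⟨t, ht⟩ := h.exists_notMem_drift hfree hT₁ hT₂ hf₁ hf₂ (hk (R₀ + ξ))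
    (hfix (R₀ + ξ) 1 (by simp; omega))
  obtain ⟨R, hR, hlt⟩ := hinf.exists_gt t.natAbs
  have e : D (k (R₀ + ξ)) = D (k (R + ξ)) :=
    congrArg Subtype.val ((Set.mem_singleton_iff.1 hR₀).trans (Set.mem_singleton_iff.1 hR).symm)
  have := hD (R + ξ) t (by omega)
  rw [← e] at this
  exact ht (mem_layer_verts.1 this).2.1.2

end AntiTorus

/-! ### Transfer from the model to an arbitrary universal cover. -/

namespace AntiTorus

open CubeComplex SimpleGraph

variable {V₁ V₂ Γ : Type u} [Group Γ] {T₁ : SimpleGraph V₁} {T₂ : SimpleGraph V₂}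
  {ρ : Γ →* (T₁.boxProd T₂ ≃g T₁.boxProd T₂)} {g₁ g₂ : Γ} (h : AntiTorus ρ g₁ g₂)

theorem isCubulation_of_isUniversalCover (hT₁ : T₁.IsTree) (hT₂ : T₂.IsTree)
    (hf₁ : ∀ v, (T₁.neighborSet v).Finite) (hf₂ : ∀ v, (T₂.neighborSet v).Finite)
    (hfree : (graphAction ρ).IsFree) (hcoc : (graphAction ρ).IsCocompact) {X : CubeComplex.{u}}
    {p : X.Hom (h.gluedComplex hfree)} (hp : p.IsUniversalCover) :
    (∃ A : X.Action Γ, A.IsFree ∧ A.IsCubulation ∧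
      ∀ (n : ℕ) (c c' : X.cube n), p.toFun c = p.toFun c' ↔ ∃ g : Γ, (A.act g).toFun c = c') ∧
    ¬ X.HasFactorSystem := by
  obtain ⟨f, g, hgf, hfg, hpf⟩ := exists_iso_of_universalCover hp
    (h.modelMap_isUniversalCover hT₁ hfree hT₂) (h.modelMap_surjective hT₁ hfree hT₂ 0)
  let e : Iso (ofGraph h.modelGraph) X := ⟨f, g, hgf, hfg⟩
  have hA := h.modelAction_isCubulation hT₁ hfree hT₂ hf₁ hf₂ hcoc
  refine ⟨⟨(graphAction h.modelHom).transport e, (h.modelAction_isFree hT₁ hfree hT₂).transport e,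
    ⟨⟨hp.simplyConnected, e.isNonpositivelyCurved hA.cat0.nonpositivelyCurved⟩,
      hA.proper.transport e, hA.cocompact.transport e⟩, fun n c c' => ?_⟩, fun hX => ?_⟩
  · have hc : ∀ c : X.cube n, p.toFun c = (h.modelMap hT₁ hfree hT₂).toFun (g.toFun c) :=
      fun c => by rw [← hpf, hfg]
    rw [hc, hc, h.modelMap_eq_iff]
    refine exists_congr fun γ => ?_
    rw [Action.transport_act]
    exact ⟨fun h1 => (congrArg f.toFun h1).trans (hfg c'),
      fun h1 => (hgf _).symm.trans (congrArg g.toFun h1)⟩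
  · exact h.model_not_hasFactorSystem hfree hT₁ hT₂ hf₁ hf₂ (e.hasFactorSystem hX)

end AntiTorus

/-! ### Cayley trees of free groups -/

namespace SimpleGraph

/-- A graph is acyclic if it has a rank function that separates adjacent vertices, for which every
vertex has at most one neighbour of lower rank. -/
theorem isAcyclic_of_rank {V : Type*} {G : SimpleGraph V} (f : V → ℕ)
    (hne : ∀ v w, G.Adj v w → f v ≠ f w)
    (hlow : ∀ v a b, G.Adj v a → G.Adj v b → f a < f v → f b < f v → a = b) : G.IsAcyclic := by
  classical
  intro v c hc
  -- A cycle is rotated so as to start at a vertex of highest rank; its two neighbours on the cycle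
  -- are distinct and both lower.
  obtain ⟨m, hm, hmax⟩ := c.support.toFinset.exists_max_image f ⟨v, by simp⟩
  rw [List.mem_toFinset] at hm
  have hc' := hc.rotate hm
  have hle : ∀ w ∈ (c.rotate m hm).support, f w ≤ f m := fun w hw =>
    hmax w (by rw [List.mem_toFinset]; exact (Walk.mem_support_rotate_iff c m hm).1 hw)
  have h1 := (c.rotate m hm).adj_snd hc'.not_nil
  have h2 := ((c.rotate m hm).adj_penultimate hc'.not_nil).symm
  refine hc'.snd_ne_penultimate (hlow m _ _ h1 h2 ?_ ?_)
  · exact lt_of_le_of_ne (hle _ (Walk.getVert_mem_support _ _)) (hne _ _ h1).symm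
  · exact lt_of_le_of_ne (hle _ (Walk.getVert_mem_support _ _)) (hne _ _ h2).symm

end SimpleGraph

/-- The inverse of a generator or inverse generator. -/
def invLetter {α : Type*} (x : α × Bool) : α × Bool := (x.1, !x.2)

@[simp] theorem invLetter_invLetter {α : Type*} (x : α × Bool) : invLetter (invLetter x) = x := by
  simp [invLetter]

theorem invLetter_ne {α : Type*} (x : α × Bool) : invLetter x ≠ x := fun h => by
  simpa [invLetter] using congrArg Prod.snd h

namespace FreeGroup

variable {α : Type u}

/-- The element of the free group given by a generator or inverse generator. -/
def letter (x : α × Bool) : FreeGroup α := mk [x]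

theorem letter_true (a : α) : letter (a, true) = of a := rfl

theorem letter_invLetter (x : α × Bool) : letter (invLetter x) = (letter x)⁻¹ := rfl

theorem letter_mul_invLetter (x : α × Bool) : letter x * letter (invLetter x) = 1 := by
  rw [letter_invLetter, mul_inv_cancel]

theorem toWord_letter [DecidableEq α] (x : α × Bool) : (letter x).toWord = [x] := rfl

theorem letter_injective : Function.Injective (letter (α := α)) := by
  classical
  intro x y h
  have := congrArg toWord h
  rw [toWord_letter, toWord_letter] at this
  exact List.singleton_injective this

theorem letter_ne_one (x : α × Bool) : letter x ≠ 1 := by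
  classical
  intro h
  have := congrArg toWord h
  rw [toWord_letter, toWord_one] at this
  exact List.cons_ne_nil _ _ this

theorem letter_mul_eq_one_iff {x y : α × Bool} : letter x * letter y = 1 ↔ y = invLetter x := by
  rw [mul_eq_one_iff_inv_eq, ← letter_invLetter, letter_injective.eq_iff, eq_comm]

theorem letter_sq_ne_one (x : α × Bool) : letter x * letter x ≠ 1 := fun h =>
  invLetter_ne x (letter_mul_eq_one_iff.1 h).symm

theorem letter_induction {P : FreeGroup α → Prop} (one : P 1)
    (mul : ∀ x w, P w → P (letter x * w)) (w : FreeGroup α) : P w := by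
  obtain ⟨L, rfl⟩ := Quot.exists_rep w
  induction L with
  | nil => exact one
  | cons x L ih => exact mul x _ ih

/-- Homomorphisms from a free group are determined on letters. -/
theorem lift_letter {G : Type*} [Group G] (f : α × Bool → G)
    (hf : ∀ x, f (invLetter x) = (f x)⁻¹) (x : α × Bool) :
    FreeGroup.lift (fun a => f (a, true)) (letter x) = f x := by
  obtain ⟨a, _ | _⟩ := x
  · rw [show (a, false) = invLetter (a, true) from rfl, letter_invLetter, _root_.map_inv, hf, letter_true,
      lift_apply_of]
  · rw [letter_true, lift_apply_of]

open Classical in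
-- Recording the first letter in the cancelling case is what makes the neighbour of smaller norm in
-- the Cayley graph unique.
theorem norm_letter_mul (x : α × Bool) (w : FreeGroup α) :
    ((letter x * w).norm = w.norm + 1) ∨
      ((letter x * w).norm + 1 = w.norm ∧ w.toWord.head? = some (invLetter x)) := by
  have h : (letter x * w).toWord = reduce (x :: w.toWord) := by
    rw [toWord_mul, toWord_letter]
    rfl
  rw [norm, norm, h, reduce.cons, reduce_toWord]
  rcases hw : w.toWord with _ | ⟨y, L⟩
  · simp
  · by_cases hxy : x.1 = y.1 ∧ x.2 = !y.2
    · right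
      refine ⟨by simp [hxy], ?_⟩
      simp [invLetter, hxy]
    · left
      simp [hxy]

/-- The Cayley graph of a free group. -/
def cayleyTree (α : Type u) : SimpleGraph (FreeGroup α) where
  Adj v w := ∃ x, w = v * letter x
  symm := ⟨by
    rintro v _ ⟨x, rfl⟩
    exact ⟨invLetter x, by rw [mul_assoc, letter_mul_invLetter, mul_one]⟩⟩
  loopless := ⟨fun v ⟨x, h⟩ => letter_ne_one x (left_eq_mul.1 h)⟩

theorem cayleyTree_adj {v w : FreeGroup α} : (cayleyTree α).Adj v w ↔ ∃ x, w = v * letter x :=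
  Iff.rfl

open Classical in
theorem isTree_cayleyTree : (cayleyTree α).IsTree where
  connected := by
    have h : ∀ w v : FreeGroup α, (cayleyTree α).Reachable v (v * w) := by
      intro w
      induction w using letter_induction with
      | one => exact fun v => by rw [mul_one]
      | mul x w ih =>
        intro v
        rw [← mul_assoc]
        exact (SimpleGraph.Adj.reachable (cayleyTree_adj.2 ⟨x, rfl⟩)).trans (ih _)
    exact ⟨fun v w => by simpa using h (v⁻¹ * w) v⟩
  isAcyclic := by
    -- Edges of the Cayley graph multiply on the right, so `norm_letter_mul` is applied to inverses.
    have h : ∀ (v : FreeGroup α) (x : α × Bool), (v * letter x).norm = v.norm + 1 ∨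
        ((v * letter x).norm + 1 = v.norm ∧ v⁻¹.toWord.head? = some x) := by
      intro v x
      have := norm_letter_mul (invLetter x) v⁻¹
      rwa [letter_invLetter, ← mul_inv_rev, norm_inv_eq, norm_inv_eq, invLetter_invLetter] at this
    refine SimpleGraph.isAcyclic_of_rank norm ?_ ?_
    · rintro v _ ⟨x, rfl⟩
      have := h v x
      omega
    · rintro v _ _ ⟨x, rfl⟩ ⟨y, rfl⟩ h1 h2
      have hx := (h v x).resolve_left (by omega)
      have hy := (h v y).resolve_left (by omega)
      rw [Option.some.inj (hx.2.symm.trans hy.2)]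

theorem finite_neighborSet_cayleyTree [Finite α] (v : FreeGroup α) :
    ((cayleyTree α).neighborSet v).Finite := by
  refine (Set.finite_range fun x => v * letter x).subset ?_
  rintro _ ⟨x, rfl⟩
  exact ⟨x, rfl⟩

/-- The action of a free group on its Cayley graph. -/
def mulLeftIso : FreeGroup α →* (cayleyTree α ≃g cayleyTree α) where
  toFun g :=
    { toEquiv := Equiv.mulLeft g
      map_rel_iff' := by
        intro v w
        simp [cayleyTree_adj, mul_assoc] }
  map_one' := by
    ext w
    simp
  map_mul' g g' := by
    ext w
    simp

@[simp] theorem mulLeftIso_apply (g w : FreeGroup α) : mulLeftIso g w = g * w := rfl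

end FreeGroup

/-! ### Groups acting simply transitively on the vertices of a product of trees -/

/-- The squares of a square complex with one vertex, horizontal edges `α` and vertical edges `β`,
in which any vertical and any horizontal oriented edge span a unique square: the square spanned by
`b` and `a` shows `b a = (act b a) (res b a)`. -/
structure SquareDatum (α β : Type u) where
  act : β × Bool → α × Bool → α × Bool
  res : β × Bool → α × Bool → β × Bool
  act_res : ∀ b a, act (res b a) (invLetter a) = invLetter (act b a)
  res_res : ∀ b a, res (res b a) (invLetter a) = b
  act_act : ∀ b a, act (invLetter b) (act b a) = a
  res_act : ∀ b a, res (invLetter b) (act b a) = invLetter (res b a)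

namespace SquareDatum

open FreeGroup

variable {α β : Type u} (D : SquareDatum α β)

/-- Exchange of the horizontal and the vertical direction. -/
def swap : SquareDatum β α where
  -- Inverting the relation for the pair b⁻¹, a⁻¹ expresses a b as a vertical letter times a
  -- horizontal one.
  act a b := invLetter (D.res (invLetter b) (invLetter a))
  res a b := invLetter (D.act (invLetter b) (invLetter a))
  act_res a b := by
    have := D.res_act (invLetter b) (invLetter a)
    simp only [invLetter_invLetter] at this ⊢
    rw [this, invLetter_invLetter]
  res_res a b := by
    have := D.act_act (invLetter b) (invLetter a)
    simp only [invLetter_invLetter] at this ⊢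
    rw [this, invLetter_invLetter]
  act_act a b := by
    have := D.res_res (invLetter b) (invLetter a)
    simp only [invLetter_invLetter] at this ⊢
    rw [this, invLetter_invLetter]
  res_act a b := by
    have := D.act_res (invLetter b) (invLetter a)
    simp only [invLetter_invLetter] at this ⊢
    rw [this, invLetter_invLetter]

theorem swap_act (a : α × Bool) (b : β × Bool) :
    D.swap.act a b = invLetter (D.res (invLetter b) (invLetter a)) := rfl

theorem swap_res (a : α × Bool) (b : β × Bool) :
    D.swap.res a b = invLetter (D.act (invLetter b) (invLetter a)) := rfl

theorem swap_act_res (b : β × Bool) (a : α × Bool) : D.swap.act (D.act b a) (D.res b a) = b := by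
  have h1 := D.res_res (invLetter b) (D.act b a)
  rw [D.res_act] at h1
  rw [swap_act, h1, invLetter_invLetter]

theorem swap_res_res (b : β × Bool) (a : α × Bool) : D.swap.res (D.act b a) (D.res b a) = a := by
  have h1 := D.act_res (invLetter b) (D.act b a)
  rw [D.res_act, D.act_act] at h1
  rw [swap_res, h1, invLetter_invLetter]

/-- The action of a vertical letter on horizontal words. -/
def wordAct : β × Bool → List (α × Bool) → FreeGroup α
  | _, [] => 1
  | b, a :: L => letter (D.act b a) * wordAct (D.res b a) L

/-- The action of a vertical letter on the vertices of the horizontal tree. -/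
def treeAct (b : β × Bool) : FreeGroup α → FreeGroup α :=
  Quot.lift (D.wordAct b) (by
    rintro _ _ ⟨⟩
    rename_i L₁ L₂ x s
    induction L₁ generalizing b with
    | nil =>
      -- A cancelling pair is sent to a cancelling pair, and the vertical letter comes out unchanged
      -- behind it.
      change letter (D.act b (x, s)) * (letter (D.act (D.res b (x, s)) (invLetter (x, s))) *
        D.wordAct (D.res (D.res b (x, s)) (invLetter (x, s))) L₂) = D.wordAct b L₂
      rw [D.act_res, D.res_res, ← mul_assoc, letter_mul_invLetter, one_mul]
    | cons a L₁ ih => exact congrArg (letter (D.act b a) * ·) (ih _))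

theorem treeAct_one (b : β × Bool) : D.treeAct b 1 = 1 := rfl

theorem treeAct_letter_mul (b : β × Bool) (a : α × Bool) (w : FreeGroup α) :
    D.treeAct b (letter a * w) = letter (D.act b a) * D.treeAct (D.res b a) w := by
  obtain ⟨L, rfl⟩ := Quot.exists_rep w
  rfl

theorem treeAct_letter (b : β × Bool) (a : α × Bool) :
    D.treeAct b (letter a) = letter (D.act b a) := by
  rw [← mul_one (letter a), treeAct_letter_mul, treeAct_one, mul_one]

theorem treeAct_inv (b : β × Bool) (w : FreeGroup α) :
    D.treeAct (invLetter b) (D.treeAct b w) = w := by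
  induction w using letter_induction generalizing b with
  | one => rfl
  | mul a w ih => rw [treeAct_letter_mul, treeAct_letter_mul, D.act_act, D.res_act, ih]

/-- The letter `c` is what `b` has become after passing through `w`. This makes the tree action
respect adjacency, which is multiplication on the right. -/
theorem exists_treeAct_mul (b : β × Bool) (w : FreeGroup α) :
    ∃ c, ∀ a, D.treeAct b (w * letter a) = D.treeAct b w * letter (D.act c a) := by
  induction w using letter_induction generalizing b with
  | one => exact ⟨b, fun a => by rw [one_mul, treeAct_letter, treeAct_one, one_mul]⟩
  | mul x w ih =>
    obtain ⟨c, hc⟩ := ih (D.res b x)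
    exact ⟨c, fun a => by rw [mul_assoc, treeAct_letter_mul, treeAct_letter_mul, hc, mul_assoc]⟩

theorem treeAct_adj (b : β × Bool) {v w : FreeGroup α} (h : (cayleyTree α).Adj v w) :
    (cayleyTree α).Adj (D.treeAct b v) (D.treeAct b w) := by
  obtain ⟨a, rfl⟩ := h
  obtain ⟨c, hc⟩ := D.exists_treeAct_mul b v
  exact ⟨_, hc a⟩

/-- The automorphism of the horizontal tree given by a vertical letter. -/
def treeIso (b : β × Bool) : cayleyTree α ≃g cayleyTree α where
  toFun := D.treeAct b
  invFun := D.treeAct (invLetter b)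
  left_inv := D.treeAct_inv b
  right_inv w := by simpa using D.treeAct_inv (invLetter b) w
  map_rel_iff' := by
    intro v w
    refine ⟨fun h => ?_, D.treeAct_adj b⟩
    have := D.treeAct_adj (invLetter b) h
    simpa [treeAct_inv] using this

theorem treeIso_apply (b : β × Bool) (w : FreeGroup α) : D.treeIso b w = D.treeAct b w := rfl

theorem treeIso_invLetter (b : β × Bool) : D.treeIso (invLetter b) = (D.treeIso b)⁻¹ :=
  RelIso.ext fun _ => rfl

/-- The action of the vertical free group on the horizontal tree. -/
def treeHom : FreeGroup β →* (cayleyTree α ≃g cayleyTree α) :=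
  FreeGroup.lift fun b => D.treeIso (b, true)

theorem treeHom_letter (b : β × Bool) : D.treeHom (letter b) = D.treeIso b :=
  lift_letter D.treeIso D.treeIso_invLetter b

theorem treeHom_apply_one (w : FreeGroup β) : D.treeHom w 1 = 1 := by
  induction w using letter_induction with
  | one => simp
  | mul b w ih =>
    rw [_root_.map_mul, RelIso.mul_apply, ih, treeHom_letter, treeIso_apply, treeAct_one]

/-! #### The fundamental group -/

/-- The defining relations of the fundamental group. -/
def rels : Set (FreeGroup (α ⊕ β)) :=
  Set.range fun x : (β × Bool) × (α × Bool) =>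
    FreeGroup.map Sum.inr (letter x.1) * FreeGroup.map Sum.inl (letter x.2) *
      (FreeGroup.map Sum.inl (letter (D.act x.1 x.2)) *
        FreeGroup.map Sum.inr (letter (D.res x.1 x.2)))⁻¹

/-- The fundamental group of the square complex. -/
abbrev Grp : Type u := PresentedGroup D.rels

/-- The horizontal free subgroup. -/
def horiz : FreeGroup α →* D.Grp := (PresentedGroup.mk D.rels).comp (FreeGroup.map Sum.inl)

/-- The vertical free subgroup. -/
def vert : FreeGroup β →* D.Grp := (PresentedGroup.mk D.rels).comp (FreeGroup.map Sum.inr)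

theorem vert_mul_horiz (b : β × Bool) (a : α × Bool) :
    D.vert (letter b) * D.horiz (letter a) =
      D.horiz (letter (D.act b a)) * D.vert (letter (D.res b a)) := by
  have h : PresentedGroup.mk D.rels _ = 1 := PresentedGroup.one_of_mem
    (Set.mem_range_self (f := fun x : (β × Bool) × (α × Bool) => _) (b, a))
  rw [_root_.map_mul, _root_.map_inv, mul_inv_eq_one] at h
  simpa [vert, horiz] using h

section Lift

variable {G : Type v} [Group G] (f : FreeGroup α →* G) (g : FreeGroup β →* G)

theorem lift_rels
    (hfg : ∀ b a, g (letter b) * f (letter a) = f (letter (D.act b a)) * g (letter (D.res b a)))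
    (r : FreeGroup (α ⊕ β)) (hr : r ∈ D.rels) :
    FreeGroup.lift (Sum.elim (fun a => f (of a)) fun b => g (of b)) r = 1 := by
  have hf : (FreeGroup.lift (Sum.elim (fun a => f (of a)) fun b => g (of b))).comp
      (FreeGroup.map Sum.inl) = f := by
    ext a
    simp
  have hg : (FreeGroup.lift (Sum.elim (fun a => f (of a)) fun b => g (of b))).comp
      (FreeGroup.map Sum.inr) = g := by
    ext a
    simp
  obtain ⟨⟨b, a⟩, rfl⟩ := hr
  rw [_root_.map_mul, _root_.map_inv, mul_inv_eq_one, _root_.map_mul, _root_.map_mul]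
  simp only [← MonoidHom.comp_apply, hf, hg]
  exact hfg b a

/-- Homomorphisms on the fundamental group are pairs of homomorphisms of free groups that are
compatible with the squares. -/
def lift
    (hfg : ∀ b a, g (letter b) * f (letter a) = f (letter (D.act b a)) * g (letter (D.res b a))) :
    D.Grp →* G := PresentedGroup.toGroup (D.lift_rels f g hfg)

variable
    (hfg : ∀ b a, g (letter b) * f (letter a) = f (letter (D.act b a)) * g (letter (D.res b a)))

theorem lift_horiz (w : FreeGroup α) : D.lift f g hfg (D.horiz w) = f w := by
  have : (D.lift f g hfg).comp D.horiz = f := by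
    ext a
    exact PresentedGroup.toGroup.of (D.lift_rels f g hfg)
  exact DFunLike.congr_fun this w

theorem lift_vert (w : FreeGroup β) : D.lift f g hfg (D.vert w) = g w := by
  have : (D.lift f g hfg).comp D.vert = g := by
    ext a
    exact PresentedGroup.toGroup.of (D.lift_rels f g hfg)
  exact DFunLike.congr_fun this w

end Lift

theorem exists_vert_mul_horiz (b : β × Bool) (w : FreeGroup α) :
    ∃ w' c, D.vert (letter b) * D.horiz w = D.horiz w' * D.vert (letter c) := by
  induction w using letter_induction generalizing b with
  | one => exact ⟨1, b, by simp⟩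
  | mul a w ih =>
    obtain ⟨w', c, h⟩ := ih (D.res b a)
    exact ⟨letter (D.act b a) * w', c, by
      rw [_root_.map_mul, ← mul_assoc, vert_mul_horiz, mul_assoc, h, _root_.map_mul, mul_assoc]⟩

/-- The relations move vertical letters to the right past horizontal words. No uniqueness is proved
here; the actions on the two trees take care of it. -/
theorem exists_horiz_mul_vert (γ : D.Grp) : ∃ w u, γ = D.horiz w * D.vert u := by
  obtain ⟨γ, rfl⟩ := PresentedGroup.mk_surjective _ γ
  induction γ using letter_induction with
  | one => exact ⟨1, 1, by simp⟩
  | mul x γ ih =>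
    obtain ⟨w, u, h⟩ := ih
    rw [_root_.map_mul, h]
    rcases x with ⟨a | b, s⟩
    · exact ⟨letter (a, s) * w, u, by rw [_root_.map_mul, mul_assoc]; rfl⟩
    · obtain ⟨w', c, h'⟩ := D.exists_vert_mul_horiz (b, s) w
      refine ⟨w', letter c * u, ?_⟩
      rw [_root_.map_mul, ← mul_assoc, ← mul_assoc, ← h']
      rfl

/-- The action of the fundamental group on the horizontal tree. -/
def horizAction : D.Grp →* (cayleyTree α ≃g cayleyTree α) :=
  D.lift mulLeftIso D.treeHom fun b a => RelIso.ext fun w => by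
    rw [treeHom_letter, treeHom_letter]
    exact D.treeAct_letter_mul b a w

/-- The action of the fundamental group on the vertical tree. -/
def vertAction : D.Grp →* (cayleyTree β ≃g cayleyTree β) :=
  D.lift D.swap.treeHom mulLeftIso fun b a => RelIso.ext fun w => by
    rw [treeHom_letter, treeHom_letter]
    have := D.swap.treeAct_letter_mul (D.act b a) (D.res b a) w
    rw [swap_act_res, swap_res_res] at this
    exact this.symm

theorem horizAction_horiz (w v : FreeGroup α) : D.horizAction (D.horiz w) v = w * v := by
  rw [horizAction, lift_horiz, mulLeftIso_apply]

theorem horizAction_vert (w : FreeGroup β) : D.horizAction (D.vert w) = D.treeHom w := by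
  rw [horizAction, lift_vert]

theorem vertAction_vert (w v : FreeGroup β) : D.vertAction (D.vert w) v = w * v := by
  rw [vertAction, lift_vert, mulLeftIso_apply]

theorem vertAction_horiz (w : FreeGroup α) : D.vertAction (D.horiz w) = D.swap.treeHom w := by
  rw [vertAction, lift_horiz]

/-- The action is transitive on pairs of vertices. -/
theorem exists_apply_one (x : FreeGroup α) (y : FreeGroup β) :
    ∃ γ, D.horizAction γ 1 = x ∧ D.vertAction γ 1 = y := by
  -- The horizontal factor reaches `x` but also moves the vertical tree, which the choice of the
  -- vertical factor compensates.
  refine ⟨D.horiz x * D.vert ((D.swap.treeHom x)⁻¹ y), ?_, ?_⟩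
  · rw [_root_.map_mul, RelIso.mul_apply, horizAction_vert, treeHom_apply_one, horizAction_horiz,
      mul_one]
  · rw [_root_.map_mul, RelIso.mul_apply, vertAction_vert, vertAction_horiz, mul_one,
      RelIso.apply_inv_self]

/-- The action is free on pairs of vertices. -/
theorem eq_one_of_apply_one {γ : D.Grp} (h₁ : D.horizAction γ 1 = 1) (h₂ : D.vertAction γ 1 = 1) :
    γ = 1 := by
  obtain ⟨w, u, rfl⟩ := D.exists_horiz_mul_vert γ
  rw [_root_.map_mul, RelIso.mul_apply, horizAction_vert, treeHom_apply_one, horizAction_horiz,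
    mul_one] at h₁
  subst h₁
  rw [_root_.map_mul, RelIso.mul_apply, vertAction_vert, _root_.map_one, _root_.map_one,
    RelIso.one_apply, mul_one] at h₂
  rw [h₂, _root_.map_one, _root_.map_one, one_mul]

theorem eq_of_apply_one {γ γ' : D.Grp} (h₁ : D.horizAction γ 1 = D.horizAction γ' 1)
    (h₂ : D.vertAction γ 1 = D.vertAction γ' 1) : γ = γ' := by
  refine (inv_mul_eq_one.1 (D.eq_one_of_apply_one (γ := γ'⁻¹ * γ) ?_ ?_)).symm
  · rw [_root_.map_mul, RelIso.mul_apply, h₁, _root_.map_inv, RelIso.inv_apply_self]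
  · rw [_root_.map_mul, RelIso.mul_apply, h₂, _root_.map_inv, RelIso.inv_apply_self]

end SquareDatum

/-! ### Cubes in a product of two trees. -/

namespace CubeComplex

open SimpleGraph

/-- The vertices of a cube in a product of two trees form a product of two sets, each of which
consists of a vertex or of the endpoints of an edge. -/
theorem range_cube_boxProd {V₁ V₂ : Type u} {T₁ : SimpleGraph V₁} {T₂ : SimpleGraph V₂}
    (hT₁ : T₁.IsTree) (hT₂ : T₂.IsTree) {n : ℕ} (c : (ofGraph (T₁.boxProd T₂)).cube n) :
    ∃ x x' y y', (x' = x ∨ T₁.Adj x x') ∧ (y' = y ∨ T₂.Adj y y') ∧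
      ∀ p, p ∈ Set.range c.1 ↔ (p.1 = x ∨ p.1 = x') ∧ (p.2 = y ∨ p.2 = y') := by
  have hn := cube_dim_le (hT₁.boxProd_twoDimensional hT₂) c
  interval_cases n
  · refine ⟨(c.1 fun _ => false).1, (c.1 fun _ => false).1, (c.1 fun _ => false).2,
      (c.1 fun _ => false).2, Or.inl rfl, Or.inl rfl, fun p => ?_⟩
    rw [or_self, or_self, ← Prod.ext_iff]
    refine ⟨?_, fun h => ⟨_, h.symm⟩⟩
    rintro ⟨t, rfl⟩
    exact congrArg c.1 (Subsingleton.elim _ _)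
  · have hr : ∀ p, p ∈ Set.range c.1 ↔ p = c.1 (fun _ => false) ∨ p = c.1 fun _ => true := by
      intro p
      constructor
      · rintro ⟨t, rfl⟩
        rcases corner_one t with rfl | rfl
        · exact Or.inl rfl
        · exact Or.inr rfl
      · rintro (rfl | rfl)
        · exact ⟨_, rfl⟩
        · exact ⟨_, rfl⟩
    have h := c.2.2 (fun _ => false) (fun _ => true) rfl
    refine ⟨(c.1 fun _ => false).1, (c.1 fun _ => true).1, (c.1 fun _ => false).2,
      (c.1 fun _ => true).2, ?_, ?_, fun p => (hr p).trans ?_⟩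
    · rcases boxProd_adj.1 h with h | h
      · exact Or.inr h.1
      · exact Or.inl h.2.symm
    · rcases boxProd_adj.1 h with h | h
      · exact Or.inl h.2.symm
      · exact Or.inr h.1
    · rw [boxProd_adj] at h
      rw [Prod.ext_iff, Prod.ext_iff]
      rcases h with ⟨-, h⟩ | ⟨-, h⟩ <;> rw [h] <;> tauto
  · have hr : ∀ p, p ∈ Set.range c.1 ↔ p = c.1 ![false, false] ∨ p = c.1 ![true, false] ∨
        p = c.1 ![false, true] ∨ p = c.1 ![true, true] := by
      intro p
      constructor
      · rintro ⟨t, rfl⟩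
        rcases corner_two t with rfl | rfl | rfl | rfl <;> simp
      · rintro (rfl | rfl | rfl | rfl) <;> exact ⟨_, rfl⟩
    have h1 := c.2.2 ![false, false] ![true, false] (by decide)
    have h2 := c.2.2 ![false, false] ![false, true] (by decide)
    have h3 := c.2.2 ![true, true] ![true, false] (by decide)
    have h4 := c.2.2 ![true, true] ![false, true] (by decide)
    have hsq := hT₁.boxProd_square hT₂ (fun h => absurd (c.2.1 h) (by decide))
      (fun h => absurd (c.2.1 h) (by decide)) h1 h2 h3 h4
    generalize c.1 ![false, false] = u, c.1 ![true, false] = a, c.1 ![false, true] = b,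
      c.1 ![true, true] = w at *
    rw [boxProd_adj] at h1 h2
    rcases hsq with ⟨e1, e2, rfl⟩ | ⟨e1, e2, rfl⟩
    · refine ⟨u.1, a.1, u.2, b.2, ?_, ?_, fun p => (hr p).trans ?_⟩
      · exact Or.inr (h1.resolve_right fun h => h.1.ne e1.symm).1
      · exact Or.inr (h2.resolve_left fun h => h.1.ne e2.symm).1
      · simp only [Prod.ext_iff, e1, e2]
        tauto
    · refine ⟨u.1, b.1, u.2, a.2, ?_, ?_, fun p => (hr p).trans ?_⟩
      · exact Or.inr (h2.resolve_right fun h => h.1.ne e2.symm).1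
      · exact Or.inr (h1.resolve_left fun h => h.1.ne e1.symm).1
      · simp only [Prod.ext_iff, e1, e2]
        tauto

end CubeComplex

/-! ### Freeness and cocompactness of the action on the product of Cayley trees. -/

namespace SquareDatum

open FreeGroup CubeComplex

variable {α β : Type u} (D : SquareDatum α β)

/-- The action of the fundamental group on the product of trees. -/
def productAction : D.Grp →*
    ((cayleyTree α).boxProd (cayleyTree β) ≃g (cayleyTree α).boxProd (cayleyTree β)) where
  toFun γ :=
    { toEquiv := (D.horizAction γ).toEquiv.prodCongr (D.vertAction γ).toEquiv
      map_rel_iff' := by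
        intro p q
        simp only [SimpleGraph.boxProd_adj, Equiv.prodCongr_apply, Prod.map_fst, Prod.map_snd,
          RelIso.coe_fn_toEquiv, (D.horizAction γ).map_adj_iff, (D.vertAction γ).map_adj_iff,
          (D.horizAction γ).injective.eq_iff, (D.vertAction γ).injective.eq_iff] }
  map_one' := RelIso.ext fun p => by simp
  map_mul' γ γ' := RelIso.ext fun p => Prod.ext
    (DFunLike.congr_fun (_root_.map_mul D.horizAction γ γ') p.1)
    (DFunLike.congr_fun (_root_.map_mul D.vertAction γ γ') p.2)

theorem productAction_apply (γ : D.Grp) (p : FreeGroup α × FreeGroup β) :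
    D.productAction γ p = (D.horizAction γ p.1, D.vertAction γ p.2) := rfl

/-- No square of the complex is rotated by half a turn. -/
def NoRotation : Prop := ∀ a b,
  ¬ (D.act (D.swap.act (invLetter a) b) a = invLetter a ∧
    D.swap.act (D.swap.res a (D.swap.act (invLetter a) b)) b = invLetter b)

theorem vertAction_horiz_letter (a : α × Bool) (w : FreeGroup β) :
    D.vertAction (D.horiz (letter a)) w = D.swap.treeAct a w := by
  rw [vertAction_horiz, treeHom_letter, treeIso_apply]

theorem horizAction_vert_letter (b : β × Bool) (w : FreeGroup α) :
    D.horizAction (D.vert (letter b)) w = D.treeAct b w := by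
  rw [horizAction_vert, treeHom_letter, treeIso_apply]

variable {D} in
-- The element is determined by the image (a, b) of the base vertex, so it is a times a vertical
-- letter. That it also interchanges the remaining coordinates means that it turns the square by
-- half a turn.
theorem NoRotation.false_of_swap (hD : D.NoRotation) {γ : D.Grp} {a : α × Bool} {b : β × Bool}
    (h₁ : D.horizAction γ 1 = letter a) (h₁' : D.horizAction γ (letter a) = 1)
    (h₂ : D.vertAction γ 1 = letter b) (h₂' : D.vertAction γ (letter b) = 1) : False := by
  have hu : D.swap.act a (D.swap.act (invLetter a) b) = b := by
    have := D.swap.act_act (invLetter a) b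
    rwa [invLetter_invLetter] at this
  obtain rfl : γ = D.horiz (letter a) * D.vert (letter (D.swap.act (invLetter a) b)) := by
    refine D.eq_of_apply_one (h₁.trans ?_) (h₂.trans ?_)
    · rw [_root_.map_mul, RelIso.mul_apply, horizAction_vert, treeHom_apply_one, horizAction_horiz,
        mul_one]
    · rw [_root_.map_mul, RelIso.mul_apply, vertAction_vert, mul_one, vertAction_horiz_letter,
        treeAct_letter, hu]
  refine hD a b ⟨?_, ?_⟩
  · rwa [_root_.map_mul, RelIso.mul_apply, horizAction_vert_letter, horizAction_horiz,
      treeAct_letter, letter_mul_eq_one_iff] at h₁'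
  · rwa [_root_.map_mul, RelIso.mul_apply, vertAction_vert, vertAction_horiz_letter,
      treeAct_letter_mul, treeAct_letter, hu, letter_mul_eq_one_iff] at h₂'

theorem horiz_false_of_swap {γ : D.Grp} {a : α × Bool} (h₁ : D.horizAction γ 1 = letter a)
    (h₁' : D.horizAction γ (letter a) = 1) (h₂ : D.vertAction γ 1 = 1) : False := by
  obtain rfl : γ = D.horiz (letter a) := by
    refine D.eq_of_apply_one (h₁.trans ?_) (h₂.trans ?_)
    · rw [horizAction_horiz, mul_one]
    · rw [vertAction_horiz, treeHom_apply_one]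
  rw [horizAction_horiz] at h₁'
  exact letter_sq_ne_one a h₁'

theorem vert_false_of_swap {γ : D.Grp} {b : β × Bool} (h₂ : D.vertAction γ 1 = letter b)
    (h₂' : D.vertAction γ (letter b) = 1) (h₁ : D.horizAction γ 1 = 1) : False := by
  obtain rfl : γ = D.vert (letter b) := by
    refine D.eq_of_apply_one (h₁.trans ?_) (h₂.trans ?_)
    · rw [horizAction_vert, treeHom_apply_one]
    · rw [vertAction_vert, mul_one]
  rw [vertAction_vert] at h₂'
  exact letter_sq_ne_one b h₂'

/-- A cube can be moved to the base vertex. -/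
theorem exists_translate {n : ℕ}
    (c : (ofGraph ((cayleyTree α).boxProd (cayleyTree β))).cube n) :
    ∃ (τ : D.Grp) (x : FreeGroup α) (y : FreeGroup β), (x = 1 ∨ ∃ a, x = letter a) ∧
      (y = 1 ∨ ∃ b, y = letter b) ∧
      ∀ p, p ∈ Set.range (((graphAction D.productAction).act τ).toFun c).1 ↔
        (p.1 = 1 ∨ p.1 = x) ∧ (p.2 = 1 ∨ p.2 = y) := by
  obtain ⟨x, x', y, y', hx, hy, hr⟩ := range_cube_boxProd isTree_cayleyTree isTree_cayleyTree c
  obtain ⟨τ, h₁, h₂⟩ := D.exists_apply_one x y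
  refine ⟨τ⁻¹, (D.horizAction τ)⁻¹ x', (D.vertAction τ)⁻¹ y', ?_, ?_, fun p => ?_⟩
  · refine hx.imp (fun h => ?_) fun h => ?_
    · rw [h, ← h₁, RelIso.inv_apply_self]
    · have := (D.horizAction τ)⁻¹.map_adj_iff.2 h
      rw [← h₁, RelIso.inv_apply_self, cayleyTree_adj] at this
      simpa using this
  · refine hy.imp (fun h => ?_) fun h => ?_
    · rw [h, ← h₂, RelIso.inv_apply_self]
    · have := (D.vertAction τ)⁻¹.map_adj_iff.2 h
      rw [← h₂, RelIso.inv_apply_self, cayleyTree_adj] at this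
      simpa using this
  · have e : p ∈ Set.range (((graphAction D.productAction).act τ⁻¹).toFun c).1 ↔
        D.productAction τ p ∈ Set.range c.1 := by
      refine exists_congr fun t => ?_
      change D.productAction τ⁻¹ (c.1 t) = p ↔ _
      rw [_root_.map_inv, ← (D.productAction τ).injective.eq_iff, RelIso.apply_inv_self]
    rw [e, hr, productAction_apply, ← h₁, ← h₂]
    simp only [(D.horizAction τ).injective.eq_iff, (D.vertAction τ).injective.eq_iff]
    have e₁ : D.horizAction τ p.1 = x' ↔ p.1 = (D.horizAction τ)⁻¹ x' := by
      rw [← (D.horizAction τ).injective.eq_iff (b := (D.horizAction τ)⁻¹ x'),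
        RelIso.apply_inv_self]
    have e₂ : D.vertAction τ p.2 = y' ↔ p.2 = (D.vertAction τ)⁻¹ y' := by
      rw [← (D.vertAction τ).injective.eq_iff (b := (D.vertAction τ)⁻¹ y'),
        RelIso.apply_inv_self]
    rw [e₁, e₂]

variable {D} in
-- After moving the cube to the base vertex, an element preserving it either fixes 1 or swaps 1 with
-- a letter, in each factor. Fixing both gives the identity; a swap in just one factor fails because
-- the square of a letter is nontrivial; swaps in both factors are the half turn.
theorem NoRotation.isFree (hD : D.NoRotation) : (graphAction D.productAction).IsFree := by
  have main : ∀ (γ : D.Grp) {n : ℕ}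
      (c : (ofGraph ((cayleyTree α).boxProd (cayleyTree β))).cube n) (φ : CubeMap n n)
      (x : FreeGroup α) (y : FreeGroup β), (x = 1 ∨ ∃ a, x = letter a) →
      (y = 1 ∨ ∃ b, y = letter b) →
      (∀ p, p ∈ Set.range c.1 ↔ (p.1 = 1 ∨ p.1 = x) ∧ (p.2 = 1 ∨ p.2 = y)) →
      ((graphAction D.productAction).act γ).toFun c = (ofGraph _).face φ c → γ = 1 := by
    intro γ n c φ x y hx hy hr hc
    have hmap : ∀ p : FreeGroup α × FreeGroup β, (p.1 = 1 ∨ p.1 = x) ∧ (p.2 = 1 ∨ p.2 = y) →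
        (D.horizAction γ p.1 = 1 ∨ D.horizAction γ p.1 = x) ∧
        (D.vertAction γ p.2 = 1 ∨ D.vertAction γ p.2 = y) := by
      intro p hp
      obtain ⟨t, rfl⟩ := (hr p).2 hp
      exact (hr (D.productAction γ (c.1 t))).1
        ⟨φ.toFun t, (congrFun (congrArg Subtype.val hc) t).symm⟩
    have h1 := hmap (1, 1) ⟨Or.inl rfl, Or.inl rfl⟩
    have h2 := hmap (x, y) ⟨Or.inr rfl, Or.inr rfl⟩
    have hh : D.horizAction γ 1 = 1 ∨ ∃ a, D.horizAction γ 1 = letter a ∧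
        D.horizAction γ (letter a) = 1 := by
      rcases h1.1 with h | h
      · exact Or.inl h
      · rcases hx with rfl | ⟨a, rfl⟩
        · exact Or.inl h
        · refine Or.inr ⟨a, h, h2.1.resolve_right fun h' => ?_⟩
          exact letter_ne_one a ((D.horizAction γ).injective (h'.trans h.symm))
    have hv : D.vertAction γ 1 = 1 ∨ ∃ b, D.vertAction γ 1 = letter b ∧
        D.vertAction γ (letter b) = 1 := by
      rcases h1.2 with h | h
      · exact Or.inl h
      · rcases hy with rfl | ⟨b, rfl⟩
        · exact Or.inl h
        · refine Or.inr ⟨b, h, h2.2.resolve_right fun h' => ?_⟩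
          exact letter_ne_one b ((D.vertAction γ).injective (h'.trans h.symm))
    rcases hh with hh | ⟨a, ha, ha'⟩ <;> rcases hv with hv | ⟨b, hb, hb'⟩
    · exact D.eq_one_of_apply_one hh hv
    · exact (D.vert_false_of_swap hb hb' hh).elim
    · exact (D.horiz_false_of_swap ha ha' hv).elim
    · exact (hD.false_of_swap ha ha' hb hb').elim
  intro γ n c φ hc
  obtain ⟨τ, x, y, hx, hy, hr⟩ := D.exists_translate c
  have := main (τ * γ * τ⁻¹) _ φ x y hx hy hr (by
    rw [← Action.act_mul, inv_mul_cancel_right, Action.act_mul, hc, Hom.map_face])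
  rwa [conj_eq_one_iff] at this

theorem isCocompact [Finite α] [Finite β] : (graphAction D.productAction).IsCocompact := by
  refine graphAction_isCocompact D.productAction
    (isTree_cayleyTree.boxProd_twoDimensional isTree_cayleyTree)
    (B := ({1} ∪ Set.range letter) ×ˢ ({1} ∪ Set.range letter))
    (((Set.finite_singleton _).union (Set.finite_range _)).prod
      ((Set.finite_singleton _).union (Set.finite_range _))) fun c => ?_
  obtain ⟨τ, x, y, hx, hy, hr⟩ := D.exists_translate c
  refine ⟨τ, fun t => ?_⟩
  obtain ⟨h1, h2⟩ := (hr _).1 ⟨t, rfl⟩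
  constructor
  · rcases h1 with h | h
    · exact Or.inl h
    · exact hx.imp (fun h' => h.trans h') fun ⟨a, h'⟩ => ⟨a, (h.trans h').symm⟩
  · rcases h2 with h | h
    · exact Or.inl h
    · exact hy.imp (fun h' => h.trans h') fun ⟨a, h'⟩ => ⟨a, (h.trans h').symm⟩

theorem zpow_of_injective (a : α) : Function.Injective fun t : ℤ => of a ^ t := fun s t h => by
  have := congrArg (FreeGroup.lift fun _ : α => Multiplicative.ofAdd (1 : ℤ)) h
  simpa [← ofAdd_zsmul] using this

/-- The anti-torus spanned by a horizontal and a vertical generator no powers of which commute. -/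
def antiTorus (a : α) (b : β)
    (hab : ∀ m n : ℤ, m ≠ 0 → n ≠ 0 → ¬ Commute (D.horiz (of a) ^ m) (D.vert (of b) ^ n)) :
    AntiTorus D.productAction (D.horiz (of a)) (D.vert (of b)) where
  ℓ₁ t := of a ^ t
  ℓ₂ t := of b ^ t
  ℓ₁_injective := zpow_of_injective a
  ℓ₂_injective := zpow_of_injective b
  ℓ₁_adj t := ⟨(a, true), zpow_add_one _ _⟩
  ℓ₂_adj t := ⟨(b, true), zpow_add_one _ _⟩
  τ₁ := 1
  τ₂ := 1
  τ₁_pos := one_pos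
  τ₂_pos := one_pos
  translate₁ t := by
    rw [productAction_apply]
    refine Prod.ext ?_ ?_
    · exact (D.horizAction_horiz _ _).trans (zpow_one_add _ _ |>.symm.trans (by simp [add_comm]))
    · simp only [zpow_zero]
      rw [vertAction_horiz, treeHom_apply_one]
  translate₂ t := by
    rw [productAction_apply]
    refine Prod.ext ?_ ?_
    · simp only [zpow_zero]
      rw [horizAction_vert, treeHom_apply_one]
    · exact (D.vertAction_vert _ _).trans (zpow_one_add _ _ |>.symm.trans (by simp [add_comm]))
  not_commute := hab

end SquareDatum

/-! ### An arithmetic lattice in a product of two trees -/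

section QuaternionLattice

open Matrix

/-- The quaternions `1 ± j ± k` of norm 3 and `1 ± 2i`, `1 ± 2j`, `1 ± 2k` of norm 5 satisfy
`b a = ± a' b'` for the following pairs `(a', b')`. -/
def quaternionSquare : Fin 3 × Bool → Fin 2 × Bool → (Fin 2 × Bool) × (Fin 3 × Bool)
  | (0, true), (0, true) => ((1, true), (2, false))
  | (0, true), (0, false) => ((1, false), (2, true))
  | (0, true), (1, true) => ((0, false), (1, false))
  | (0, true), (1, false) => ((0, true), (1, true))
  | (0, false), (0, true) => ((1, false), (1, false))
  | (0, false), (0, false) => ((1, true), (1, true))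
  | (0, false), (1, true) => ((0, true), (2, true))
  | (0, false), (1, false) => ((0, false), (2, false))
  | (1, true), (0, true) => ((1, false), (0, false))
  | (1, true), (0, false) => ((0, true), (2, false))
  | (1, true), (1, true) => ((0, false), (0, true))
  | (1, true), (1, false) => ((1, true), (2, true))
  | (1, false), (0, true) => ((0, false), (2, true))
  | (1, false), (0, false) => ((1, true), (0, false))
  | (1, false), (1, true) => ((1, false), (2, false))
  | (1, false), (1, false) => ((0, true), (0, true))
  | (2, true), (0, true) => ((1, true), (0, true))
  | (2, true), (0, false) => ((0, true), (1, false))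
  | (2, true), (1, true) => ((1, false), (1, true))
  | (2, true), (1, false) => ((0, false), (0, false))
  | (2, false), (0, true) => ((0, false), (1, true))
  | (2, false), (0, false) => ((1, false), (0, true))
  | (2, false), (1, true) => ((0, true), (0, false))
  | (2, false), (1, false) => ((1, true), (1, false))

def quaternionDatum : SquareDatum (Fin 2) (Fin 3) where
  act b a := (quaternionSquare b a).1
  res b a := (quaternionSquare b a).2
  act_res := by decide
  res_res := by decide
  act_act := by decide
  res_act := by decide

theorem quaternionDatum_noRotation : quaternionDatum.NoRotation := by
  unfold SquareDatum.NoRotation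
  decide

/-- The matrix of the rotation by the quaternion `w + xi + yj + zk`, multiplied by its norm. -/
def rotMatrix (w x y z : ℤ) : Matrix (Fin 3) (Fin 3) ℤ :=
  !![w * w + x * x - y * y - z * z, 2 * (x * y - w * z), 2 * (x * z + w * y);
    2 * (x * y + w * z), w * w - x * x + y * y - z * z, 2 * (y * z - w * x);
    2 * (x * z - w * y), 2 * (y * z + w * x), w * w - x * x - y * y + z * z]

/-- The quaternions 1 + j + k and 1 + j − k, with their conjugates as inverse letters. -/
def rotA : Fin 2 × Bool → Matrix (Fin 3) (Fin 3) ℤ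
  | (0, true) => rotMatrix 1 0 1 1
  | (0, false) => rotMatrix 1 0 (-1) (-1)
  | (1, true) => rotMatrix 1 0 1 (-1)
  | (1, false) => rotMatrix 1 0 (-1) 1

/-- The quaternions 1 + 2i, 1 + 2j and 1 + 2k, with their conjugates as inverse letters. -/
def rotB : Fin 3 × Bool → Matrix (Fin 3) (Fin 3) ℤ
  | (0, true) => rotMatrix 1 2 0 0
  | (0, false) => rotMatrix 1 (-2) 0 0
  | (1, true) => rotMatrix 1 0 2 0
  | (1, false) => rotMatrix 1 0 (-2) 0
  | (2, true) => rotMatrix 1 0 0 2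
  | (2, false) => rotMatrix 1 0 0 (-2)

/-- The quaternion relations hold up to sign, and a quaternion and its negative give the same
rotation. -/
theorem rotB_mul_rotA : ∀ b a, rotB b * rotA a =
    rotA (quaternionDatum.act b a) * rotB (quaternionDatum.res b a) := by
  decide

/-- The constant is the square of the norm, because `rotMatrix` is the rotation scaled by the norm.
-/
theorem rotA_mul_rotA : ∀ a, rotA a * rotA (invLetter a) = 9 := by
  decide

theorem rotB_mul_rotB : ∀ a, rotB a * rotB (invLetter a) = 25 := by
  decide

/-- The rotation by a quaternion of norm 3. -/
def rotUnitA (a : Fin 2 × Bool) : (Matrix (Fin 3) (Fin 3) ℚ)ˣ where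
  val := (3 : ℚ)⁻¹ • (Int.castRingHom ℚ).mapMatrix (rotA a)
  inv := (3 : ℚ)⁻¹ • (Int.castRingHom ℚ).mapMatrix (rotA (invLetter a))
  val_inv := by
    rw [smul_mul_smul_comm, ← map_mul, rotA_mul_rotA, map_ofNat, Algebra.smul_def]
    rw [show (9 : Matrix (Fin 3) (Fin 3) ℚ) = algebraMap ℚ _ 9 from (map_ofNat _ 9).symm, ← map_mul]
    norm_num
  inv_val := by
    have := rotA_mul_rotA (invLetter a)
    rw [invLetter_invLetter] at this
    rw [smul_mul_smul_comm, ← map_mul, this, map_ofNat, Algebra.smul_def]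
    rw [show (9 : Matrix (Fin 3) (Fin 3) ℚ) = algebraMap ℚ _ 9 from (map_ofNat _ 9).symm, ← map_mul]
    norm_num

/-- The rotation by a quaternion of norm 5. -/
def rotUnitB (b : Fin 3 × Bool) : (Matrix (Fin 3) (Fin 3) ℚ)ˣ where
  val := (5 : ℚ)⁻¹ • (Int.castRingHom ℚ).mapMatrix (rotB b)
  inv := (5 : ℚ)⁻¹ • (Int.castRingHom ℚ).mapMatrix (rotB (invLetter b))
  val_inv := by
    rw [smul_mul_smul_comm, ← map_mul, rotB_mul_rotB, map_ofNat, Algebra.smul_def]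
    rw [show (25 : Matrix (Fin 3) (Fin 3) ℚ) = algebraMap ℚ _ 25 from (map_ofNat _ 25).symm, ← map_mul]
    norm_num
  inv_val := by
    have := rotB_mul_rotB (invLetter b)
    rw [invLetter_invLetter] at this
    rw [smul_mul_smul_comm, ← map_mul, this, map_ofNat, Algebra.smul_def]
    rw [show (25 : Matrix (Fin 3) (Fin 3) ℚ) = algebraMap ℚ _ 25 from (map_ofNat _ 25).symm, ← map_mul]
    norm_num

theorem rotUnitA_invLetter (a : Fin 2 × Bool) : rotUnitA (invLetter a) = (rotUnitA a)⁻¹ :=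
  Units.ext rfl

theorem rotUnitB_invLetter (b : Fin 3 × Bool) : rotUnitB (invLetter b) = (rotUnitB b)⁻¹ :=
  Units.ext rfl

/-- The representation of the lattice by rotations. -/
def rotHom : quaternionDatum.Grp →* (Matrix (Fin 3) (Fin 3) ℚ)ˣ :=
  quaternionDatum.lift (FreeGroup.lift fun a => rotUnitA (a, true))
    (FreeGroup.lift fun b => rotUnitB (b, true)) fun b a => by
      rw [FreeGroup.lift_letter _ rotUnitA_invLetter, FreeGroup.lift_letter _ rotUnitA_invLetter,
        FreeGroup.lift_letter _ rotUnitB_invLetter, FreeGroup.lift_letter _ rotUnitB_invLetter]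
      refine Units.ext ?_
      change (_ • _) * (_ • _) = (_ • _) * (_ • _)
      rw [smul_mul_smul_comm, smul_mul_smul_comm, ← map_mul, ← map_mul, rotB_mul_rotA, mul_comm]

theorem rotHom_horiz (a : Fin 2) :
    rotHom (quaternionDatum.horiz (FreeGroup.of a)) = rotUnitA (a, true) := by
  rw [rotHom, SquareDatum.lift_horiz, FreeGroup.lift_apply_of]

theorem rotHom_vert (b : Fin 3) :
    rotHom (quaternionDatum.vert (FreeGroup.of b)) = rotUnitB (b, true) := by
  rw [rotHom, SquareDatum.lift_vert, FreeGroup.lift_apply_of]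

/-- The congruences survive multiplication by the block of −3 + 4i, which acts on (p, r) with r ≡ 2p
as −1 modulo 5. They show that 5 does not divide `p`, so that no power of this rotation is trivial.
-/
theorem rotB_pow (n : ℕ) : ∃ p r : ℤ, r % 5 = 2 * p % 5 ∧ p % 5 ≠ 0 ∧
    rotB (0, true) ^ (n + 1) = !![5 ^ (n + 1), 0, 0; 0, p, -r; 0, r, p] := by
  induction n with
  | zero => exact ⟨-3, 4, by decide, by decide, by decide⟩
  | succ n ih =>
    obtain ⟨p, r, h1, h2, h3⟩ := ih
    refine ⟨-3 * p - 4 * r, 4 * p - 3 * r, by omega, by omega, ?_⟩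
    rw [pow_succ', h3, show rotB (0, true) = !![5, 0, 0; 0, -3, -4; 0, 4, -3] by decide]
    ext i j
    fin_cases i <;> fin_cases j <;> simp [Matrix.mul_apply, Fin.sum_univ_three] <;> ring

/-- Modulo 3 the vector stays a nonzero multiple of (1, 1, 2). So it never returns to the first
coordinate axis, the axis of the rotation `rotB (0, true)`. -/
theorem rotA_pow (n : ℕ) : ∃ x y z : ℤ, y % 3 = x % 3 ∧ z % 3 = 2 * x % 3 ∧ x % 3 ≠ 0 ∧
    rotA (0, true) ^ (n + 1) *ᵥ ![1, 0, 0] = ![x, y, z] := by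
  induction n with
  | zero => exact ⟨-1, 2, -2, by decide, by decide, by decide, by decide⟩
  | succ n ih =>
    obtain ⟨x, y, z, h1, h2, h3, h4⟩ := ih
    refine ⟨-x - 2 * y + 2 * z, 2 * x + y + 2 * z, -2 * x + 2 * y + z, by omega, by omega,
      by omega, ?_⟩
    rw [pow_succ', ← Matrix.mulVec_mulVec, h4,
      show rotA (0, true) = !![-1, -2, 2; 2, 1, 2; -2, 2, 1] by decide]
    ext i
    fin_cases i <;> simp [Matrix.mulVec, dotProduct, Fin.sum_univ_three]; ring

theorem not_commute_rot (m n : ℕ) :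
    ¬ Commute (rotA (0, true) ^ (m + 1)) (rotB (0, true) ^ (n + 1)) := by
  intro h
  obtain ⟨p, r, h1, h2, h3⟩ := rotB_pow n
  obtain ⟨x, y, z, h4, h5, h6, h7⟩ := rotA_pow m
  have e : rotB (0, true) ^ (n + 1) *ᵥ ![1, 0, 0] = (5 ^ (n + 1) : ℤ) • ![1, 0, 0] := by
    rw [h3]
    ext i
    fin_cases i <;> simp [Matrix.mulVec, dotProduct, Fin.sum_univ_three]
  have h8 := congrArg (· *ᵥ ![1, 0, 0]) h.eq
  simp only [← Matrix.mulVec_mulVec] at h8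
  rw [e, Matrix.mulVec_smul, h7, h3] at h8
  have e1 := congrFun h8 1
  have e2 := congrFun h8 2
  simp [Matrix.mulVec, dotProduct, Fin.sum_univ_three] at e1 e2
  -- Commutation makes the image of the axis an eigenvector of the power of `rotB` with eigenvalue
  -- 5ⁿ⁺¹. Weighting its last two equations by y and z eliminates `r`; then p = 5ⁿ⁺¹ contradicts the
  -- congruence modulo 5.
  have e3 : (p - 5 ^ (n + 1)) * (y ^ 2 + z ^ 2) = 0 := by linear_combination -y * e1 - z * e2
  have hy : y ≠ 0 := by omega
  have e4 : p - 5 ^ (n + 1) = 0 := (mul_eq_zero.1 e3).resolve_right (by positivity)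
  rw [pow_succ] at e4
  omega

/-- The rotation representation detects it: signs of exponents do not affect commutation, and
clearing the denominators 3 and 5 leads to integer matrices. -/
theorem quaternionDatum_not_commute (m n : ℤ) (hm : m ≠ 0) (hn : n ≠ 0) :
    ¬ Commute (quaternionDatum.horiz (FreeGroup.of 0) ^ m)
      (quaternionDatum.vert (FreeGroup.of 0) ^ n) := by
  intro h
  have h1 := h.map rotHom
  rw [map_zpow, map_zpow, rotHom_horiz, rotHom_vert] at h1
  have h2 : Commute (rotUnitA (0, true) ^ m.natAbs) (rotUnitB (0, true) ^ n.natAbs) := by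
    rw [← zpow_natCast, ← zpow_natCast]
    rcases Int.natAbs_eq m with hm' | hm' <;> rcases Int.natAbs_eq n with hn' | hn' <;>
      rw [hm', hn'] at h1 <;> simpa using h1
  obtain ⟨k, hk⟩ := Nat.exists_eq_succ_of_ne_zero (Int.natAbs_ne_zero.2 hm)
  obtain ⟨l, hl⟩ := Nat.exists_eq_succ_of_ne_zero (Int.natAbs_ne_zero.2 hn)
  rw [hk, hl] at h2
  refine not_commute_rot k l ?_
  have h3 := congrArg Units.val h2.eq
  simp only [Units.val_mul, Units.val_pow_eq_pow_val] at h3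
  change ((3 : ℚ)⁻¹ • _) ^ _ * ((5 : ℚ)⁻¹ • _) ^ _ = ((5 : ℚ)⁻¹ • _) ^ _ * ((3 : ℚ)⁻¹ • _) ^ _ at h3
  rw [smul_pow, smul_pow, smul_mul_smul_comm, smul_mul_smul_comm,
    mul_comm ((5 : ℚ)⁻¹ ^ (l + 1)), ← map_pow, ← map_pow, ← map_mul, ← map_mul] at h3
  have h4 := smul_right_injective _ (by positivity : (3 : ℚ)⁻¹ ^ (k + 1) * (5 : ℚ)⁻¹ ^ (l + 1) ≠ 0) h3
  exact Matrix.map_injective (Int.cast_injective) h4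

theorem exists_cubulation_not_hasFactorSystem :
    ∃ (G : Type) (_ : Group G) (X : CubeComplex.{0}) (A : X.Action G),
      A.IsCubulation ∧ ¬ X.HasFactorSystem := by
  let h := quaternionDatum.antiTorus 0 0 quaternionDatum_not_commute
  have hT₁ := FreeGroup.isTree_cayleyTree (α := Fin 2)
  have hT₂ := FreeGroup.isTree_cayleyTree (α := Fin 3)
  have hf₁ := FreeGroup.finite_neighborSet_cayleyTree (α := Fin 2)
  have hf₂ := FreeGroup.finite_neighborSet_cayleyTree (α := Fin 3)
  have hfree := quaternionDatum_noRotation.isFree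
  exact ⟨quaternionDatum.Grp, inferInstance, _, _,
    h.modelAction_isCubulation hT₁ hfree hT₂ hf₁ hf₂ quaternionDatum.isCocompact,
    h.model_not_hasFactorSystem hfree hT₁ hT₂ hf₁ hf₂⟩

end QuaternionLattice

theorem mainTheorem1 :
    -- there is a cubulated group whose cube complex has no factor system
    (∃ (G : Type) (_ : Group G) (X : CubeComplex.{0}) (A : X.Action G),
      A.IsCubulation ∧ ¬ X.HasFactorSystem) ∧
    -- the concrete construction from anti-tori
    (∀ (V₁ V₂ Γ : Type u) [Group Γ] (T₁ : SimpleGraph V₁) (T₂ : SimpleGraph V₂),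
      T₁.IsTree → T₂.IsTree →
      (∀ v, (T₁.neighborSet v).Finite) → (∀ v, (T₂.neighborSet v).Finite) →
      ∀ (ρ : Γ →* (T₁.boxProd T₂ ≃g T₁.boxProd T₂)) (hfree : (CubeComplex.graphAction ρ).IsFree),
      (CubeComplex.graphAction ρ).IsCocompact →
      ∀ (g₁ g₂ : Γ) (h : AntiTorus ρ g₁ g₂),
      (∀ (a : Γ) (n : ℕ), 2 ≤ n → a ^ n ≠ g₁) → (∀ (a : Γ) (n : ℕ), 2 ≤ n → a ^ n ≠ g₂) →
      (∃ (X : CubeComplex.{u}) (p : X.Hom (h.gluedComplex hfree)), p.IsUniversalCover) ∧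
      ∀ (X : CubeComplex.{u}) (p : X.Hom (h.gluedComplex hfree)), p.IsUniversalCover →
        -- `Γ` acts as the group of deck transformations, and this is a cubulation of `Γ`
        (∃ A : X.Action Γ, A.IsFree ∧ A.IsCubulation ∧
          ∀ (n : ℕ) (c c' : X.cube n), p.toFun c = p.toFun c' ↔
            ∃ g : Γ, (A.act g).toFun c = c') ∧
        ¬ X.HasFactorSystem) := by
  refine ⟨exists_cubulation_not_hasFactorSystem, ?_⟩
  intro V₁ V₂ Γ _ T₁ T₂ hT₁ hT₂ hf₁ hf₂ ρ hfree hcoc g₁ g₂ h _ _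
  exact ⟨⟨_, _, h.modelMap_isUniversalCover hT₁ hfree hT₂⟩,
    fun X p hp => h.isCubulation_of_isUniversalCover hT₁ hT₂ hf₁ hf₂ hfree hcoc hp⟩
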